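/- **Theorem B.** Let $A$ be an abelian group (written additively) that is not periodic, with torsion subgroup $T=T(A)$. An automorphism $\gamma$ of $A$ is called *inertial* if $(H+H\gamma)/H$ is finite for every subgroup $H\le A$. Let $\mathrm{IAut}(A)\le\mathrm{Aut}(A)$ be the group generated by all inertial automorphisms of $A$, and let $\mathrm{IAut}_1(A)$ be the set of all inertial automorphisms of $A$ that induce the identity on $A/T$. For a prime $p$ let $A_p$ be the $p$-component of $A$, and let $\pi_*(A)$ be the set of all primes $p$ such that $A/A_p$ is $p$-divisible and either $A_p$ is finite, or $A$ has finite torsion-free rank and $A_p$ is bounded (that is, $nA_p=0$ for some integer $n>0$). For $p\in\pi_*(A)$ let $\gamma_{(p)}$ be the automorphism of $A$ that is the identity on $A_p$ and multiplication by $p$ on $C$, where $A=A_p\oplus C$. Let $Q(A)$ be the subgroup of $\mathrm{Aut}(A)$ generated by $-1$ and all $\gamma_{(p)}$ with $p\in\pi_*(A)$. Then $\mathrm{IAut}_1(A)$ is a subgroup of $\mathrm{Aut}(A)$, the group $Q(A)$ is contained in the center of $\mathrm{Aut}(A)$, and $$\mathrm{IAut}(A)=\mathrm{IAut}_1(A)\times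 Q(A).$$ Moreover, $Q(A)$ is isomorphic to the multiplicative group of rational numbers generated by $-1$ and the primes in $\pi_*(A)$, by an isomorphism such that each element of $Q(A)$ acts on $A/T$ as multiplication by the corresponding rational number. Furthermore, there is a normal subgroup $\Gamma$ of $\mathrm{IAut}_1(A)$ such that: (i) $\mathrm{IAut}_1(A)/\Gamma$ is locally finite; (ii) the derived subgroup $\Gamma'$ of $\Gamma$ is a periodic abelian group, and each subgroup of $\Gamma'$ is normal in $\Gamma$. -/

import Mathlib

/-- `Aut(A)`: the automorphisms of the abelian group `A` (which are the same as the `ℤ`-linear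
automorphisms), as a multiplicative group under composition. -/
abbrev AutGroup (A : Type*) [AddCommGroup A] : Type _ := A ≃ₗ[ℤ] A

/-- An automorphism `γ` of the abelian group `A` is *inertial* if `(H + Hγ) / H` is finite for
every subgroup `H` of `A`. -/
def IsInertial {A : Type*} [AddCommGroup A] (γ : AutGroup A) : Prop :=
  ∀ H : AddSubgroup A,
    Finite (↥(H ⊔ H.map γ.toAddEquiv.toAddMonoidHom) ⧸
      H.addSubgroupOf (H ⊔ H.map γ.toAddEquiv.toAddMonoidHom))

/-- `γ` induces the identity map on `A / T(A)`. -/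
def ActsTriviallyModTorsion {A : Type*} [AddCommGroup A] (γ : AutGroup A) : Prop :=
  ∀ a : A, ((γ a : A) : A ⧸ AddCommGroup.torsion A) = (a : A ⧸ AddCommGroup.torsion A)

/-- `IAut(A)`: the group generated by all inertial automorphisms of `A`. -/
def IAut (A : Type*) [AddCommGroup A] : Subgroup (AutGroup A) :=
  Subgroup.closure {γ | IsInertial γ}

/-- `IAut₁(A)`: the group of the inertial automorphisms of `A` acting as the identity on `A / T(A)`.
It is defined as the subgroup they generate; that, for non-periodic `A`, it has no other elements is
part of the theorem. -/
def IAutOne (A : Type*) [AddCommGroup A] : Subgroup (AutGroup A) :=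
  Subgroup.closure {γ | IsInertial γ ∧ ActsTriviallyModTorsion γ}

/-- `p` belongs to `π_*(A)`: `p` is a prime, the group `A / A_p` is `p`-divisible, and either `A_p`
is finite, or the torsion-free rank of `A` is finite and `A_p` is bounded. -/
def InPiStar (A : Type*) [AddCommGroup A] (p : ℕ) : Prop :=
  p.Prime ∧
  (∀ x : A ⧸ AddCommGroup.primaryComponent A p,
    ∃ y : A ⧸ AddCommGroup.primaryComponent A p, p • y = x) ∧
  (Finite (AddCommGroup.primaryComponent A p) ∨
    (Module.rank ℤ A < Cardinal.aleph0 ∧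
      ∃ n : ℕ, 0 < n ∧ ∀ x ∈ AddCommGroup.primaryComponent A p, n • x = 0))

/-- `γ` is the automorphism `1 ⊕ p` with respect to a decomposition `A = A_p ⊕ C`. -/
def IsOneSumMul {A : Type*} [AddCommGroup A] (p : ℕ) (γ : AutGroup A) : Prop :=
  ∃ C : AddSubgroup A, IsCompl (AddCommGroup.primaryComponent A p) C ∧
    (∀ a ∈ AddCommGroup.primaryComponent A p, γ a = a) ∧ (∀ c ∈ C, γ c = p • c)

/-- `Q(A)`: the group generated by `-1` and the automorphisms `1 ⊕ p` of `A = A_p ⊕ C`, where `p`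
ranges over `π_*(A)`. -/
def QAut (A : Type*) [AddCommGroup A] : Subgroup (AutGroup A) :=
  Subgroup.closure
    ({LinearEquiv.neg ℤ} ∪ {γ | ∃ p : ℕ, InPiStar A p ∧ IsOneSumMul p γ})

/-- The multiplicative group of rational numbers generated by `-1` and the primes in `π_*(A)`. -/
def ratGroupPiStar (A : Type*) [AddCommGroup A] : Subgroup ℚˣ :=
  Subgroup.closure ({-1} ∪ {u | ∃ p : ℕ, InPiStar A p ∧ (u : ℚ) = (p : ℚ)})

/-- A group is locally finite if all its finitely generated subgroups are finite. -/
def IsLocallyFiniteGroup (G : Type*) [Group G] : Prop :=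
  ∀ K : Subgroup G, K.FG → Finite K

/-! Inertiality is studied for endomorphisms, so that maps such as γ - 1 and nγ - m are available:
inertial endomorphisms are closed under sums and composites, contain the integers, and pass to
invariant subgroups and to quotients.

Torsion. A pigeonhole argument on independent cyclic subgroups shows that an inertial φ preserves
⟨a⟩ for every torsion a keeping clear of one finite subgroup
(`InertialEnd.exists_finite_forall_mem_zmultiples`). Hence φ preserves all cyclic subgroups of A_p
for almost all p. For every p, A_p = X + Y + F with F finite, Y bounded, and the cyclic subgroups of
X and of Y preserved (`InertialEnd.exists_sup_eq_top`). So finitely many inertial maps act locally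
finitely on T, whence inverses exist in IAut₁(A); and two inertial maps with torsion image commute
up to a finite set.

Γ. It consists of the elements of IAut₁(A) preserving every cyclic torsion subgroup (`powerPart`).
In a finitely generated subgroup, fixing a suitable finite set of torsion elements forces membership
in Γ, and torsion elements have finite orbits; hence local finiteness of the quotient. A commutator
ν of Γ fixes T pointwise and ν - 1 has finite image E ≤ T. Such automorphisms commute and have
finite order, and an element of Γ acting on E as the integer l conjugates ν to a power of ν with
exponent l.

Q(A). For p in π_*(A) the component A_p is killed by some p^k and its complement must be p^k A, so
γ_(p) is unique and central. Since A is not periodic, an element of Q(A) is determined by the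
rational number by which it acts on A/T.

Decomposition. An inertial γ acts on A/T as a reduced fraction m/n. The crucial point is that all
primes p dividing m or n lie in π_*(A). The map ε = nγ - m has torsion image and A = ε(A) + pA, and
the p-part ψ of ε maps A_p onto itself. If A_p were unbounded, characters into ℚ/ℤ would produce a
subgroup H with ψ(H) not covered by finitely many cosets of H; if A_p were infinite and the rank
infinite, a suitable free subgroup would do so (`InertialEnd.inPiStar`). Elements q, r of Q(A)
acting as n, m then give γqr⁻¹ in IAut₁(A). -/

/-- An endomorphism `φ` is inertial if `φ(H)` is covered by finitely many cosets of `H`, for every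
subgroup `H`. -/
def InertialEnd {A : Type*} [AddCommGroup A] (φ : A →+ A) : Prop :=
  ∀ H : AddSubgroup A, ∃ S : Set A, S.Finite ∧ ∀ h ∈ H, ∃ s ∈ S, φ h - s ∈ H

/-- The coset form involves no quotient group and makes sense for non-invertible maps; everything
below is proved for it and carried back here. -/
theorem isInertial_iff_inertialEnd {A : Type*} [AddCommGroup A] (γ : AutGroup A) :
    IsInertial γ ↔ InertialEnd (γ : A ≃ₗ[ℤ] A).toAddEquiv.toAddMonoidHom := by
  constructor
  · intro h H
    have := h H
    refine ⟨Set.range fun q : (↥(H ⊔ H.map γ.toAddEquiv.toAddMonoidHom) ⧸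
      H.addSubgroupOf (H ⊔ H.map γ.toAddEquiv.toAddMonoidHom)) => (q.out : A),
      Set.finite_range _, fun x hx => ?_⟩
    have hm : γ.toAddEquiv.toAddMonoidHom x ∈ H ⊔ H.map γ.toAddEquiv.toAddMonoidHom :=
      AddSubgroup.mem_sup_right (AddSubgroup.mem_map_of_mem _ hx)
    refine ⟨_, ⟨(QuotientAddGroup.mk ⟨_, hm⟩), rfl⟩, ?_⟩
    have := QuotientAddGroup.eq.1 (Quotient.out_eq
      (QuotientAddGroup.mk (s := H.addSubgroupOf (H ⊔ H.map γ.toAddEquiv.toAddMonoidHom))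
        ⟨_, hm⟩))
    rw [AddSubgroup.mem_addSubgroupOf] at this
    rw [sub_eq_neg_add]
    exact this
  · intro h H
    obtain ⟨S, hS, hS'⟩ := h H
    have key : ∀ k : ↥(H ⊔ H.map γ.toAddEquiv.toAddMonoidHom), ∃ s : S, (k : A) - s ∈ H := by
      rintro ⟨k, hk⟩
      obtain ⟨x, hx, _, ⟨y, hy, rfl⟩, rfl⟩ := AddSubgroup.mem_sup.1 hk
      obtain ⟨s, hs, hsy⟩ := hS' y hy
      refine ⟨⟨s, hs⟩, ?_⟩
      simp only [add_sub_assoc]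
      exact H.add_mem hx hsy
    choose f hf using key
    have := hS.to_subtype
    refine Finite.of_injective (fun q : (↥(H ⊔ H.map γ.toAddEquiv.toAddMonoidHom) ⧸
      H.addSubgroupOf (H ⊔ H.map γ.toAddEquiv.toAddMonoidHom)) => f q.out) fun q q' hq => ?_
    rw [← Quotient.out_eq q, ← Quotient.out_eq q']
    refine QuotientAddGroup.eq.2 ?_
    rw [AddSubgroup.mem_addSubgroupOf]
    have h1 := hf q.out
    have h2 := hf q'.out
    simp only at hq
    rw [hq] at h1
    have := H.sub_mem h2 h1
    rw [sub_sub_sub_cancel_right, sub_eq_neg_add] at this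
    exact this

/-! ### Closure properties and pigeonhole consequences of inertiality. -/

namespace InertialEnd

variable {A : Type*} [AddCommGroup A]

/-- The cosets may be chosen to be represented by images of elements of `H`. -/
theorem exists_finite_subset {φ : A →+ A} (h : InertialEnd φ) (H : AddSubgroup A) :
    ∃ S : Set A, S.Finite ∧ S ⊆ H ∧ ∀ h ∈ H, ∃ s ∈ S, φ h - φ s ∈ H := by
  obtain ⟨S, hS, hS'⟩ := h H
  classical
  choose! f hf using hS'
  have hfin : (f '' (H : Set A)).Finite := hS.subset (by
    rintro _ ⟨x, hx, rfl⟩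
    exact (hf x hx).1)
  obtain ⟨t, hts, ht⟩ := Set.exists_subset_bijOn (H : Set A) f
  refine ⟨t, (ht.finite_iff_finite).2 hfin, hts, fun x hx => ?_⟩
  have : f x ∈ f '' t := ht.image_eq ▸ Set.mem_image_of_mem f hx
  obtain ⟨y, hy, hyx⟩ := this
  refine ⟨y, hy, ?_⟩
  have h1 := (hf x hx).2
  have h2 := (hf y (hts hy)).2
  rw [hyx] at h2
  have := H.sub_mem h1 h2
  rwa [sub_sub_sub_cancel_right] at this

theorem add {φ ψ : A →+ A} (hφ : InertialEnd φ) (hψ : InertialEnd ψ) : InertialEnd (φ + ψ) := by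
  intro H
  obtain ⟨S, hS, hS'⟩ := hφ H
  obtain ⟨R, hR, hR'⟩ := hψ H
  refine ⟨Set.image2 (· + ·) S R, hS.image2 _ hR, fun x hx => ?_⟩
  obtain ⟨s, hs, hs'⟩ := hS' x hx
  obtain ⟨r, hr, hr'⟩ := hR' x hx
  refine ⟨s + r, ⟨s, hs, r, hr, rfl⟩, ?_⟩
  have := H.add_mem hs' hr'
  rw [AddMonoidHom.add_apply]
  convert this using 1
  abel

/-- Enlarging by subgroups: if `ψ(H) ⊆ φ(H)` for all `H`, then `ψ` is inertial with `φ`. -/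
theorem of_map_le {φ ψ : A →+ A} (hφ : InertialEnd φ)
    (h : ∀ H : AddSubgroup A, H.map ψ ≤ H.map φ) : InertialEnd ψ := by
  intro H
  obtain ⟨S, hS, hS'⟩ := hφ H
  refine ⟨S, hS, fun x hx => ?_⟩
  obtain ⟨y, hy, hxy⟩ := h H (AddSubgroup.mem_map_of_mem ψ hx)
  obtain ⟨s, hs, hsy⟩ := hS' y hy
  exact ⟨s, hs, hxy ▸ hsy⟩

/-- An endomorphism mapping each element to one of its multiples is inertial. -/
theorem of_forall_mem_zmultiples {φ : A →+ A} (h : ∀ x, φ x ∈ AddSubgroup.zmultiples x) :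
    InertialEnd φ := fun H =>
  ⟨{0}, Set.finite_singleton 0, fun x hx => ⟨0, rfl, by
    rw [sub_zero]
    exact (AddSubgroup.zmultiples_le_of_mem hx) (h x)⟩⟩

theorem zsmul_id (n : ℤ) : InertialEnd (n • AddMonoidHom.id A) :=
  of_forall_mem_zmultiples fun _ => ⟨n, rfl⟩

theorem neg {φ : A →+ A} (hφ : InertialEnd φ) : InertialEnd (-φ) :=
  hφ.of_map_le fun H => by
    rintro _ ⟨x, hx, rfl⟩
    exact ⟨-x, H.neg_mem hx, by simp⟩

theorem sub {φ ψ : A →+ A} (hφ : InertialEnd φ) (hψ : InertialEnd ψ) : InertialEnd (φ - ψ) := by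
  rw [sub_eq_add_neg]
  exact hφ.add hψ.neg

theorem zsmul {φ : A →+ A} (hφ : InertialEnd φ) (n : ℤ) : InertialEnd (n • φ) :=
  hφ.of_map_le fun H => by
    rintro _ ⟨x, hx, rfl⟩
    exact ⟨n • x, H.zsmul_mem hx n, by simp⟩

theorem comp {φ ψ : A →+ A} (hφ : InertialEnd φ) (hψ : InertialEnd ψ) :
    InertialEnd (φ.comp ψ) := by
  intro H
  obtain ⟨S, hS, hS'⟩ := hψ H
  obtain ⟨R, hR, hR'⟩ := hφ H
  refine ⟨Set.image2 (· + ·) (φ '' S) R, (hS.image φ).image2 _ hR, fun x hx => ?_⟩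
  obtain ⟨s, hs, hs'⟩ := hS' x hx
  obtain ⟨r, hr, hr'⟩ := hR' _ hs'
  refine ⟨φ s + r, ⟨_, ⟨s, hs, rfl⟩, r, hr, rfl⟩, ?_⟩
  rw [AddMonoidHom.comp_apply]
  rw [map_sub] at hr'
  rwa [← sub_sub]

/-- Pulling back along an injective homomorphism. -/
theorem of_injective {B : Type*} [AddCommGroup B] {φ : A →+ A} {ψ : B →+ B} (hφ : InertialEnd φ)
    (f : B →+ A) (hf : Function.Injective f) (hc : ∀ b, f (ψ b) = φ (f b)) : InertialEnd ψ := by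
  intro H
  obtain ⟨S, hS, hSH, hS'⟩ := hφ.exists_finite_subset (H.map f)
  refine ⟨ψ '' (f ⁻¹' S), (hS.preimage hf.injOn).image ψ, fun x hx => ?_⟩
  obtain ⟨s, hs, hs'⟩ := hS' (f x) (AddSubgroup.mem_map_of_mem f hx)
  obtain ⟨y, hy, rfl⟩ := hSH hs
  refine ⟨ψ y, ⟨y, hs, rfl⟩, ?_⟩
  rw [← hc, ← hc, ← map_sub] at hs'
  exact (AddSubgroup.mem_map_iff_mem hf).1 hs'

/-- Pushing forward along a surjective homomorphism. -/
theorem of_surjective {B : Type*} [AddCommGroup B] {φ : A →+ A} {ψ : B →+ B} (hφ : InertialEnd φ)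
    (f : A →+ B) (hf : Function.Surjective f) (hc : ∀ a, f (φ a) = ψ (f a)) : InertialEnd ψ := by
  intro H
  obtain ⟨S, hS, hS'⟩ := hφ (H.comap f)
  refine ⟨f '' S, hS.image f, fun x hx => ?_⟩
  obtain ⟨a, rfl⟩ := hf x
  obtain ⟨s, hs, hs'⟩ := hS' a hx
  refine ⟨f s, ⟨s, hs, rfl⟩, ?_⟩
  rw [← hc, ← map_sub]
  exact hs'

/-- Among infinitely many elements of `H` there are two with images congruent modulo `H`. -/
theorem exists_ne_sub_mem {φ : A →+ A} (hφ : InertialEnd φ) (H : AddSubgroup A) {ι : Type*}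
    [Infinite ι] (f : ι → A) (hf : ∀ i, f i ∈ H) : ∃ i j, i ≠ j ∧ φ (f i) - φ (f j) ∈ H := by
  obtain ⟨S, hS, hS'⟩ := hφ H
  have : ∀ i, ∃ s : S, φ (f i) - s ∈ H := fun i => by
    obtain ⟨s, hs, h⟩ := hS' _ (hf i)
    exact ⟨⟨s, hs⟩, h⟩
  choose g hg using this
  have := hS.to_subtype
  obtain ⟨i, j, hij, hgij⟩ := Finite.exists_ne_map_eq_of_infinite g
  refine ⟨i, j, hij, ?_⟩
  have h1 := hg i
  have h2 := hg j
  rw [hgij] at h1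
  have := H.sub_mem h1 h2
  rwa [sub_sub_sub_cancel_right] at this

/-- If `φ(H) ∩ H = 0`, then `φ(H)` is finite. -/
theorem finite_image_of_disjoint {φ : A →+ A} (hφ : InertialEnd φ) (H : AddSubgroup A)
    (h : ∀ x ∈ H, φ x ∈ H → φ x = 0) : (φ '' (H : Set A)).Finite := by
  by_contra hinf
  have : Infinite (φ '' (H : Set A)) := Set.infinite_coe_iff.2 hinf
  choose f hfH hf using fun y : φ '' (H : Set A) => y.2
  obtain ⟨i, j, hij, hmem⟩ := hφ.exists_ne_sub_mem H f hfH
  rw [← map_sub] at hmem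
  have := h _ (H.sub_mem (hfH i) (hfH j)) hmem
  rw [map_sub, sub_eq_zero, hf, hf] at this
  exact hij (Subtype.ext this)

/-- Every element has a positive multiple whose image under `φ` is a multiple of it. -/
theorem exists_zsmul_eq {φ : A →+ A} (hφ : InertialEnd φ) (x : A) :
    ∃ k l : ℤ, 0 < k ∧ k • φ x = l • x := by
  obtain ⟨i, j, hij, l, hl⟩ := hφ.exists_ne_sub_mem (AddSubgroup.zmultiples x)
    (fun n : ℤ => n • x) (fun n => ⟨n, rfl⟩)
  simp only [map_zsmul] at hl
  rw [← sub_smul] at hl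
  rcases lt_or_gt_of_ne hij with h | h
  · refine ⟨j - i, -l, by lia, ?_⟩
    have : (j - i) • φ x = - ((i - j) • φ x) := by rw [← neg_smul]; congr 1; ring
    rw [this, ← hl, neg_smul]
  · exact ⟨i - j, l, by lia, hl.symm⟩

/-- A `p`-divisible subgroup contained in `φ(H)`, consisting of elements of `p`-power order, is
contained in `H`. -/
theorem le_of_divisible {φ : A →+ A} (hφ : InertialEnd φ) {p : ℕ} (H D : AddSubgroup A)
    (hD : ∀ x ∈ D, ∃ y ∈ D, p • y = x) (hp : ∀ x ∈ D, ∃ k : ℕ, p ^ k • x = 0)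
    (hle : D ≤ H.map φ) : D ≤ H := by
  intro x hx
  choose! f hf hf' using hD
  -- A chain of successive `p`-th parts of `x` inside `D`; each term lies in φ(H), so pigeonhole
  -- makes two of them congruent modulo `H`.
  set s : ℕ → A := fun n => f^[n] x with hs
  have hsD : ∀ n, s n ∈ D := by
    intro n
    induction n with
    | zero => exact hx
    | succ n ih =>
      simp only [hs, Function.iterate_succ_apply']
      exact hf _ ih
  have hsp : ∀ n m, p ^ n • s (n + m) = s m := by
    intro n
    induction n with
    | zero => intro m; simp
    | succ n ih =>
      intro m
      rw [pow_succ, mul_smul]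
      have : p • s (n + 1 + m) = s (n + m) := by
        have h1 : n + 1 + m = (n + m) + 1 := by lia
        rw [h1]
        simp only [hs, Function.iterate_succ_apply']
        exact hf' _ (hsD (n + m))
      rw [this, ih]
  -- work with the differences of two congruent terms
  choose g hgH hg using fun n => hle (hsD n)
  obtain ⟨i, j, hij, hmem⟩ := hφ.exists_ne_sub_mem H g hgH
  simp only [hg] at hmem
  obtain ⟨k, hk⟩ := hp x hx
  wlog hlt : i < j generalizing i j
  · refine this j i hij.symm ?_ (by lia)
    have := H.neg_mem hmem
    rwa [neg_sub] at this
  -- `s i - s j = (p ^ (j - i) - 1) • s j`, and `p ^ (j - i) - 1` is invertible on `s j`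
  have hsi : s i = p ^ (j - i) • s j := by
    have := hsp (j - i) i
    rw [Nat.sub_add_cancel hlt.le] at this
    exact this.symm
  have hsj : p ^ (j + k) • s j = 0 := by
    have := hsp j 0
    rw [add_comm, pow_add, mul_smul]
    rw [add_zero] at this
    rw [this]
    exact hk
  set d := p ^ (j - i) with hd
  have hmem2 : ((d : ℤ) - 1) • s j ∈ H := by
    rw [sub_smul, one_smul, natCast_zsmul, ← hsi]
    exact hmem
  have hsjH : s j ∈ H := by
    have hdvd : ((d : ℤ) - 1) ∣ (d : ℤ) ^ (j + k) - 1 := by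
      simpa using sub_dvd_pow_sub_pow (d : ℤ) 1 (j + k)
    obtain ⟨c, hc⟩ := hdvd
    have h1 : (d ^ (j + k)) • s j = 0 := by
      rw [hd, ← pow_mul]
      have : j + k ≤ (j - i) * (j + k) := Nat.le_mul_of_pos_left _ (by lia)
      obtain ⟨e, he⟩ := Nat.exists_eq_add_of_le this
      rw [he, pow_add, mul_comm, mul_smul, hsj, smul_zero]
    have h2 : ((d : ℤ) ^ (j + k) - 1) • s j = - s j := by
      rw [sub_smul, one_smul]
      have : ((d : ℤ) ^ (j + k)) • s j = 0 := by
        rw [← h1, ← natCast_zsmul]; push_cast; rfl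
      rw [this, zero_sub]
    have h3 : ((d : ℤ) ^ (j + k) - 1) • s j ∈ H := by
      rw [hc, mul_comm, mul_smul]
      exact H.zsmul_mem hmem2 c
    rw [h2] at h3
    simpa using h3
  have : s 0 = p ^ j • s j := by
    have := hsp j 0
    simpa using this.symm
  have h0 : s 0 = x := rfl
  rw [← h0, this]
  exact H.nsmul_mem hsjH _

end InertialEnd

/-! ### Torsion elements, finite subgroups, and endomorphisms preserving cyclic subgroups. -/

section TorsionGeneralities

variable {A : Type*} [AddCommGroup A]

theorem finite_closure_of_isOfFinAddOrder {S : Set A} (hS : S.Finite)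
    (h : ∀ s ∈ S, IsOfFinAddOrder s) : Finite (AddSubgroup.closure S) := by
  have hfg : AddGroup.FG (AddSubgroup.closure S) :=
    (AddGroup.fg_iff_addSubgroup_fg _).2 ⟨hS.toFinset, by simp⟩
  refine AddCommGroup.finite_of_fg_isAddTorsion _ fun x => ?_
  have hle : AddSubgroup.closure S ≤ AddCommGroup.torsion A :=
    (AddSubgroup.closure_le _).2 fun s hs => h s hs
  exact (AddSubgroup.subtype_injective _).isOfFinAddOrder_iff.1 (hle x.2)

theorem finite_zmultiples_of_isOfFinAddOrder {x : A} (h : IsOfFinAddOrder x) :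
    Finite (AddSubgroup.zmultiples x) := by
  rw [AddSubgroup.zmultiples_eq_closure]
  exact finite_closure_of_isOfFinAddOrder (Set.finite_singleton x) (by simpa using h)

theorem finite_sup {F E : AddSubgroup A} (hF : Finite F) (hE : Finite E) :
    Finite (F ⊔ E : AddSubgroup A) := by
  have : ((F ⊔ E : AddSubgroup A) : Set A).Finite := by
    refine (Set.Finite.image2 (· + ·) (Set.toFinite (F : Set A)) (Set.toFinite (E : Set A))).subset
      fun x hx => ?_
    obtain ⟨y, hy, z, hz, rfl⟩ := AddSubgroup.mem_sup.1 hx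
    exact ⟨y, hy, z, hz, rfl⟩
  exact this.to_subtype

theorem finite_finset_sup {ι : Type*} (s : Finset ι) (F : ι → AddSubgroup A)
    (h : ∀ i ∈ s, Finite (F i)) : Finite (s.sup F : AddSubgroup A) := by
  classical
  induction s using Finset.induction_on with
  | empty => rw [Finset.sup_empty]; infer_instance
  | insert i s _ ih =>
    rw [Finset.sup_insert]
    exact finite_sup (h i (Finset.mem_insert_self _ _))
      (ih fun j hj => h j (Finset.mem_insert_of_mem hj))

theorem isOfFinAddOrder_of_mem_finite {F : AddSubgroup A} [Finite F] {x : A} (hx : x ∈ F) :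
    IsOfFinAddOrder x := by
  exact F.subtype.isOfFinAddOrder (isOfFinAddOrder_of_finite (⟨x, hx⟩ : F))

theorem isOfFinAddOrder_of_nsmul {x : A} {n : ℕ} (hn : 0 < n) (h : n • x = 0) :
    IsOfFinAddOrder x := isOfFinAddOrder_iff_nsmul_eq_zero.2 ⟨n, hn, h⟩

theorem isOfFinAddOrder_of_zsmul {x : A} {n : ℤ} (hn : n ≠ 0) (h : n • x = 0) :
    IsOfFinAddOrder x := isOfFinAddOrder_iff_zsmul_eq_zero.2 ⟨n, hn, h⟩

theorem isOfFinAddOrder_of_zsmul_isOfFinAddOrder {x : A} {n : ℤ} (hn : n ≠ 0)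
    (h : IsOfFinAddOrder (n • x)) : IsOfFinAddOrder x := by
  obtain ⟨m, hm, hmx⟩ := isOfFinAddOrder_iff_zsmul_eq_zero.1 h
  exact isOfFinAddOrder_of_zsmul (mul_ne_zero hm hn) (by rw [mul_smul, hmx])

/-- To show that a torsion element lies in a subgroup it suffices to consider its multiples of
prime power order. -/
theorem mem_of_forall_prime_power {t : A} (ht : IsOfFinAddOrder t) (L : AddSubgroup A)
    (h : ∀ s ∈ AddSubgroup.zmultiples t, ∀ p k : ℕ, p.Prime → p ^ k • s = 0 → s ∈ L) : t ∈ L := by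
  obtain ⟨n, hn, hnt⟩ := ht.exists_nsmul_eq_zero
  have key : ∀ n : ℕ, 0 < n → ∀ s ∈ AddSubgroup.zmultiples t, n • s = 0 → s ∈ L := by
    intro n
    induction n using Nat.recOnPosPrimePosCoprime with
    | prime_pow p k hp _ => exact fun _ s hs h0 => h s hs p k hp h0
    | zero => exact fun h0 => absurd h0 (lt_irrefl 0)
    | one =>
      intro _ s _ h0
      rw [one_smul] at h0
      rw [h0]; exact L.zero_mem
    | coprime a b ha hb hab iha ihb =>
      intro _ s hs h0
      have hbez := Nat.gcd_eq_gcd_ab a b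
      rw [hab.gcd_eq_one] at hbez
      have : s = (a.gcdA b) • a • s + (a.gcdB b) • b • s := by
        rw [← natCast_zsmul, ← natCast_zsmul s b, ← mul_smul, ← mul_smul, ← add_smul,
          mul_comm, mul_comm (a.gcdB b), ← hbez]
        simp
      rw [this]
      refine L.add_mem (L.zsmul_mem (ihb (by lia) _ ?_ ?_) _) (L.zsmul_mem (iha (by lia) _ ?_ ?_) _)
      · exact AddSubgroup.nsmul_mem _ hs _
      · rw [← mul_smul, mul_comm, h0]
      · exact AddSubgroup.nsmul_mem _ hs _
      · rw [← mul_smul, h0]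
  exact key n hn t (AddSubgroup.mem_zmultiples t) hnt

/-- An endomorphism of a finite subgroup preserving all cyclic subgroups is a multiplication. -/
theorem exists_zsmul_of_finite (F : AddSubgroup A) [Finite F] (φ : A →+ A)
    (h : ∀ x ∈ F, φ x ∈ AddSubgroup.zmultiples x) : ∃ l : ℤ, ∀ x ∈ F, φ x = l • x := by
  classical
  obtain ⟨ι, _, n, hn, ⟨e⟩⟩ := AddCommGroup.equiv_directSum_zmod_of_finite' F
  let g : ι → F := fun i => e.symm (DirectSum.of (fun i => ZMod (n i)) i 1)
  choose! c hc using fun x (hx : x ∈ F) => AddSubgroup.mem_zmultiples_iff.1 (h x hx)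
  -- The multiplier of the sum of the generators serves all of them: comparing the `i`-th components
  -- of φ(t) = c(t) t gives c(g i) g i = c(t) g i.
  set t : F := ∑ i, g i with ht
  have hgl : ∀ i, c (g i) • g i = c t • g i := by
    have h1 : ∑ i, c (g i) • g i = ∑ i, c t • g i := by
      apply Subtype.ext
      rw [← Finset.smul_sum, ← ht]
      push_cast
      rw [hc t t.2, ht]
      push_cast
      rw [map_sum]
      exact Finset.sum_congr rfl fun i _ => hc _ (g i).2
    intro i
    have h2 := congrArg (fun z => e z i) h1
    simp only [map_sum, map_zsmul] at h2
    rw [DFinsupp.finsetSum_apply, DFinsupp.finsetSum_apply, Finset.sum_eq_single i,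
      Finset.sum_eq_single i] at h2
    · apply e.injective
      rw [map_zsmul, map_zsmul]
      ext j
      by_cases hj : j = i
      · subst hj; exact h2
      · have : (e (g i)) j = 0 := by
          simp only [g, AddEquiv.apply_symm_apply]
          exact DirectSum.of_eq_of_ne _ _ _ hj
        change c (g i) • (e (g i)) j = c t • (e (g i)) j
        rw [this, smul_zero, smul_zero]
    · intro j _ hj
      change c t • (e (g j)) i = 0
      have : (e (g j)) i = 0 := by
        simp only [g, AddEquiv.apply_symm_apply]
        exact DirectSum.of_eq_of_ne _ _ _ hj.symm
      rw [this, smul_zero]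
    · simp
    · intro j _ hj
      change c (g j) • (e (g j)) i = 0
      have : (e (g j)) i = 0 := by
        simp only [g, AddEquiv.apply_symm_apply]
        exact DirectSum.of_eq_of_ne _ _ _ hj.symm
      rw [this, smul_zero]
    · simp
  refine ⟨c t, fun x hx => ?_⟩
  have hgen : ∀ z : DirectSum ι (fun i => ZMod (n i)), φ (e.symm z : F) = c t • ((e.symm z : F) : A) := by
    intro z
    induction z using DirectSum.induction_on with
    | zero => simp
    | of i a =>
      have : NeZero (n i) := ⟨by have := hn i; lia⟩
      have ha : DirectSum.of (fun i => ZMod (n i)) i a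
          = a.val • DirectSum.of (fun i => ZMod (n i)) i 1 := by
        rw [← map_nsmul]; simp
      rw [ha, map_nsmul]
      change φ ((a.val • g i : F) : A) = c t • ((a.val • g i : F) : A)
      push_cast
      rw [map_nsmul, ← hc _ (g i).2, smul_comm (c t)]
      congr 1
      have := congrArg (Subtype.val) (hgl i)
      simpa using this
    | add y z hy hz => rw [map_add, AddSubgroup.coe_add, map_add, hy, hz, smul_add]
  have := hgen (e ⟨x, hx⟩)
  simpa using this

/-- On the finite group ⟨x, y⟩ the map is multiplication by a single integer, which is congruent to
`k` modulo the order of `x` and so modulo that of `y`. An element of largest order thus determines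
the action. -/
theorem zsmul_eq_of_addOrderOf_dvd {N : AddSubgroup A} {φ : A →+ A}
    (h : ∀ x ∈ N, φ x ∈ AddSubgroup.zmultiples x) {x y : A} (hx : x ∈ N) (hy : y ∈ N)
    (hxt : IsOfFinAddOrder x) (hdvd : addOrderOf y ∣ addOrderOf x) {k : ℤ} (hk : φ x = k • x) :
    φ y = k • y := by
  have hyt : IsOfFinAddOrder y := by
    rw [← addOrderOf_pos_iff]
    exact Nat.pos_of_dvd_of_pos hdvd hxt.addOrderOf_pos
  have hfin : Finite (AddSubgroup.closure {x, y}) :=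
    finite_closure_of_isOfFinAddOrder (by simp) (by
      rintro s (rfl | rfl)
      · exact hxt
      · exact hyt)
  obtain ⟨l, hl⟩ := exists_zsmul_of_finite (AddSubgroup.closure {x, y}) φ fun z hz =>
    h z ((AddSubgroup.closure_le N).2 (by
      rintro s (rfl | rfl)
      · exact hx
      · exact hy) hz)
  have h1 := hl x (AddSubgroup.subset_closure (by simp))
  have h2 := hl y (AddSubgroup.subset_closure (by simp))
  rw [h2]
  rw [hk] at h1
  have h3 : (k - l) • x = 0 := by rw [sub_smul, h1, sub_self]
  have h4 : (l - k) • y = 0 := by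
    rw [← addOrderOf_dvd_iff_zsmul_eq_zero] at h3 ⊢
    rw [← neg_sub, dvd_neg]
    exact (Int.natCast_dvd_natCast.2 hdvd).trans h3
  rwa [sub_smul, sub_eq_zero] at h4

/-- Gluing homomorphisms on a group of elements of `p`-power order. -/
theorem exists_hom_of_compatible {N C : Type*} [AddCommGroup N] [AddCommGroup C] {p : ℕ}
    (hN : ∀ x : N, ∃ k : ℕ, p ^ k • x = 0) (f : ℕ → N →+ C)
    (hf : ∀ m x, p ^ m • x = 0 → f (m + 1) x = f m x) :
    ∃ g : N →+ C, ∀ m x, p ^ m • x = 0 → g x = f m x := by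
  have hle : ∀ m j x, p ^ m • x = 0 → f (m + j) x = f m x := by
    intro m j x hx
    induction j with
    | zero => rfl
    | succ j ih =>
      rw [← add_assoc, hf, ih]
      rw [pow_add, mul_comm, mul_smul, hx, smul_zero]
  choose v hv using hN
  have hv' : ∀ m x, p ^ m • x = 0 → f (v x) x = f m x := by
    intro m x hx
    rw [← hle _ m x (hv x), ← hle _ (v x) x hx, add_comm]
  refine ⟨AddMonoidHom.mk' (fun x => f (v x) x) fun x y => ?_, fun m x hx => hv' m x hx⟩
  have hx : p ^ (v x + v y) • x = 0 := by rw [pow_add, mul_comm, mul_smul, hv, smul_zero]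
  have hy : p ^ (v x + v y) • y = 0 := by rw [pow_add, mul_smul, hv, smul_zero]
  rw [hv' _ _ hx, hv' _ _ hy, hv' (v x + v y) (x + y) (by rw [smul_add, hx, hy, add_zero]),
    map_add]

end TorsionGeneralities

/-! ### Inertial maps preserve almost all cyclic torsion subgroups. -/

/-- For an inertial endomorphism `φ` there is a finite subgroup `F` such that `φ` preserves `⟨a⟩`
for each torsion element `a` such that `⟨a, φ a⟩` meets `F` trivially. -/
theorem InertialEnd.exists_finite_forall_mem_zmultiples {A : Type*} [AddCommGroup A] {φ : A →+ A}
    (hφ : InertialEnd φ) : ∃ F : AddSubgroup A, Finite F ∧ ∀ a, IsOfFinAddOrder a →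
      Disjoint (AddSubgroup.zmultiples a ⊔ AddSubgroup.zmultiples (φ a)) F →
      φ a ∈ AddSubgroup.zmultiples a := by
  by_contra! hcon
  let B : A → AddSubgroup A := fun a => AddSubgroup.zmultiples a ⊔ AddSubgroup.zmultiples (φ a)
  have hB : ∀ a, IsOfFinAddOrder a → Finite (B a) := fun a ha =>
    finite_sup (finite_zmultiples_of_isOfFinAddOrder ha)
      (finite_zmultiples_of_isOfFinAddOrder (φ.isOfFinAddOrder ha))
  -- If no finite subgroup works, bad elements a_n can be picked one after another, each with B(a_n)
  -- disjoint from a finite F_n containing all earlier B(a_m). On K = Σ⟨a_n⟩ a congruence φ(a_i) ≡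
  -- φ(a_j) mod K with i < j then forces φ(a_j) ∈ ⟨a_j⟩.
  obtain ⟨f, hf, hr⟩ := exists_seq_of_forall_finset_exists
    (P := fun s : A × AddSubgroup A => IsOfFinAddOrder s.1 ∧ Finite s.2 ∧ Disjoint (B s.1) s.2 ∧
      φ s.1 ∉ AddSubgroup.zmultiples s.1)
    (r := fun s s' => s.2 ⊔ B s.1 ≤ s'.2) (fun s hs => by
      have hfin : Finite (s.sup fun x => x.2 ⊔ B x.1 : AddSubgroup A) :=
        finite_finset_sup _ _ fun x hx => finite_sup (hs x hx).2.1 (hB _ (hs x hx).1)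
      obtain ⟨a, ha, had, han⟩ := hcon _ hfin
      exact ⟨(a, s.sup fun x => x.2 ⊔ B x.1), ⟨ha, hfin, had, han⟩,
        fun x hx => Finset.le_sup (f := fun x : A × AddSubgroup A => x.2 ⊔ B x.1) hx⟩)
  set a : ℕ → A := fun n => (f n).1 with ha
  set F : ℕ → AddSubgroup A := fun n => (f n).2 with hF
  have hdisj : ∀ n, Disjoint (B (a n)) (F n) := fun n => (hf n).2.2.1
  have hFle : ∀ m n, m < n → F m ⊔ B (a m) ≤ F n := hr
  have haB : ∀ n, a n ∈ B (a n) := fun n =>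
    AddSubgroup.mem_sup_left (AddSubgroup.mem_zmultiples _)
  have hφB : ∀ n, φ (a n) ∈ B (a n) := fun n =>
    AddSubgroup.mem_sup_right (AddSubgroup.mem_zmultiples _)
  let H : ℕ → AddSubgroup A := fun n => ⨆ i : Fin n, AddSubgroup.zmultiples (a i)
  have hHF : ∀ n, H n ≤ F n := fun n => iSup_le fun i =>
    (AddSubgroup.zmultiples_le_of_mem (haB i)).trans (le_sup_right.trans (hFle i n i.2))
  have hHsucc : ∀ n, H (n + 1) = H n ⊔ AddSubgroup.zmultiples (a n) := by
    intro n
    apply le_antisymm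
    · refine iSup_le fun i => ?_
      rcases Nat.lt_succ_iff_lt_or_eq.1 i.2 with h | h
      · exact (le_iSup (fun i : Fin n => AddSubgroup.zmultiples (a i)) ⟨i, h⟩).trans le_sup_left
      · rw [h]; exact le_sup_right
    · refine sup_le (iSup_le fun i => ?_) ?_
      · exact le_iSup (fun i : Fin (n + 1) => AddSubgroup.zmultiples (a i)) i.castSucc
      · exact le_iSup (fun i : Fin (n + 1) => AddSubgroup.zmultiples (a i)) (Fin.last n)
  have hmono : Monotone H := monotone_nat_of_le_succ fun n => by rw [hHsucc]; exact le_sup_left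
  -- elements of `H k` lying in `F n + B n` lie in `H (n + 1)`
  have hdesc : ∀ n j, ∀ h ∈ H (n + 1 + j), h ∈ F n ⊔ B (a n) → h ∈ H (n + 1) := by
    intro n j
    induction j with
    | zero => exact fun h hh _ => hh
    | succ j ih =>
      intro h hh hmem
      rw [← add_assoc, hHsucc] at hh
      obtain ⟨x, hx, y, hy, rfl⟩ := AddSubgroup.mem_sup.1 hh
      have hyF : y ∈ F (n + 1 + j) := by
        have h1 := hFle n (n + 1 + j) (by lia) hmem
        have h2 := AddSubgroup.sub_mem _ h1 (hHF _ hx)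
        rwa [add_sub_cancel_left] at h2
      have hy0 : y = 0 := AddSubgroup.disjoint_def.1 (hdisj (n + 1 + j))
        ((AddSubgroup.zmultiples_le_of_mem (haB _)) hy) hyF
      rw [hy0, add_zero] at hmem ⊢
      exact ih x hx hmem
  set K : AddSubgroup A := ⨆ n, H n with hK
  have haK : ∀ n, a n ∈ K := fun n => by
    refine (le_iSup H (n + 1)) ?_
    rw [hHsucc]
    exact AddSubgroup.mem_sup_right (AddSubgroup.mem_zmultiples _)
  obtain ⟨i, j, hij, hmem⟩ := hφ.exists_ne_sub_mem K a haK
  wlog hlt : i < j generalizing i j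
  · refine this j i hij.symm ?_ (by lia)
    have := K.neg_mem hmem
    rwa [neg_sub] at this
  obtain ⟨k, hk⟩ := (AddSubgroup.mem_iSup_of_directed hmono.directed_le).1 hmem
  have h1 : φ (a i) - φ (a j) ∈ F j ⊔ B (a j) :=
    AddSubgroup.sub_mem _ (AddSubgroup.mem_sup_left (hFle i j hlt (AddSubgroup.mem_sup_right
      (hφB i)))) (AddSubgroup.mem_sup_right (hφB j))
  have h2 := hdesc j k _ (hmono (by lia) hk) h1
  rw [hHsucc] at h2
  obtain ⟨x, hx, y, hy, hxy⟩ := AddSubgroup.mem_sup.1 h2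
  have h3 : φ (a j) + y = φ (a i) - x := by
    rw [eq_sub_iff_add_eq, add_assoc, add_comm y x, hxy]; abel
  have h4 : φ (a j) + y = 0 := by
    refine AddSubgroup.disjoint_def.1 (hdisj j) ?_ ?_
    · exact AddSubgroup.add_mem _ (hφB j) (AddSubgroup.zmultiples_le_of_mem (haB _) hy)
    · rw [h3]
      exact AddSubgroup.sub_mem _ (hFle i j hlt (AddSubgroup.mem_sup_right (hφB i))) (hHF _ hx)
  apply (hf j).2.2.2
  rw [eq_neg_of_add_eq_zero_left h4]
  exact AddSubgroup.neg_mem _ hy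

/-! ### Characters into ℚ/ℤ with unbounded image. -/

section Characters

variable {A : Type*} [AddCommGroup A]

theorem exists_character_extension (N : AddSubgroup A) (g : N →+ AddCircle (1 : ℚ)) :
    ∃ f : A →+ AddCircle (1 : ℚ), ∀ x : N, f x = g x := by
  obtain ⟨f, hf⟩ := CharacterModule.dual_surjective_of_injective (R := ℤ)
    (N.subtype.toIntLinearMap) (AddSubgroup.subtype_injective N) g
  exact ⟨f, fun x => DFunLike.congr_fun hf x⟩

/-- A subgroup of unbounded elements of `p`-power order has an unbounded image under some
character. -/
theorem exists_character_unbounded {p : ℕ} (N : AddSubgroup A)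
    (hN : ∀ x ∈ N, ∃ k : ℕ, p ^ k • x = 0) (hunb : ∀ k : ℕ, ∃ x ∈ N, p ^ k • x ≠ 0) :
    ∃ g : A →+ AddCircle (1 : ℚ), ∀ k : ℕ, ∃ x ∈ N, p ^ k • g x ≠ 0 := by
  have hN' : ∀ x : N, ∃ k : ℕ, p ^ k • x = 0 := fun x => by
    obtain ⟨k, hk⟩ := hN x x.2
    exact ⟨k, Subtype.ext hk⟩
  -- A state (g, n) stands for a character whose values on the elements killed by p^n are frozen.
  -- The next state keeps these values and has one not killed by p^n.
  have step : ∀ s : (N →+ AddCircle (1 : ℚ)) × ℕ, ∃ s' : (N →+ AddCircle (1 : ℚ)) × ℕ,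
      s.2 < s'.2 ∧ (∀ x, p ^ s.2 • x = 0 → s'.1 x = s.1 x) ∧
      ∃ x, p ^ s'.2 • x = 0 ∧ p ^ s.2 • s'.1 x ≠ 0 := by
    rintro ⟨g, n⟩
    obtain ⟨x, hxN, hx⟩ := hunb (n + n)
    obtain ⟨k, hk⟩ := hN' ⟨x, hxN⟩
    have hk' : p ^ (n + 1 + k) • (⟨x, hxN⟩ : N) = 0 := by rw [pow_add, mul_smul, hk, smul_zero]
    have hx' : p ^ (n + n) • (⟨x, hxN⟩ : N) ≠ 0 := fun h => hx (congrArg Subtype.val h)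
    -- One factor p^n makes the correction p^n f vanish on the frozen part; the other appears
    -- because p^n times the new value at x must be f(p^(2n) x) ≠ 0.
    obtain ⟨f, hf⟩ : ∃ f : N →+ AddCircle (1 : ℚ), f (p ^ (n + n) • (⟨x, hxN⟩ : N)) ≠ 0 :=
      CharacterModule.exists_character_apply_ne_zero_of_ne_zero hx'
    by_cases h : p ^ n • g ⟨x, hxN⟩ = 0
    · refine ⟨(g + p ^ n • f, n + 1 + k), by simp only; lia, fun y hy => ?_, ⟨x, hxN⟩, hk', ?_⟩
      · simp only [AddMonoidHom.add_apply, AddMonoidHom.nsmul_apply]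
        rw [← map_nsmul, hy, map_zero, add_zero]
      · simp only [AddMonoidHom.add_apply, AddMonoidHom.nsmul_apply]
        rw [smul_add, h, zero_add, ← mul_smul, ← pow_add, ← map_nsmul]
        exact hf
    · exact ⟨(g, n + 1 + k), by simp only; lia, fun y _ => rfl, ⟨x, hxN⟩, hk', h⟩
  choose next hlt heq hne using step
  let s : ℕ → (N →+ AddCircle (1 : ℚ)) × ℕ := fun n => next^[n] (0, 0)
  have hs : ∀ n, s (n + 1) = next (s n) := fun n => Function.iterate_succ_apply' _ _ _
  have hge : ∀ n, n ≤ (s n).2 := by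
    intro n
    induction n with
    | zero => exact Nat.zero_le _
    | succ n ih =>
      have := hlt (s n)
      rw [← hs] at this
      lia
  have hpow : ∀ (m n : ℕ) (x : N), m ≤ n → p ^ m • x = 0 → p ^ n • x = 0 := by
    intro m n x hmn h
    obtain ⟨d, rfl⟩ := Nat.exists_eq_add_of_le hmn
    rw [pow_add, mul_comm, mul_smul, h, smul_zero]
  obtain ⟨g, hg⟩ := exists_hom_of_compatible hN' (fun n => (s n).1) (fun m x hx => by
    rw [hs]
    exact heq (s m) x (hpow _ _ x (hge m) hx))
  -- `g` agrees with the `n`-th approximation on elements killed by `p ^ (s n).2`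
  have hstab : ∀ n j x, p ^ (s n).2 • x = 0 → (s (n + j)).1 x = (s n).1 x := by
    intro n j x hx
    induction j with
    | zero => rfl
    | succ j ih =>
      rw [← add_assoc, hs, heq, ih]
      refine hpow _ _ x ?_ hx
      have hmono : Monotone fun n => (s n).2 := monotone_nat_of_le_succ fun n => by
        have := hlt (s n)
        rw [← hs] at this
        exact this.le
      exact hmono (by lia)
  obtain ⟨f, hf⟩ := exists_character_extension N g
  refine ⟨f, fun k => ?_⟩
  obtain ⟨x, hx0, hx⟩ := hne (s k)
  rw [← hs] at hx0 hx
  refine ⟨x, x.2, fun h0 => hx ?_⟩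
  have h1 : g x = (s (k + 1)).1 x := by
    obtain ⟨m, hm⟩ := hN' x
    rw [hg (k + 1 + m) x (hpow m _ x (by lia) hm)]
    exact hstab (k + 1) m x hx0
  rw [hf, h1] at h0
  obtain ⟨d, hd⟩ := Nat.exists_eq_add_of_le (hge k)
  rw [hd, pow_add, mul_comm, mul_smul, h0, smul_zero]

/-- An unbounded image of a group of elements of `p`-power order under a character contains all
elements of `p`-power order. -/
theorem exists_apply_eq_of_unbounded {p : ℕ} (hp : p.Prime) (N : AddSubgroup A)
    (hN : ∀ x ∈ N, ∃ k : ℕ, p ^ k • x = 0) {g : A →+ AddCircle (1 : ℚ)}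
    (hunb : ∀ k : ℕ, ∃ x ∈ N, p ^ k • g x ≠ 0) {y : AddCircle (1 : ℚ)} {j : ℕ}
    (hy : p ^ j • y = 0) : ∃ x ∈ N, g x = y := by
  obtain ⟨x, hxN, hx⟩ := hunb j
  have hex : ∃ i : ℕ, p ^ i • g x = 0 := by
    obtain ⟨k, hk⟩ := hN x hxN
    exact ⟨k, by rw [← map_nsmul, hk, map_zero]⟩
  classical
  obtain ⟨i, hi, hi', hij⟩ : ∃ i, p ^ (i + 1) • g x = 0 ∧ p ^ i • g x ≠ 0 ∧ j ≤ i := by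
    have h1 := Nat.find_spec hex
    have hgt : j < Nat.find hex := by
      by_contra! hle
      apply hx
      obtain ⟨d, hd⟩ := Nat.exists_eq_add_of_le hle
      rw [hd, pow_add, mul_comm, mul_smul, h1, smul_zero]
    obtain ⟨i, hi⟩ : ∃ i, Nat.find hex = i + 1 := ⟨Nat.find hex - 1, by lia⟩
    refine ⟨i, hi ▸ h1, Nat.find_min hex (by lia), by lia⟩
  obtain ⟨a, ha⟩ := QuotientAddGroup.mk_surjective (g x)
  obtain ⟨b, hb⟩ := QuotientAddGroup.mk_surjective y
  have hz : ∀ (n : ℕ) (q : ℚ), n • (QuotientAddGroup.mk q : AddCircle (1 : ℚ)) = 0 ↔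
      ∃ m : ℤ, (m : ℚ) = n * q := by
    intro n q
    rw [← nsmul_eq_mul]
    change ((n • q : ℚ) : AddCircle (1 : ℚ)) = 0 ↔ _
    rw [AddCircle.coe_eq_zero_iff]
    simp
  rw [← ha, Ne, hz] at hi'
  rw [← ha, hz] at hi
  rw [← hb, hz] at hy
  obtain ⟨m, hm⟩ := hi
  obtain ⟨l, hl⟩ := hy
  have hp0 : (p : ℚ) ≠ 0 := by exact_mod_cast hp.ne_zero
  -- Here g(x) is m / p^(i+1) modulo 1, of exact order p^(i+1), so m is prime to p and the multiples
  -- of g(x) exhaust the elements killed by p^(i+1), in particular `y`.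
  have hmp : IsCoprime m ((p : ℤ) ^ (i + 1)) := by
    apply IsCoprime.pow_right
    rw [isCoprime_comm, Prime.coprime_iff_not_dvd (Nat.prime_iff_prime_int.1 hp)]
    rintro ⟨c, rfl⟩
    apply hi'
    refine ⟨c, ?_⟩
    push_cast at hm ⊢
    rw [pow_succ] at hm
    apply mul_left_cancel₀ hp0
    rw [hm]; ring
  obtain ⟨u, v, huv⟩ := hmp
  refine ⟨(l * p ^ (i + 1 - j) * u) • x, N.zsmul_mem hxN _, ?_⟩
  rw [map_zsmul, ← ha, ← hb]
  change (((l * p ^ (i + 1 - j) * u) • a : ℚ) : AddCircle (1 : ℚ)) = (b : AddCircle (1 : ℚ))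
  rw [← sub_eq_zero, ← AddCircle.coe_sub, AddCircle.coe_eq_zero_iff]
  refine ⟨-(l * p ^ (i + 1 - j) * v), ?_⟩
  have huv' : (u : ℚ) * m + v * p ^ (i + 1) = 1 := by exact_mod_cast huv
  have hpj : (p : ℚ) ^ (i + 1) = p ^ j * p ^ (i + 1 - j) := by
    rw [← pow_add]; congr 1; lia
  simp only [zsmul_eq_mul, mul_one]
  push_cast at hm hl ⊢
  have hpi : (p : ℚ) ^ (i + 1) ≠ 0 := pow_ne_zero _ hp0
  apply mul_left_cancel₀ hpi
  have e1 : (p : ℚ) ^ (i + 1) * b = p ^ (i + 1 - j) * l := by rw [hl, hpj]; ring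
  have e2 : (p : ℚ) ^ (i + 1) * (l * p ^ (i + 1 - j) * u * a - b)
      = l * p ^ (i + 1 - j) * u * (p ^ (i + 1) * a) - p ^ (i + 1) * b := by ring
  rw [e2, e1, ← hm]
  linear_combination (-(l * (p : ℚ) ^ (i + 1 - j))) * huv'

/-- If g is unbounded on `N` but kills d, take f with f(d) ≠ 0. Either f is itself unbounded on `N`,
or f is bounded there and g + f remains unbounded. -/
theorem exists_character_unbounded_ne_zero {p : ℕ} (N : AddSubgroup A)
    (hN : ∀ x ∈ N, ∃ k : ℕ, p ^ k • x = 0) (hunb : ∀ k : ℕ, ∃ x ∈ N, p ^ k • x ≠ 0)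
    {d : A} (hd : d ≠ 0) :
    ∃ g : A →+ AddCircle (1 : ℚ), (∀ k : ℕ, ∃ x ∈ N, p ^ k • g x ≠ 0) ∧ g d ≠ 0 := by
  obtain ⟨g, hg⟩ := exists_character_unbounded N hN hunb
  obtain ⟨f, hf⟩ : ∃ f : A →+ AddCircle (1 : ℚ), f d ≠ 0 :=
    CharacterModule.exists_character_apply_ne_zero_of_ne_zero hd
  by_cases h1 : g d = 0
  · by_cases h2 : ∀ k : ℕ, ∃ x ∈ N, p ^ k • f x ≠ 0
    · exact ⟨f, h2, hf⟩
    · push Not at h2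
      obtain ⟨m, hm⟩ := h2
      refine ⟨g + f, fun k => ?_, by rwa [AddMonoidHom.add_apply, h1, zero_add]⟩
      obtain ⟨x, hx, hgx⟩ := hg (m + k)
      refine ⟨x, hx, fun h0 => hgx ?_⟩
      have : p ^ m • p ^ k • (g + f) x = 0 := by rw [h0, smul_zero]
      rw [AddMonoidHom.add_apply, smul_comm, smul_add, hm x hx, add_zero] at this
      rwa [add_comm, pow_add, mul_smul]
  · exact ⟨g, hg, h1⟩

end Characters

/-! ### Structure of inertial endomorphisms of abelian p-groups. -/

section PGroups

variable {T : Type*} [AddCommGroup T]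

/-- A subgroup maximal among those meeting `F` trivially. -/
theorem exists_maximal_disjoint (F : AddSubgroup T) : ∃ M : AddSubgroup T, Disjoint M F ∧
    ∀ x, x ∉ M → ∃ m ∈ M, ∃ k : ℤ, m + k • x ∈ F ∧ m + k • x ≠ 0 := by
  obtain ⟨M, hM⟩ := zorn_le₀ {M : AddSubgroup T | Disjoint M F} (fun c hc hchain => by
    rcases c.eq_empty_or_nonempty with rfl | hne
    · exact ⟨⊥, disjoint_bot_left, by simp⟩
    · refine ⟨sSup c, ?_, fun M hM => le_sSup hM⟩
      refine AddSubgroup.disjoint_def.2 fun {x} hx hxF => ?_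
      obtain ⟨M, hMc, hxM⟩ := (AddSubgroup.mem_sSup_of_directedOn hne hchain.directedOn).1 hx
      exact AddSubgroup.disjoint_def.1 (hc hMc) hxM hxF)
  refine ⟨M, hM.prop, fun x hx => ?_⟩
  by_contra! hcon
  have hd : Disjoint (M ⊔ AddSubgroup.zmultiples x) F := by
    refine AddSubgroup.disjoint_def.2 fun {y} hy hyF => ?_
    obtain ⟨m, hm, _, ⟨k, rfl⟩, rfl⟩ := AddSubgroup.mem_sup.1 hy
    exact hcon m hm k hyF
  exact hx (hM.le_of_ge hd le_sup_left
    (AddSubgroup.mem_sup_right (AddSubgroup.mem_zmultiples x)))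

/-- A group of elements of `p`-power order with finitely many elements of order `p` is the sum of
its `p ^ j`-multiples and of its elements killed by some fixed `p ^ k`. -/
theorem exists_eq_pow_smul_add_of_finite_socle {p : ℕ} (hT : ∀ x : T, ∃ k : ℕ, p ^ k • x = 0)
    (hfin : {x : T | p • x = 0}.Finite) :
    ∃ k : ℕ, ∀ (j : ℕ) (x : T), ∃ y z, p ^ k • z = 0 ∧ x = p ^ j • y + z := by
  classical
  have h1 : ∀ q : T, ∃ i : ℕ, (∀ j, ∃ y, p ^ j • y = q) ∨ ¬ ∃ y, p ^ i • y = q := by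
    intro q
    by_cases h : ∀ j, ∃ y, p ^ j • y = q
    · exact ⟨0, Or.inl h⟩
    · push Not at h
      obtain ⟨i, hi⟩ := h
      exact ⟨i, Or.inr (by push Not; exact hi)⟩
  choose i hi using h1
  set k := hfin.toFinset.sup i with hk
  -- Each of the finitely many socle elements has infinite height or height below a bound, so from
  -- `k` on divisibility by p^k means infinite height. Induction on the order extends this from the
  -- socle to all of p^k T, which is therefore divisible.
  have hsoc : ∀ x : T, p • x = 0 → (∃ y, p ^ k • y = x) → ∀ j, ∃ y, p ^ j • y = x := by
    rintro x hx ⟨y, hy⟩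
    refine (hi x).resolve_right fun hn => hn ?_
    have hle : i x ≤ k := Finset.le_sup (f := i) (hfin.mem_toFinset.2 hx)
    obtain ⟨d, hd⟩ := Nat.exists_eq_add_of_le hle
    exact ⟨p ^ d • y, by rw [← mul_smul, ← pow_add, ← hd, hy]⟩
  have hdiv : ∀ (n : ℕ) (x : T), p ^ n • x = 0 → (∃ y, p ^ k • y = x) → ∀ j, ∃ y, p ^ j • y = x := by
    intro n
    induction n with
    | zero =>
      intro x hx _ j
      rw [pow_zero, one_smul] at hx
      exact ⟨0, by rw [smul_zero, hx]⟩
    | succ n ih =>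
      rintro x hx ⟨y, hy⟩ j
      obtain ⟨u, hu⟩ := hsoc (p ^ n • x) (by rw [← mul_smul, ← pow_succ', hx])
        ⟨p ^ n • y, by rw [smul_comm, hy]⟩ (n + (k + j))
      obtain ⟨w, hw⟩ := ih (x - p ^ (k + j) • u)
        (by rw [smul_sub, ← mul_smul, ← pow_add, hu, sub_self])
        ⟨y - p ^ j • u, by rw [smul_sub, hy, ← mul_smul, ← pow_add]⟩ j
      exact ⟨w + p ^ k • u, by
        rw [smul_add, hw, ← mul_smul, ← pow_add, add_comm j k, sub_add_cancel]⟩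
  refine ⟨k, fun j x => ?_⟩
  obtain ⟨n, hn⟩ := hT x
  obtain ⟨y, hy⟩ := hdiv n (p ^ k • x) (by rw [smul_comm, hn, smul_zero]) ⟨x, rfl⟩ (k + j)
  exact ⟨y, x - p ^ j • y, by rw [smul_sub, ← mul_smul, ← pow_add, hy, sub_self], by abel⟩

theorem finite_setOf_pow_smul_eq_zero {p : ℕ} (hfin : {x : T | p • x = 0}.Finite) (k : ℕ) :
    {x : T | p ^ k • x = 0}.Finite := by
  induction k with
  | zero => simp
  | succ k ih =>
    have : {x : T | p ^ (k + 1) • x = 0} = (fun x => p • x) ⁻¹' {x : T | p ^ k • x = 0} := by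
      ext x
      simp only [Set.mem_ofPred_eq, Set.mem_preimage]
      rw [← mul_smul, pow_succ]
    rw [this]
    refine ih.preimage' fun b _ => ?_
    rcases ((fun x : T => p • x) ⁻¹' {b}).eq_empty_or_nonempty with h | ⟨a, ha⟩
    · rw [h]; exact Set.finite_empty
    · refine (hfin.image (fun x => x + a)).subset fun x hx => ⟨x - a, ?_, by simp⟩
      simp only [Set.mem_preimage, Set.mem_singleton_iff] at ha hx
      simp only [Set.mem_ofPred_eq]
      rw [smul_sub, ha, hx, sub_self]

/-- An inertial endomorphism preserves the cyclic subgroups of a divisible subgroup. -/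
theorem InertialEnd.mem_zmultiples_of_divisible {φ : T →+ T} (hφ : InertialEnd φ) {p : ℕ}
    (hp : p.Prime) {X : AddSubgroup T} (hX : ∀ x ∈ X, ∃ k : ℕ, p ^ k • x = 0)
    (hdiv : ∀ x ∈ X, ∃ y ∈ X, p • y = x) {x : T} (hx : x ∈ X) :
    φ x ∈ AddSubgroup.zmultiples x := by
  have := Fact.mk hp
  choose! f hf hf' using hdiv
  set s : ℕ → T := fun n => f^[n] x with hs
  have hss : ∀ n, s (n + 1) = f (s n) := fun n => Function.iterate_succ_apply' _ _ _
  have hsX : ∀ n, s n ∈ X := by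
    intro n
    induction n with
    | zero => exact hx
    | succ n ih => rw [hss]; exact hf _ ih
  have hsp : ∀ n, p • s (n + 1) = s n := fun n => by rw [hss]; exact hf' _ (hsX n)
  have hs0 : ∀ n, p ^ n • s n = x := by
    intro n
    induction n with
    | zero => rw [pow_zero, one_smul]; rfl
    | succ n ih => rw [pow_succ, mul_smul, hsp, ih]
  have hmono : Monotone fun n => AddSubgroup.zmultiples (s n) := monotone_nat_of_le_succ fun n =>
    AddSubgroup.zmultiples_le_of_mem ⟨p, by simp [hsp]⟩
  -- A quasicyclic subgroup through `x` (trivial if x = 0). Its image is again divisible, so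
  -- `le_of_divisible` with D = φ(P) yields φ(P) ≤ P; comparing orders then places φ(x) in ⟨x⟩.
  set P : AddSubgroup T := ⨆ n, AddSubgroup.zmultiples (s n) with hP
  have hmem : ∀ y, y ∈ P ↔ ∃ n, ∃ m : ℤ, m • s n = y := fun y =>
    AddSubgroup.mem_iSup_of_directed hmono.directed_le
  have hle : P.map φ ≤ P := by
    refine hφ.le_of_divisible (p := p) P (P.map φ) ?_ ?_ le_rfl
    · rintro _ ⟨y, hy, rfl⟩
      obtain ⟨n, m, rfl⟩ := (hmem y).1 hy
      exact ⟨φ (m • s (n + 1)), ⟨_, (hmem _).2 ⟨n + 1, m, rfl⟩, rfl⟩,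
        by rw [← map_nsmul, smul_comm, hsp]⟩
    · rintro _ ⟨y, hy, rfl⟩
      obtain ⟨n, m, rfl⟩ := (hmem y).1 hy
      obtain ⟨k, hk⟩ := hX _ (hsX n)
      exact ⟨k, by rw [← map_nsmul, smul_comm, hk, smul_zero, map_zero]⟩
  obtain ⟨n, m, hm⟩ := (hmem _).1 (hle ⟨x, (hmem x).2 ⟨0, 1, one_smul _ _⟩, rfl⟩)
  obtain ⟨a, ha⟩ := exists_addOrderOf_eq_prime_pow_iff.2 (hX x hx)
  rcases a with _ | a
  · rw [pow_zero, AddMonoid.addOrderOf_eq_one_iff] at ha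
    rw [ha, map_zero]
    exact AddSubgroup.zero_mem _
  · have hox : p ^ (a + 1) • x = 0 := ha ▸ addOrderOf_nsmul_eq_zero x
    have hos : addOrderOf (s n) = p ^ (a + n + 1) := by
      apply addOrderOf_eq_prime_pow
      · intro h0
        rw [pow_add, mul_smul, hs0] at h0
        have := addOrderOf_dvd_of_nsmul_eq_zero h0
        rw [ha, Nat.pow_dvd_pow_iff_le_right hp.one_lt] at this
        lia
      · rw [show a + n + 1 = (a + 1) + n by lia, pow_add, mul_smul, hs0, hox]
    have h0 : ((p : ℤ) ^ (a + 1) * m) • s n = 0 := by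
      rw [mul_smul, hm]
      have : ((p : ℤ) ^ (a + 1)) • φ x = p ^ (a + 1) • φ x := by
        rw [← natCast_zsmul]; push_cast; rfl
      rw [this, ← map_nsmul, hox, map_zero]
    rw [← addOrderOf_dvd_iff_zsmul_eq_zero, hos] at h0
    push_cast at h0
    rw [show a + n + 1 = (a + 1) + n by lia, pow_add] at h0
    obtain ⟨c, rfl⟩ := Int.dvd_of_mul_dvd_mul_left
      (pow_ne_zero _ (by exact_mod_cast hp.ne_zero)) h0
    refine ⟨c, ?_⟩
    rw [← hm, mul_comm, mul_smul]
    rw [← hs0 n, ← natCast_zsmul]; push_cast; rfl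

/-- An endomorphism preserving the cyclic subgroups of an unbounded subgroup agrees there with an
endomorphism preserving all cyclic subgroups. -/
theorem exists_extension_of_forall_mem_zmultiples {p : ℕ} (hp : p.Prime)
    (hT : ∀ x : T, ∃ k : ℕ, p ^ k • x = 0) {N : AddSubgroup T}
    (hunb : ∀ k : ℕ, ∃ x ∈ N, p ^ k • x ≠ 0) {φ : T →+ T}
    (hN : ∀ x ∈ N, φ x ∈ AddSubgroup.zmultiples x) :
    ∃ W : T →+ T, (∀ x, W x ∈ AddSubgroup.zmultiples x) ∧ ∀ x ∈ N, φ x = W x := by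
  have := Fact.mk hp
  have hord : ∀ m : ℕ, ∃ x ∈ N, addOrderOf x = p ^ m := by
    intro m
    obtain ⟨x, hx, hxm⟩ := hunb m
    obtain ⟨i, hi⟩ := exists_addOrderOf_eq_prime_pow_iff.2 (hT x)
    have hmi : m ≤ i := by
      by_contra! hlt
      apply hxm
      rw [← addOrderOf_dvd_iff_nsmul_eq_zero, hi]
      exact pow_dvd_pow p hlt.le
    refine ⟨p ^ (i - m) • x, N.nsmul_mem hx _, ?_⟩
    rw [addOrderOf_nsmul_of_dvd (pow_ne_zero _ hp.ne_zero) (by rw [hi]; exact pow_dvd_pow p (by lia)),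
      hi, Nat.pow_div (by lia) hp.pos]
    congr 1
    lia
  choose x hxN hx using hord
  choose k hk using fun m => AddSubgroup.mem_zmultiples_iff.1 (hN _ (hxN m))
  have hfo : ∀ x : T, IsOfFinAddOrder x := fun x => by
    obtain ⟨k, hk⟩ := hT x
    exact isOfFinAddOrder_of_nsmul (pow_pos hp.pos k) hk
  have hkm : ∀ m, ∀ y ∈ N, p ^ m • y = 0 → φ y = k m • y := fun m y hy h0 =>
    zsmul_eq_of_addOrderOf_dvd hN (hxN m) hy (hfo _)
      (by rw [hx]; exact addOrderOf_dvd_of_nsmul_eq_zero h0) (hk m).symm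
  -- The multipliers on elements of order p^m are coherent, that is, φ acts on `N` as a p-adic
  -- integer, and a p-adic integer acts on all of `T`.
  have hdvd : ∀ m, (p : ℤ) ^ m ∣ k (m + 1) - k m := by
    intro m
    have h1 := hkm (m + 1) (x m) (hxN m) (by
      rw [← addOrderOf_dvd_iff_nsmul_eq_zero, hx]; exact pow_dvd_pow p (by lia))
    rw [← hk m, eq_comm, ← sub_eq_zero, ← sub_smul, ← addOrderOf_dvd_iff_zsmul_eq_zero, hx] at h1
    exact_mod_cast h1
  obtain ⟨W, hW⟩ := exists_hom_of_compatible hT (fun m => k m • AddMonoidHom.id T)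
    (fun m y hy => by
      simp only [AddMonoidHom.zsmul_apply, AddMonoidHom.id_apply]
      rw [← sub_eq_zero, ← sub_smul]
      obtain ⟨c, hc⟩ := hdvd m
      rw [hc, mul_comm, mul_smul]
      have : ((p : ℤ) ^ m) • y = p ^ m • y := by rw [← natCast_zsmul]; push_cast; rfl
      rw [this, hy, smul_zero])
  refine ⟨W, fun y => ?_, fun y hy => ?_⟩
  · obtain ⟨m, hm⟩ := hT y
    exact ⟨k m, (hW m y hm).symm⟩
  · obtain ⟨m, hm⟩ := hT y
    rw [hkm m y hy hm, hW m y hm]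
    rfl

/-- Take `M` maximal disjoint from a finite `E` containing all exceptional subgroups. By maximality
an x with px ∈ M is congruent modulo `M` to an element of `E`, so T/M has finite socle. The elements
of `M` that all φ i send into `M` form `N`, and T/N embeds into a finite power of T/M. -/
theorem InertialEnd.exists_finite_socle {p : ℕ} (hp : p.Prime)
    (hT : ∀ x : T, ∃ k : ℕ, p ^ k • x = 0) {ι : Type*} [Finite ι] (φ : ι → T →+ T)
    (hφ : ∀ i, InertialEnd (φ i)) : ∃ N : AddSubgroup T,
      (∀ i, ∀ x ∈ N, φ i x ∈ AddSubgroup.zmultiples x) ∧ {x : T ⧸ N | p • x = 0}.Finite := by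
  classical
  have := Fintype.ofFinite ι
  choose F hF hF' using fun i => (hφ i).exists_finite_forall_mem_zmultiples
  set E : AddSubgroup T := Finset.univ.sup F with hE
  have hEfin : Finite E := finite_finset_sup _ _ fun i _ => hF i
  have hFE : ∀ i, F i ≤ E := fun i => Finset.le_sup (Finset.mem_univ i)
  obtain ⟨M, hME, hM⟩ := exists_maximal_disjoint E
  have hsoc : ∀ x : T, ∃ f : E, p • x ∈ M → x - f ∈ M := by
    intro x
    by_cases hx : x ∈ M
    · exact ⟨0, fun _ => by simpa using hx⟩
    obtain ⟨m, hm, k, hkE, hk0⟩ := hM x hx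
    by_cases hpx : p • x ∈ M
    · have hpk : ¬ (p : ℤ) ∣ k := by
        rintro ⟨c, rfl⟩
        apply hk0
        refine AddSubgroup.disjoint_def.1 hME (M.add_mem hm ?_) hkE
        rw [mul_comm, mul_smul, natCast_zsmul]
        exact M.zsmul_mem hpx c
      obtain ⟨u, v, huv⟩ := ((Prime.coprime_iff_not_dvd (Nat.prime_iff_prime_int.1 hp)).2 hpk)
      refine ⟨v • ⟨_, hkE⟩, fun _ => ?_⟩
      have : x = u • p • x + v • k • x := by
        rw [← natCast_zsmul, ← mul_smul, ← mul_smul, ← add_smul, huv, one_smul]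
      push_cast
      have h2 : x - v • (m + k • x) = u • p • x - v • m := by
        rw [smul_add]; nth_rewrite 1 [this]; abel
      rw [h2]
      exact M.sub_mem (M.zsmul_mem hpx u) (M.zsmul_mem hm v)
    · exact ⟨0, fun h => absurd h hpx⟩
  choose f hf using hsoc
  set N : AddSubgroup T := M ⊓ ⨅ i, M.comap (φ i) with hN
  have hNmem : ∀ x, x ∈ N ↔ x ∈ M ∧ ∀ i, φ i x ∈ M := fun x => by
    simp [hN, AddSubgroup.mem_inf, AddSubgroup.mem_iInf]
  refine ⟨N, fun i x hx => ?_, ?_⟩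
  · obtain ⟨k, hk⟩ := hT x
    refine hF' i x (isOfFinAddOrder_of_nsmul (pow_pos hp.pos k) hk) ?_
    refine hME.mono ?_ (hFE i)
    rw [hNmem] at hx
    exact sup_le (AddSubgroup.zmultiples_le_of_mem hx.1) (AddSubgroup.zmultiples_le_of_mem (hx.2 i))
  · refine Set.Finite.of_injOn (f := fun q : T ⧸ N => (f q.out, fun i => f (φ i q.out)))
      (t := Set.univ) (fun _ _ => Set.mem_univ _) ?_ Set.finite_univ
    have hout : ∀ q : T ⧸ N, p • q = 0 → p • q.out ∈ N := by
      intro q hq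
      rw [← QuotientAddGroup.eq_zero_iff, QuotientAddGroup.mk_nsmul, QuotientAddGroup.out_eq', hq]
    intro q hq q' hq' h
    have h1 := (hNmem _).1 (hout q hq)
    have h2 := (hNmem _).1 (hout q' hq')
    simp only [Prod.mk.injEq] at h
    rw [← QuotientAddGroup.out_eq' q, ← QuotientAddGroup.out_eq' q', QuotientAddGroup.eq, hNmem]
    have aux : ∀ y y' : T, p • y ∈ M → p • y' ∈ M → f y = f y' → -y + y' ∈ M := by
      intro y y' hy hy' hyy
      have a1 := hf y hy
      have a2 := hf y' hy'
      rw [hyy] at a1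
      have := M.sub_mem a2 a1
      rwa [sub_sub_sub_cancel_right, sub_eq_neg_add] at this
    refine ⟨aux _ _ h1.1 h2.1 h.1, fun i => ?_⟩
    rw [map_add, map_neg]
    exact aux _ _ (by rw [← map_nsmul]; exact h1.2 i) (by rw [← map_nsmul]; exact h2.2 i)
      (congrFun h.2 i)

/-- An inertial endomorphism killing an unbounded subgroup with finite socle of the quotient kills
the divisible part of the quotient. -/
theorem InertialEnd.eq_zero_of_unbounded {ψ : T →+ T} (hψ : InertialEnd ψ) {p : ℕ}
    (hp : p.Prime) (hT : ∀ x : T, ∃ k : ℕ, p ^ k • x = 0) {N : AddSubgroup T}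
    (hunb : ∀ k : ℕ, ∃ x ∈ N, p ^ k • x ≠ 0) (hN : ∀ x ∈ N, ψ x = 0) {k : ℕ}
    (hk : ∀ (j : ℕ) (x : T), ∃ y z, p ^ k • z ∈ N ∧ x - (p ^ j • y + z) ∈ N) (x : T) :
    ψ (p ^ k • x) = 0 := by
  by_contra hne
  set D : AddSubgroup T := (ψ.comp (p ^ k • AddMonoidHom.id T)).range with hD
  have hDmem : ∀ y, y ∈ D ↔ ∃ x, ψ (p ^ k • x) = y := fun y => by
    simp [hD, AddMonoidHom.mem_range]
  -- D = ψ(p^k T) is divisible. As g(N) contains all elements of p-power order and ψ(N) = 0, each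
  -- p^k x can be moved into ker g by an element of `N` without changing its ψ-image. So D ≤ ψ(ker
  -- g), and divisibility gives D ≤ ker g, against the choice of g.
  obtain ⟨g, hg, hg0⟩ := exists_character_unbounded_ne_zero N (fun x _ => hT x) hunb hne
  have hle : D ≤ g.ker := by
    refine hψ.le_of_divisible (p := p) g.ker D ?_ (fun x _ => hT x) ?_
    · intro y hy
      obtain ⟨x, rfl⟩ := (hDmem y).1 hy
      obtain ⟨u, z, hz, hu⟩ := hk 1 x
      refine ⟨ψ (p ^ k • u), (hDmem _).2 ⟨u, rfl⟩, ?_⟩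
      have h1 := hN _ (N.nsmul_mem hu (p ^ k))
      rw [smul_sub, smul_add, map_sub, map_add, hN _ hz, add_zero, sub_eq_zero] at h1
      rw [h1, ← map_nsmul, pow_one, smul_comm]
    · intro y hy
      obtain ⟨x, rfl⟩ := (hDmem y).1 hy
      obtain ⟨j, hj⟩ := hT (p ^ k • x)
      obtain ⟨n, hn, hgn⟩ := exists_apply_eq_of_unbounded hp N (fun x _ => hT x) hg
        (y := g (p ^ k • x)) (j := j) (by rw [← map_nsmul, hj, map_zero])
      refine ⟨p ^ k • x - n, ?_, by rw [map_sub, hN n hn, sub_zero]⟩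
      change g _ = 0
      rw [map_sub, hgn, sub_self]
  exact hg0 (hle ((hDmem _).2 ⟨x, rfl⟩))

/-- Structure of finitely many inertial endomorphisms of a group of elements of `p`-power order. -/
theorem InertialEnd.exists_sup_eq_top {p : ℕ} (hp : p.Prime)
    (hT : ∀ x : T, ∃ k : ℕ, p ^ k • x = 0) {ι : Type*} [Finite ι] (φ : ι → T →+ T)
    (hφ : ∀ i, InertialEnd (φ i)) : ∃ X Y F : AddSubgroup T,
      (∀ i, ∀ x ∈ X, φ i x ∈ AddSubgroup.zmultiples x) ∧
      (∀ i, ∀ y ∈ Y, φ i y ∈ AddSubgroup.zmultiples y) ∧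
      (∃ k : ℕ, ∀ y ∈ Y, p ^ k • y = 0) ∧ Finite F ∧ X ⊔ Y ⊔ F = ⊤ := by
  obtain ⟨N, hN, hfin⟩ := InertialEnd.exists_finite_socle hp hT φ hφ
  have hQ : ∀ x : T ⧸ N, ∃ k : ℕ, p ^ k • x = 0 := fun q => by
    obtain ⟨x, rfl⟩ := QuotientAddGroup.mk_surjective q
    obtain ⟨k, hk⟩ := hT x
    exact ⟨k, by rw [← QuotientAddGroup.mk_nsmul, hk, QuotientAddGroup.mk_zero]⟩
  obtain ⟨k, hk⟩ := exists_eq_pow_smul_add_of_finite_socle hQ hfin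
  set S : Set T := Quotient.out '' {x : T ⧸ N | p ^ k • x = 0} with hS
  have hSfin : S.Finite := (finite_setOf_pow_smul_eq_zero hfin k).image _
  have hF : Finite (AddSubgroup.closure S) := finite_closure_of_isOfFinAddOrder hSfin fun s _ => by
    obtain ⟨k, hk⟩ := hT s
    exact isOfFinAddOrder_of_nsmul (pow_pos hp.pos k) hk
  have hk' : ∀ (j : ℕ) (x : T), ∃ y z, z ∈ S ∧ p ^ k • z ∈ N ∧ x - (p ^ j • y + z) ∈ N := by
    intro j x
    obtain ⟨y, z, hz, hxyz⟩ := hk j (x : T ⧸ N)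
    obtain ⟨y, rfl⟩ := QuotientAddGroup.mk_surjective y
    refine ⟨y, z.out, ⟨z, hz, rfl⟩, ?_, ?_⟩
    · rw [← QuotientAddGroup.eq_zero_iff, QuotientAddGroup.mk_nsmul, QuotientAddGroup.out_eq', hz]
    · rw [← QuotientAddGroup.eq_zero_iff, QuotientAddGroup.mk_sub, QuotientAddGroup.mk_add,
        QuotientAddGroup.mk_nsmul, QuotientAddGroup.out_eq', hxyz, sub_self]
  have hk'' : ∀ (j : ℕ) (x : T), ∃ y z, p ^ k • z ∈ N ∧ x - (p ^ j • y + z) ∈ N := fun j x => by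
    obtain ⟨y, z, _, h⟩ := hk' j x
    exact ⟨y, z, h⟩
  have htop : ∀ j, (p ^ j • AddMonoidHom.id T).range ⊔ N ⊔ AddSubgroup.closure S = ⊤ := by
    intro j
    refine eq_top_iff.2 fun x _ => ?_
    obtain ⟨y, z, hzS, _, hn⟩ := hk' j x
    have : x = p ^ j • y + (x - (p ^ j • y + z)) + z := by abel
    rw [this]
    exact AddSubgroup.add_mem_sup (AddSubgroup.add_mem_sup ⟨y, rfl⟩ hn)
      (AddSubgroup.subset_closure hzS)
  -- If `N` is unbounded, φ agrees on it with a p-adic multiplication W, and φ - W also kills p^k T,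
  -- so X = p^k T + N works. If p^m kills `N`, then p^(m+k) T is divisible and serves as `X`, with Y
  -- = N.
  by_cases hunb : ∀ k : ℕ, ∃ x ∈ N, p ^ k • x ≠ 0
  · refine ⟨(p ^ k • AddMonoidHom.id T).range ⊔ N, ⊥, AddSubgroup.closure S, fun i x hx => ?_,
      fun i y hy => ?_, ⟨0, fun y hy => ?_⟩, hF, ?_⟩
    · obtain ⟨W, hW, hWN⟩ := exists_extension_of_forall_mem_zmultiples hp hT hunb (hN i)
      obtain ⟨_, ⟨y, rfl⟩, n, hn, rfl⟩ := AddSubgroup.mem_sup.1 hx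
      have hψ : InertialEnd (φ i - W) := (hφ i).sub (InertialEnd.of_forall_mem_zmultiples hW)
      have hψN : ∀ x ∈ N, (φ i - W) x = 0 := fun x hx => by
        rw [AddMonoidHom.sub_apply, hWN x hx, sub_self]
      have h1 := hψ.eq_zero_of_unbounded hp hT hunb hψN hk'' y
      have h2 : (φ i - W) ((p ^ k • AddMonoidHom.id T) y + n) = 0 := by
        rw [map_add, hψN n hn, add_zero]
        exact h1
      rw [AddMonoidHom.sub_apply, sub_eq_zero] at h2
      rw [h2]
      exact hW _
    · rw [AddSubgroup.mem_bot.1 hy, map_zero]; exact AddSubgroup.zero_mem _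
    · rw [AddSubgroup.mem_bot.1 hy, smul_zero]
    · rw [sup_bot_eq, htop]
  · push Not at hunb
    obtain ⟨m, hm⟩ := hunb
    refine ⟨(p ^ (m + k) • AddMonoidHom.id T).range, N, AddSubgroup.closure S, fun i x hx => ?_,
      hN, ⟨m, hm⟩, hF, htop _⟩
    refine (hφ i).mem_zmultiples_of_divisible hp (fun x _ => hT x) ?_ hx
    rintro _ ⟨x, rfl⟩
    obtain ⟨y, z, hz, hn⟩ := hk'' 1 x
    refine ⟨p ^ (m + k) • y, ⟨y, rfl⟩, ?_⟩
    have h1 := hm _ (N.nsmul_mem hn (p ^ k))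
    rw [← mul_smul, ← pow_add, smul_sub, smul_add, pow_add p m k, mul_smul _ _ z, hm _ hz,
      add_zero, sub_eq_zero, pow_one] at h1
    simp only [AddMonoidHom.nsmul_apply, AddMonoidHom.id_apply]
    rw [pow_add, h1, smul_comm]

end PGroups

/-! ### Automorphisms preserving subgroups and cyclic torsion subgroups. -/

section Automorphisms

variable {A : Type*} [AddCommGroup A]

theorem AutGroup.inv_apply_self (κ : AutGroup A) (x : A) : κ⁻¹ (κ x) = x :=
  LinearEquiv.symm_apply_apply κ x

theorem AutGroup.apply_inv_self (κ : AutGroup A) (x : A) : κ (κ⁻¹ x) = x :=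
  LinearEquiv.apply_symm_apply κ x

theorem AutGroup.isOfFinAddOrder_apply_iff (κ : AutGroup A) {x : A} :
    IsOfFinAddOrder (κ x) ↔ IsOfFinAddOrder x :=
  (LinearEquiv.injective κ).isOfFinAddOrder_iff (f := κ.toAddEquiv.toAddMonoidHom)

theorem AutGroup.inv_mem_of_finite (κ : AutGroup A) {E : AddSubgroup A} [Finite E]
    (h : ∀ x ∈ E, κ x ∈ E) {x : A} (hx : x ∈ E) : κ⁻¹ x ∈ E := by
  have hinj : Function.Injective (fun y : E => (⟨κ y, h y y.2⟩ : E)) := fun y z hyz =>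
    Subtype.ext (LinearEquiv.injective κ (congrArg Subtype.val hyz))
  obtain ⟨y, hy⟩ := Finite.surjective_of_injective hinj ⟨x, hx⟩
  have hy' : κ y = x := congrArg Subtype.val hy
  rw [← hy', AutGroup.inv_apply_self]
  exact y.2

theorem AutGroup.mem_of_mem_closure {S : Set (AutGroup A)} {E : AddSubgroup A} [Finite E]
    (h : ∀ κ ∈ S, ∀ x ∈ E, κ x ∈ E) {κ : AutGroup A} (hκ : κ ∈ Subgroup.closure S) :
    ∀ x ∈ E, κ x ∈ E := by
  induction hκ using Subgroup.closure_induction with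
  | mem κ hκ => exact h κ hκ
  | one => exact fun x hx => hx
  | mul κ κ' _ _ ih ih' => exact fun x hx => ih _ (ih' x hx)
  | inv κ _ ih => exact fun x hx => κ.inv_mem_of_finite ih hx

/-- The automorphisms preserving the cyclic subgroups generated by the torsion elements of `X`. -/
def powerAutOn (X : AddSubgroup A) : Subgroup (AutGroup A) where
  carrier := {κ | ∀ x ∈ X, IsOfFinAddOrder x → κ x ∈ AddSubgroup.zmultiples x}
  one_mem' := fun x _ _ => AddSubgroup.mem_zmultiples x
  mul_mem' := fun {κ κ'} h h' x hx hxt => by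
    obtain ⟨m, hm⟩ := h' x hx hxt
    obtain ⟨n, hn⟩ := h x hx hxt
    refine ⟨m * n, ?_⟩
    simp only at hm hn ⊢
    rw [LinearEquiv.mul_apply, ← hm, map_zsmul, ← hn, mul_smul]
  inv_mem' := fun {κ} h x hx hxt => by
    have := finite_zmultiples_of_isOfFinAddOrder hxt
    refine κ.inv_mem_of_finite ?_ (AddSubgroup.mem_zmultiples x)
    rintro _ ⟨m, rfl⟩
    simp only [map_zsmul]
    exact AddSubgroup.zsmul_mem _ (h x hx hxt) m

theorem mem_powerAutOn {X : AddSubgroup A} {κ : AutGroup A} : κ ∈ powerAutOn X ↔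
    ∀ x ∈ X, IsOfFinAddOrder x → κ x ∈ AddSubgroup.zmultiples x := Iff.rfl

end Automorphisms

/-! ### Action of finitely many inertial maps on the torsion subgroup. -/

section Structure

variable {A : Type*} [AddCommGroup A]

theorem isOfFinAddOrder_of_mem_primaryComponent {p : ℕ} (hp : p.Prime) {x : A}
    (hx : x ∈ AddCommGroup.primaryComponent A p) : IsOfFinAddOrder x := by
  obtain ⟨k, hk⟩ := hx
  exact isOfFinAddOrder_of_nsmul (pow_pos hp.pos k) hk

variable {ι : Type*} [Finite ι]

theorem InertialEnd.exists_sup_eq_primaryComponent {p : ℕ} (hp : p.Prime) (φ : ι → A →+ A)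
    (hφ : ∀ i, InertialEnd (φ i)) : ∃ X Y F : AddSubgroup A,
      (∀ i, ∀ x ∈ X, φ i x ∈ AddSubgroup.zmultiples x) ∧
      (∀ i, ∀ y ∈ Y, φ i y ∈ AddSubgroup.zmultiples y) ∧
      (∃ k : ℕ, ∀ y ∈ Y, p ^ k • y = 0) ∧ Finite F ∧
      X ⊔ Y ⊔ F = AddCommGroup.primaryComponent A p := by
  set P := AddCommGroup.primaryComponent A p with hP
  have hmaps : ∀ i, ∀ x : P, φ i x ∈ P := by
    rintro i ⟨x, k, hk⟩
    exact ⟨k, by simp only; rw [← map_nsmul, hk, map_zero]⟩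
  let ψ : ι → P →+ P := fun i => ((φ i).comp P.subtype).codRestrict P (hmaps i)
  have hψ : ∀ i, InertialEnd (ψ i) := fun i =>
    (hφ i).of_injective P.subtype P.subtype_injective fun b => rfl
  obtain ⟨X, Y, F, hX, hY, ⟨k, hk⟩, hF, htop⟩ := InertialEnd.exists_sup_eq_top hp
    (fun x : P => by
      obtain ⟨x, k, hk⟩ := x
      exact ⟨k, Subtype.ext hk⟩) ψ hψ
  refine ⟨X.map P.subtype, Y.map P.subtype, F.map P.subtype, ?_, ?_, ⟨k, ?_⟩, ?_, ?_⟩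
  · rintro i _ ⟨x, hx, rfl⟩
    obtain ⟨m, hm⟩ := hX i x hx
    exact ⟨m, congrArg Subtype.val hm⟩
  · rintro i _ ⟨x, hx, rfl⟩
    obtain ⟨m, hm⟩ := hY i x hx
    exact ⟨m, congrArg Subtype.val hm⟩
  · rintro _ ⟨y, hy, rfl⟩
    exact congrArg Subtype.val (hk y hy)
  · have : ((F.map P.subtype : AddSubgroup A) : Set A).Finite :=
      (Set.toFinite (F : Set P)).image _
    exact this.to_subtype
  · rw [← AddSubgroup.map_sup, ← AddSubgroup.map_sup, htop, ← AddMonoidHom.range_eq_map,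
      AddSubgroup.range_subtype]

/-- Primes not dividing the orders of the exceptional finite subgroups are harmless: for such p, A_p
meets these subgroups trivially. -/
theorem InertialEnd.exists_finset_primes (φ : ι → A →+ A) (hφ : ∀ i, InertialEnd (φ i)) :
    ∃ S : Finset ℕ, ∀ p, p.Prime → p ∉ S → ∀ i, ∀ x ∈ AddCommGroup.primaryComponent A p,
      φ i x ∈ AddSubgroup.zmultiples x := by
  classical
  have := Fintype.ofFinite ι
  choose F hF hF' using fun i => (hφ i).exists_finite_forall_mem_zmultiples
  refine ⟨Finset.univ.sup fun i => (Nat.card (F i)).primeFactors, fun p hp hpS i x hx => ?_⟩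
  have hndvd : ¬ p ∣ Nat.card (F i) := by
    intro hdvd
    apply hpS
    rw [Finset.mem_sup]
    exact ⟨i, Finset.mem_univ i, Nat.mem_primeFactors.2 ⟨hp, hdvd, Nat.card_pos.ne'⟩⟩
  refine hF' i x (isOfFinAddOrder_of_mem_primaryComponent hp hx) ?_
  have hle : AddSubgroup.zmultiples x ⊔ AddSubgroup.zmultiples (φ i x)
      ≤ AddCommGroup.primaryComponent A p := by
    refine sup_le (AddSubgroup.zmultiples_le_of_mem hx) (AddSubgroup.zmultiples_le_of_mem ?_)
    obtain ⟨k, hk⟩ := hx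
    exact ⟨k, by rw [← map_nsmul, hk, map_zero]⟩
  refine AddSubgroup.disjoint_def.2 fun {y} hy hyF => ?_
  obtain ⟨k, hk⟩ := hle hy
  have h1 : Nat.card (F i) • y = 0 := by
    have : Nat.card (F i) • (⟨y, hyF⟩ : F i) = 0 := card_nsmul_eq_zero'
    exact congrArg Subtype.val this
  have h2 := Nat.dvd_gcd (addOrderOf_dvd_of_nsmul_eq_zero hk) (addOrderOf_dvd_of_nsmul_eq_zero h1)
  rw [((Nat.Prime.coprime_iff_not_dvd hp).2 hndvd).pow_left k, Nat.dvd_one,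
    AddMonoid.addOrderOf_eq_one_iff] at h2
  exact h2

/-- Finitely many inertial endomorphisms act locally finitely on the torsion elements. -/
theorem InertialEnd.exists_finite_invariant (φ : ι → A →+ A) (hφ : ∀ i, InertialEnd (φ i))
    {x : A} (hx : IsOfFinAddOrder x) :
    ∃ E : AddSubgroup A, Finite E ∧ x ∈ E ∧ ∀ i, ∀ y ∈ E, φ i y ∈ E := by
  classical
  let L : AddSubgroup A :=
    { carrier := {x | ∃ E : AddSubgroup A, Finite E ∧ x ∈ E ∧ ∀ i, ∀ y ∈ E, φ i y ∈ E}
      zero_mem' := ⟨⊥, inferInstance, AddSubgroup.zero_mem _, fun i y hy => by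
        rw [AddSubgroup.mem_bot.1 hy, map_zero]; exact AddSubgroup.zero_mem _⟩
      add_mem' := by
        rintro x y ⟨E, hE, hxE, hE'⟩ ⟨D, hD, hyD, hD'⟩
        refine ⟨E ⊔ D, finite_sup hE hD, AddSubgroup.add_mem_sup hxE hyD, fun i z hz => ?_⟩
        obtain ⟨e, he, d, hd, rfl⟩ := AddSubgroup.mem_sup.1 hz
        rw [map_add]
        exact AddSubgroup.add_mem_sup (hE' i e he) (hD' i d hd)
      neg_mem' := by
        rintro x ⟨E, hE, hxE, hE'⟩
        exact ⟨E, hE, E.neg_mem hxE, hE'⟩ }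
  refine mem_of_forall_prime_power hx L fun s _ p k hp hs => ?_
  obtain ⟨X, Y, F, hX, hY, -, hF, htop⟩ := InertialEnd.exists_sup_eq_primaryComponent hp φ hφ
  set P := AddCommGroup.primaryComponent A p with hP
  have hdec : ∀ z ∈ P, ∃ a ∈ X, ∃ b ∈ Y, ∃ f ∈ F, a + b + f = z := by
    intro z hz
    rw [← htop] at hz
    obtain ⟨w, hw, f, hf, rfl⟩ := AddSubgroup.mem_sup.1 hz
    obtain ⟨a, ha, b, hb, rfl⟩ := AddSubgroup.mem_sup.1 hw
    exact ⟨a, ha, b, hb, f, hf, rfl⟩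
  have hφP : ∀ i, ∀ z ∈ P, φ i z ∈ P := by
    rintro i z ⟨k, hk⟩
    exact ⟨k, by rw [← map_nsmul, hk, map_zero]⟩
  have hXP : X ≤ P := by rw [← htop]; exact le_sup_left.trans le_sup_left
  have hYP : Y ≤ P := by rw [← htop]; exact le_sup_right.trans le_sup_left
  have hFP : F ≤ P := by rw [← htop]; exact le_sup_right
  choose! a ha b hb f hf hsum using hdec
  -- The cyclic subgroups of X and of Y are invariant, so only images of `F` can escape. Adding the
  -- X- and Y-components of `s` and of these finitely many images closes everything up.
  set R : Set A := insert s (Set.range fun q : ι × F => φ q.1 q.2) with hR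
  have hRfin : R.Finite := (Set.finite_range _).insert _
  have hRP : R ⊆ P := by
    rintro z (rfl | ⟨q, rfl⟩)
    · exact ⟨k, hs⟩
    · exact hφP _ _ (hFP q.2.2)
  set E := AddSubgroup.closure (a '' R ∪ b '' R) ⊔ F with hE
  have hEmem : ∀ z ∈ R, z ∈ E := by
    intro z hz
    rw [← hsum z (hRP hz)]
    exact AddSubgroup.add_mem_sup (AddSubgroup.add_mem _
      (AddSubgroup.subset_closure (Or.inl ⟨z, hz, rfl⟩))
      (AddSubgroup.subset_closure (Or.inr ⟨z, hz, rfl⟩))) (hf z (hRP hz))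
  refine ⟨E, finite_sup (finite_closure_of_isOfFinAddOrder ((hRfin.image _).union (hRfin.image _))
    ?_) hF, hEmem s (Or.inl rfl), fun i => ?_⟩
  · rintro z (⟨r, hr, rfl⟩ | ⟨r, hr, rfl⟩)
    · exact isOfFinAddOrder_of_mem_primaryComponent hp (hXP (ha r (hRP hr)))
    · exact isOfFinAddOrder_of_mem_primaryComponent hp (hYP (hb r (hRP hr)))
  · change E ≤ E.comap (φ i)
    refine sup_le ((AddSubgroup.closure_le _).2 ?_) fun z hz => hEmem _ (Or.inr ⟨(i, ⟨z, hz⟩), rfl⟩)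
    rintro z (⟨r, hr, rfl⟩ | ⟨r, hr, rfl⟩)
    · refine (AddSubgroup.zmultiples_le_of_mem (H := E) ?_) (hX i _ (ha r (hRP hr)))
      exact AddSubgroup.mem_sup_left (AddSubgroup.subset_closure (Or.inl ⟨r, hr, rfl⟩))
    · refine (AddSubgroup.zmultiples_le_of_mem (H := E) ?_) (hY i _ (hb r (hRP hr)))
      exact AddSubgroup.mem_sup_left (AddSubgroup.subset_closure (Or.inr ⟨r, hr, rfl⟩))

/-- Commuting on elements mapped to multiples of themselves. -/
theorem comm_of_mem_zmultiples {φ ψ : A →+ A} {x : A} (h : φ x ∈ AddSubgroup.zmultiples x)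
    (h' : ψ x ∈ AddSubgroup.zmultiples x) : φ (ψ x) = ψ (φ x) := by
  obtain ⟨m, hm⟩ := h
  obtain ⟨n, hn⟩ := h'
  simp only at hm hn
  rw [← hm, ← hn, map_zsmul, map_zsmul, ← hm, ← hn, smul_comm]

/-- Inertial endomorphisms of a torsion group commute up to a finite subgroup. -/
theorem InertialEnd.exists_finite_commutator_of_torsion {φ ψ : A →+ A} (hφ : InertialEnd φ)
    (hψ : InertialEnd ψ) (hA : ∀ x : A, IsOfFinAddOrder x) :
    ∃ E : AddSubgroup A, Finite E ∧ ∀ x, φ (ψ x) - ψ (φ x) ∈ E := by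
  have hin : ∀ i : Bool, InertialEnd (bif i then φ else ψ) := fun i => by
    cases i
    · exact hψ
    · exact hφ
  obtain ⟨S, hS⟩ := InertialEnd.exists_finset_primes (fun i : Bool => bif i then φ else ψ) hin
  set D : A →+ A := φ.comp ψ - ψ.comp φ with hD
  have hp : ∀ p : ℕ, ∃ E : AddSubgroup A, Finite E ∧ (p.Prime →
      ∀ x ∈ AddCommGroup.primaryComponent A p, D x ∈ E) := by
    intro p
    by_cases hp : p.Prime
    · obtain ⟨X, Y, F, hX, hY, -, hF, htop⟩ :=
        InertialEnd.exists_sup_eq_primaryComponent hp (fun i : Bool => bif i then φ else ψ) hin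
      refine ⟨F.map D, ?_, fun _ x hx => ?_⟩
      · have : ((F.map D : AddSubgroup A) : Set A).Finite := (Set.toFinite (F : Set A)).image _
        exact this.to_subtype
      · rw [← htop] at hx
        obtain ⟨w, hw, f, hf, rfl⟩ := AddSubgroup.mem_sup.1 hx
        obtain ⟨a, ha, b, hb, rfl⟩ := AddSubgroup.mem_sup.1 hw
        -- Maps preserving the same cyclic group commute on it, so the commutator vanishes on `X`
        -- and `Y` and maps the whole component into the image of the finite `F`.
        have h1 : D a = 0 := sub_eq_zero.2 (comm_of_mem_zmultiples (hX true a ha) (hX false a ha))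
        have h2 : D b = 0 := sub_eq_zero.2 (comm_of_mem_zmultiples (hY true b hb) (hY false b hb))
        rw [map_add, map_add, h1, h2, zero_add, zero_add]
        exact ⟨f, hf, rfl⟩
    · exact ⟨⊥, inferInstance, fun h => absurd h hp⟩
  choose E hE hE' using hp
  refine ⟨S.sup E, finite_finset_sup _ _ fun p _ => hE p, fun x => ?_⟩
  refine mem_of_forall_prime_power (hA x) ((S.sup E).comap D) fun s _ p k hp hs => ?_
  by_cases hpS : p ∈ S
  · exact Finset.le_sup (f := E) hpS (hE' p hp s ⟨k, hs⟩)
  · have : D s = 0 := sub_eq_zero.2 (comm_of_mem_zmultiples (hS p hp hpS true s ⟨k, hs⟩)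
      (hS p hp hpS false s ⟨k, hs⟩))
    change D s ∈ S.sup E
    rw [this]
    exact AddSubgroup.zero_mem _

/-- A torsion-free subgroup with torsion quotient. -/
theorem exists_torsionFree_subgroup (A : Type*) [AddCommGroup A] : ∃ V : AddSubgroup A,
    (∀ x ∈ V, IsOfFinAddOrder x → x = 0) ∧ ∀ x, ∃ n : ℕ, 0 < n ∧ n • x ∈ V := by
  obtain ⟨V, hV, hmax⟩ := exists_maximal_disjoint (AddCommGroup.torsion A)
  refine ⟨V, fun x hx hxt => AddSubgroup.disjoint_def.1 hV hx hxt, fun x => ?_⟩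
  by_cases hx : x ∈ V
  · exact ⟨1, one_pos, by rwa [one_smul]⟩
  · obtain ⟨m, hm, k, hk, hne⟩ := hmax x hx
    obtain ⟨n, hn, hn0⟩ := (show IsOfFinAddOrder (m + k • x) from hk).exists_nsmul_eq_zero
    have hk0 : k ≠ 0 := by
      rintro rfl
      rw [zero_smul, add_zero] at hk hne
      exact hne (AddSubgroup.disjoint_def.1 hV hm hk)
    have h1 : ((n : ℤ) * k) • x ∈ V := by
      rw [smul_add, ← natCast_zsmul, ← natCast_zsmul, ← mul_smul] at hn0
      rw [eq_neg_of_add_eq_zero_right hn0]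
      exact V.neg_mem (V.zsmul_mem hm _)
    refine ⟨((n : ℤ) * k).natAbs, Int.natAbs_pos.2 (mul_ne_zero (by exact_mod_cast hn.ne') hk0), ?_⟩
    rcases Int.natAbs_eq ((n : ℤ) * k) with h | h
    · rw [← natCast_zsmul, ← h]; exact h1
    · rw [← natCast_zsmul, ← neg_neg ((((n : ℤ) * k).natAbs : ℤ)), ← h, neg_smul]
      exact V.neg_mem h1

/-- Inertial endomorphisms with torsion image commute up to a finite subgroup. -/
theorem InertialEnd.exists_finite_commutator {φ ψ : A →+ A} (hφ : InertialEnd φ)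
    (hψ : InertialEnd ψ) (hφt : ∀ x, IsOfFinAddOrder (φ x)) (hψt : ∀ x, IsOfFinAddOrder (ψ x)) :
    (Set.range fun x => φ (ψ x) - ψ (φ x)).Finite := by
  obtain ⟨V, hV, hVt⟩ := exists_torsionFree_subgroup A
  have hexp : ∀ θ : A →+ A, InertialEnd θ → (∀ x, IsOfFinAddOrder (θ x)) →
      ∃ e : ℕ, 0 < e ∧ ∀ x ∈ V, e • θ x = 0 := by
    intro θ hθ hθt
    have hfin : (θ '' (V : Set A)).Finite :=
      hθ.finite_image_of_disjoint V fun x _ hx => hV _ hx (hθt x)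
    have hfin' : Finite (V.map θ) := hfin.to_subtype
    refine ⟨Nat.card (V.map θ), Nat.card_pos, fun x hx => ?_⟩
    have : Nat.card (V.map θ) • (⟨θ x, ⟨x, hx, rfl⟩⟩ : V.map θ) = 0 := card_nsmul_eq_zero'
    exact congrArg Subtype.val this
  obtain ⟨e, he, heV⟩ := hexp φ hφ hφt
  obtain ⟨d, hd, hdV⟩ := hexp ψ hψ hψt
  -- The images of the torsion-free `V` are torsion, hence meet `V` trivially and are finite; so
  -- `U`, where both maps vanish, still has torsion quotient. Commutator values are torsion and `U`
  -- is torsion-free, so these values embed into A/U, where the torsion case applies.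
  set U : AddSubgroup A := V ⊓ (φ.ker ⊓ ψ.ker) with hU
  have hUt : ∀ x, ∃ n : ℕ, 0 < n ∧ n • x ∈ U := by
    intro x
    obtain ⟨n, hn, hnx⟩ := hVt x
    refine ⟨e * d * n, by positivity, ?_⟩
    rw [mul_smul]
    refine ⟨V.nsmul_mem hnx _, ?_, ?_⟩
    · change φ _ = 0
      rw [mul_comm e d, mul_smul, map_nsmul, map_nsmul, heV _ hnx, smul_zero]
    · change ψ _ = 0
      rw [mul_smul, map_nsmul, map_nsmul, hdV _ hnx, smul_zero]
  have hφU : U ≤ U.comap φ := fun x hx => by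
    have : φ x = 0 := hx.2.1
    change φ x ∈ U
    rw [this]; exact U.zero_mem
  have hψU : U ≤ U.comap ψ := fun x hx => by
    have : ψ x = 0 := hx.2.2
    change ψ x ∈ U
    rw [this]; exact U.zero_mem
  let φ' : A ⧸ U →+ A ⧸ U := QuotientAddGroup.map U U φ hφU
  let ψ' : A ⧸ U →+ A ⧸ U := QuotientAddGroup.map U U ψ hψU
  have hφ' : InertialEnd φ' := hφ.of_surjective (QuotientAddGroup.mk' U)
    (QuotientAddGroup.mk'_surjective U) fun a => rfl
  have hψ' : InertialEnd ψ' := hψ.of_surjective (QuotientAddGroup.mk' U)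
    (QuotientAddGroup.mk'_surjective U) fun a => rfl
  obtain ⟨E, hE, hE'⟩ := hφ'.exists_finite_commutator_of_torsion hψ' (fun q => by
    obtain ⟨x, rfl⟩ := QuotientAddGroup.mk_surjective q
    obtain ⟨n, hn, hnx⟩ := hUt x
    exact isOfFinAddOrder_of_nsmul hn (by
      rw [← QuotientAddGroup.mk_nsmul, (QuotientAddGroup.eq_zero_iff _).2 hnx]))
  refine Set.Finite.of_injOn (f := fun x : A => (x : A ⧸ U)) (t := E) ?_ ?_ (Set.toFinite _)
  · rintro _ ⟨x, rfl⟩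
    exact hE' (x : A ⧸ U)
  · rintro _ ⟨x, rfl⟩ _ ⟨y, rfl⟩ h
    have h1 := QuotientAddGroup.eq.1 h
    have h2 := hV _ h1.1 ?_
    · rw [neg_add_eq_zero] at h2
      exact h2
    · have hto : ∀ x, φ (ψ x) - ψ (φ x) ∈ AddCommGroup.torsion A := fun x =>
        AddSubgroup.sub_mem _ (hφt _) (hψt _)
      exact AddSubgroup.add_mem _ (AddSubgroup.neg_mem _ (hto x)) (hto y)

/-- In the group generated by finitely many inertial automorphisms, the elements fixing finitely
many suitable torsion elements preserve the cyclic subgroups generated by the torsion elements. -/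
theorem exists_finite_fixing_imp_power (γ : ι → AutGroup A)
    (hγ : ∀ i, InertialEnd (γ i).toAddEquiv.toAddMonoidHom) :
    ∃ Ω : Set A, Ω.Finite ∧ (∀ ω ∈ Ω, IsOfFinAddOrder ω) ∧
      ∀ κ ∈ Subgroup.closure (Set.range γ), (∀ ω ∈ Ω, κ ω = ω) → κ ∈ powerAutOn (⊤ : AddSubgroup A) := by
  classical
  have hcyc : ∀ X : AddSubgroup A, (∀ i, ∀ x ∈ X, γ i x ∈ AddSubgroup.zmultiples x) →
      Subgroup.closure (Set.range γ) ≤ powerAutOn X := by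
    intro X hX
    rw [Subgroup.closure_le]
    rintro _ ⟨i, rfl⟩ x hx _
    exact hX i x hx
  -- an element of maximal order in a bounded subgroup preserved by `κ` detects the action
  have hmaxord : ∀ (p e : ℕ), p.Prime → ∀ Z : AddSubgroup A, (∀ z ∈ Z, p ^ e • z = 0) →
      ∃ z₀ ∈ Z, ∀ κ ∈ powerAutOn Z, κ z₀ = z₀ → ∀ z ∈ Z, κ z = z := by
    intro p e hp Z hZ
    have hfo : ∀ z ∈ Z, IsOfFinAddOrder z := fun z hz =>
      isOfFinAddOrder_of_nsmul (pow_pos hp.pos e) (hZ z hz)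
    have hmax : ∃ z₀ ∈ Z, ∀ z ∈ Z, addOrderOf z ∣ addOrderOf z₀ := by
      obtain ⟨a₀, h₀, hmaxa⟩ := ({a ∈ Finset.range (e + 1) | ∃ z ∈ Z, addOrderOf z = p ^ a}).exists_max_image
        id ⟨0, by simp⟩
      rw [Finset.mem_filter] at h₀
      obtain ⟨-, z₀, hz₀, hord⟩ := h₀
      refine ⟨z₀, hz₀, fun z hz => ?_⟩
      obtain ⟨b, hb, hzb⟩ := (Nat.dvd_prime_pow hp).1 (addOrderOf_dvd_of_nsmul_eq_zero (hZ z hz))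
      rw [hzb, hord]
      exact pow_dvd_pow p (hmaxa b (Finset.mem_filter.2 ⟨Finset.mem_range.2 (by lia), z, hz, hzb⟩))
    obtain ⟨z₀, hz₀, hdvd⟩ := hmax
    refine ⟨z₀, hz₀, fun κ hκ hfix z hz => ?_⟩
    have := zsmul_eq_of_addOrderOf_dvd (N := Z) (φ := κ.toAddEquiv.toAddMonoidHom)
      (fun x hx => hκ x hx (hfo x hx)) hz₀ hz (hfo _ hz₀) (hdvd z hz) (k := 1)
      (by rw [one_smul]; exact hfix)
    rw [one_smul] at this
    exact this
  obtain ⟨S, hS⟩ := InertialEnd.exists_finset_primes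
    (fun i => (γ i).toAddEquiv.toAddMonoidHom) hγ
  have hprime : ∀ p : ℕ, ∃ Ω : Set A, Ω.Finite ∧ (∀ ω ∈ Ω, IsOfFinAddOrder ω) ∧ (p.Prime →
      ∀ κ ∈ Subgroup.closure (Set.range γ), (∀ ω ∈ Ω, κ ω = ω) →
        ∀ x ∈ AddCommGroup.primaryComponent A p, κ x ∈ AddSubgroup.zmultiples x) := by
    intro p
    by_cases hp : p.Prime
    swap
    · exact ⟨∅, Set.finite_empty, by simp, fun h => absurd h hp⟩
    have := Fact.mk hp
    obtain ⟨X, Y, F, hX, hY, ⟨k, hk⟩, hF, htop⟩ := InertialEnd.exists_sup_eq_primaryComponent hp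
      (fun i => (γ i).toAddEquiv.toAddMonoidHom) hγ
    set P := AddCommGroup.primaryComponent A p with hP
    have hXP : X ≤ P := by rw [← htop]; exact le_sup_left.trans le_sup_left
    have hYP : Y ≤ P := by rw [← htop]; exact le_sup_right.trans le_sup_left
    have hFP : F ≤ P := by rw [← htop]; exact le_sup_right
    obtain ⟨m, hm⟩ : ∃ m : ℕ, ∀ f ∈ F, p ^ m • f = 0 := by
      choose! m hm using fun f (hf : f ∈ F) => (show ∃ m : ℕ, p ^ m • f = 0 from hFP hf)
      have := Fintype.ofFinite F
      refine ⟨Finset.univ.sup fun f : F => m f, fun f hf => ?_⟩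
      obtain ⟨d, hd⟩ := Nat.exists_eq_add_of_le
        (Finset.le_sup (f := fun f : F => m f) (Finset.mem_univ (⟨f, hf⟩ : F)))
      rw [hd, pow_add, mul_comm, mul_smul, hm f hf, smul_zero]
    -- Chosen so that p^e kills both `Y` and `F`. Fixing `F`, an element of largest order of `Y` and
    -- one of X[p^e] makes κ the identity on `Y`, `F` and X[p^e].
    set e := k + m with he
    obtain ⟨y₀, hy₀, hy₀'⟩ := hmaxord p k hp Y hk
    set Z : AddSubgroup A := X ⊓ (p ^ e • AddMonoidHom.id A).ker with hZ
    obtain ⟨z₀, hz₀, hz₀'⟩ := hmaxord p e hp Z fun z hz => hz.2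
    refine ⟨insert y₀ (insert z₀ (F : Set A)), ((Set.toFinite _).insert _).insert _, ?_, fun _ => ?_⟩
    · rintro ω (rfl | rfl | hω)
      · exact isOfFinAddOrder_of_mem_primaryComponent hp (hYP hy₀)
      · exact isOfFinAddOrder_of_mem_primaryComponent hp (hXP hz₀.1)
      · exact isOfFinAddOrder_of_mem_primaryComponent hp (hFP hω)
    intro κ hκ hfix t ht
    have hκY := hy₀' κ (hcyc Y hY hκ) (hfix y₀ (by simp))
    have hκX := hcyc X hX hκ
    have hκZ := hz₀' κ (fun x hx => hκX x hx.1) (hfix z₀ (by simp))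
    rw [← htop] at ht
    obtain ⟨w, hw, f, hf, rfl⟩ := AddSubgroup.mem_sup.1 ht
    obtain ⟨x, hx, y, hy, rfl⟩ := AddSubgroup.mem_sup.1 hw
    have hκf : κ f = f := hfix f (by simp [hf])
    have hyf : p ^ e • (y + f) = 0 := by
      rw [smul_add, he]
      nth_rewrite 1 [add_comm k m]
      rw [pow_add, pow_add, mul_smul, hk y hy, smul_zero, mul_smul, hm f hf, smul_zero, add_zero]
    have hxt := isOfFinAddOrder_of_mem_primaryComponent hp (hXP hx)
    obtain ⟨a, ha⟩ := exists_addOrderOf_eq_prime_pow_iff.2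
      (show ∃ k : ℕ, p ^ k • x = 0 from hXP hx)
    have hκyf : κ (y + f) = y + f := by rw [map_add, hκY y hy, hκf]
    rw [add_assoc, map_add, hκyf]
    rcases le_or_gt a e with hae | hae
    · have hxZ : x ∈ Z := ⟨hx, by
        change p ^ e • x = 0
        rw [← addOrderOf_dvd_iff_nsmul_eq_zero, ha]
        exact pow_dvd_pow p hae⟩
      rw [hκZ x hxZ]
      exact AddSubgroup.mem_zmultiples _
    -- If x has order p^a with a > e, then p^(a-e) x lies in X[p^e] and is fixed, so l ≡ 1 mod p^e.
    -- Hence multiplication by `l` also fixes y + f, and κ multiplies the whole sum by `l`.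
    · obtain ⟨l, hl⟩ := hκX x hx hxt
      simp only at hl
      have hxZ : p ^ (a - e) • x ∈ Z := ⟨X.nsmul_mem hx _, by
        change p ^ e • p ^ (a - e) • x = 0
        rw [← mul_smul, ← pow_add, ← addOrderOf_dvd_iff_nsmul_eq_zero, ha]
        exact pow_dvd_pow p (by lia)⟩
      have h1 := hκZ _ hxZ
      rw [map_nsmul, ← hl, ← sub_eq_zero, ← smul_sub, ← natCast_zsmul] at h1
      have h2 : (((p ^ (a - e) : ℕ) : ℤ) * (l - 1)) • x = 0 := by
        rw [mul_smul, sub_smul, one_smul]; exact h1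
      rw [← addOrderOf_dvd_iff_zsmul_eq_zero, ha, show a = (a - e) + e by lia, pow_add] at h2
      rw [show (a - e + e - e) = a - e by lia, Nat.cast_mul] at h2
      have h3 := Int.dvd_of_mul_dvd_mul_left (by exact_mod_cast pow_ne_zero _ hp.ne_zero) h2
      refine ⟨l, ?_⟩
      simp only
      rw [smul_add, hl]
      congr 1
      obtain ⟨c, hc⟩ := h3
      rw [show l = 1 + c * ((p ^ e : ℕ) : ℤ) by rw [mul_comm]; lia, add_smul, one_smul, mul_smul,
        natCast_zsmul, hyf, smul_zero, add_zero]
  choose Ω hΩ hΩt hΩp using hprime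
  refine ⟨⋃ p ∈ S, Ω p, S.finite_toSet.biUnion fun p _ => hΩ p, ?_, fun κ hκ hfix x _ hx => ?_⟩
  · intro ω hω
    simp only [Set.mem_iUnion] at hω
    obtain ⟨p, _, hω⟩ := hω
    exact hΩt p ω hω
  refine mem_of_forall_prime_power hx ((AddSubgroup.zmultiples x).comap
    κ.toAddEquiv.toAddMonoidHom) fun s hs p k hp hsk => ?_
  refine AddSubgroup.zmultiples_le_of_mem hs (?_ : κ s ∈ AddSubgroup.zmultiples s)
  by_cases hpS : p ∈ S
  · exact hΩp p hp κ hκ (fun ω hω => hfix ω (Set.mem_biUnion hpS hω)) s ⟨k, hsk⟩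
  · exact hcyc _ (fun i => hS p hp hpS i) hκ s ⟨k, hsk⟩ (isOfFinAddOrder_of_nsmul
      (pow_pos hp.pos k) hsk)

end Structure

/-! ### The group IAut₁(A) and its normal subgroup Γ. -/

section InertialGroup

variable {A : Type*} [AddCommGroup A]

theorem actsTriviallyModTorsion_iff (γ : AutGroup A) :
    ActsTriviallyModTorsion γ ↔ ∀ a, IsOfFinAddOrder (γ a - a) := by
  refine forall_congr' fun a => ?_
  rw [eq_comm, QuotientAddGroup.eq, neg_add_eq_sub]
  rfl

theorem ActsTriviallyModTorsion.inertialEnd_sub {γ : AutGroup A}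
    (hγ : InertialEnd γ.toAddEquiv.toAddMonoidHom) :
    InertialEnd (γ.toAddEquiv.toAddMonoidHom - AddMonoidHom.id A) := by
  have := hγ.sub (InertialEnd.zsmul_id (A := A) 1)
  rwa [one_smul] at this

/-- For s running over representatives in `H`, the differences γs - s are torsion and lie in a
finite γ-invariant `E`, so γ maps H + E into itself. For x ∈ H + E, the element γx - x lies in a
finite γ-invariant subgroup of H + E, on which γ is bijective; hence γ⁻¹x ∈ H + E, and `E`
represents the cosets needed. -/
theorem InertialEnd.inv {γ : AutGroup A} (hγ : InertialEnd γ.toAddEquiv.toAddMonoidHom)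
    (ht : ∀ a, IsOfFinAddOrder (γ a - a)) : InertialEnd (γ⁻¹).toAddEquiv.toAddMonoidHom := by
  have hinv : ∀ x : A, IsOfFinAddOrder x → ∃ E : AddSubgroup A, Finite E ∧ x ∈ E ∧
      (∀ y ∈ E, IsOfFinAddOrder y) ∧ ∀ y ∈ E, γ y ∈ E := by
    intro x hx
    obtain ⟨E, hE, hxE, h⟩ := InertialEnd.exists_finite_invariant
      (fun _ : Unit => γ.toAddEquiv.toAddMonoidHom) (fun _ => hγ) hx
    exact ⟨E, hE, hxE, fun y hy => isOfFinAddOrder_of_mem_finite hy, h ()⟩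
  intro H
  obtain ⟨S, hS, hSH, hS'⟩ := hγ.exists_finite_subset H
  -- a finite invariant subgroup containing the elements `γ s - s`
  obtain ⟨E, hE, hES, hEγ⟩ : ∃ E : AddSubgroup A, Finite E ∧ (∀ s ∈ S, γ s - s ∈ E) ∧
      ∀ y ∈ E, γ y ∈ E := by
    choose E hE hxE _ hEγ using fun s => hinv _ (ht s)
    refine ⟨hS.toFinset.sup E, finite_finset_sup _ _ fun s _ => hE s, fun s hs => ?_, ?_⟩
    · exact Finset.le_sup (f := E) (hS.mem_toFinset.2 hs) (hxE s)
    · change hS.toFinset.sup E ≤ (hS.toFinset.sup E).comap γ.toAddEquiv.toAddMonoidHom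
      exact Finset.sup_le fun s hs y hy => Finset.le_sup (f := E) hs (hEγ s y hy)
  have hmap : ∀ x ∈ H ⊔ E, γ x ∈ H ⊔ E := by
    intro x hx
    obtain ⟨h, hh, f, hf, rfl⟩ := AddSubgroup.mem_sup.1 hx
    rw [map_add]
    refine AddSubgroup.add_mem _ ?_ (AddSubgroup.mem_sup_right (hEγ f hf))
    obtain ⟨s, hs, hsh⟩ := hS' h hh
    have : γ h = ((γ h - γ s) + s) + (γ s - s) := by abel
    rw [this]
    exact AddSubgroup.add_mem_sup (H.add_mem hsh (hSH hs)) (hES s hs)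
  have hmapinv : ∀ x ∈ H ⊔ E, γ⁻¹ x ∈ H ⊔ E := by
    intro x hx
    obtain ⟨D, hD, hxD, hDt, hDγ⟩ := hinv _ (ht x)
    have hfin : Finite ((H ⊔ E) ⊓ D : AddSubgroup A) :=
      Finite.of_injective (fun y : ((H ⊔ E) ⊓ D : AddSubgroup A) => (⟨y, y.2.2⟩ : D))
        fun y z h => Subtype.ext (congrArg (fun w : D => (w : A)) h)
    have h1 : γ⁻¹ (γ x - x) ∈ (H ⊔ E) ⊓ D := γ.inv_mem_of_finite
      (E := (H ⊔ E) ⊓ D) (fun y hy => ⟨hmap y hy.1, hDγ y hy.2⟩) ⟨AddSubgroup.sub_mem _ (hmap x hx) hx, hxD⟩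
    rw [map_sub, AutGroup.inv_apply_self] at h1
    have := AddSubgroup.sub_mem _ hx h1.1
    rwa [sub_sub_cancel] at this
  refine ⟨E, Set.toFinite _, fun h hh => ?_⟩
  obtain ⟨a, ha, f, hf, hsum⟩ := AddSubgroup.mem_sup.1
    (hmapinv h (AddSubgroup.mem_sup_left hh))
  refine ⟨f, hf, ?_⟩
  change γ⁻¹ h - f ∈ H
  rw [← hsum, add_sub_cancel_right]
  exact ha

/-- The inertial automorphisms acting trivially modulo torsion. -/
def inertialOne (A : Type*) [AddCommGroup A] : Subgroup (AutGroup A) where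
  carrier := {γ | InertialEnd γ.toAddEquiv.toAddMonoidHom ∧ ∀ a, IsOfFinAddOrder (γ a - a)}
  one_mem' := ⟨by
    have := InertialEnd.zsmul_id (A := A) 1
    rwa [one_smul] at this, fun a => by
    rw [LinearEquiv.coe_one, id_eq, sub_self]; exact IsOfFinAddOrder.zero⟩
  mul_mem' := fun {γ δ} h h' => ⟨h.1.comp h'.1, fun a => by
    have h1 : (γ * δ) a - a = γ (δ a - a) + (γ a - a) := by
      rw [LinearEquiv.mul_apply, map_sub]; abel
    rw [h1]
    exact (γ.isOfFinAddOrder_apply_iff.2 (h'.2 a)).add (h.2 a)⟩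
  inv_mem' := fun {γ} h => ⟨h.1.inv h.2, fun a => by
    have h1 : γ⁻¹ a - a = γ⁻¹ (-(γ a - a)) := by
      rw [neg_sub, map_sub, AutGroup.inv_apply_self]
    rw [h1]
    exact (γ⁻¹).isOfFinAddOrder_apply_iff.2 (h.2 a).neg⟩

theorem IAutOne_eq_inertialOne (A : Type*) [AddCommGroup A] : IAutOne A = inertialOne A := by
  have h : {γ : AutGroup A | IsInertial γ ∧ ActsTriviallyModTorsion γ} = inertialOne A := by
    ext γ
    change _ ∧ _ ↔ _ ∧ _
    rw [isInertial_iff_inertialEnd, actsTriviallyModTorsion_iff]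
  rw [IAutOne, h, Subgroup.closure_eq]

theorem mem_IAutOne_iff (γ : AutGroup A) :
    γ ∈ IAutOne A ↔ IsInertial γ ∧ ActsTriviallyModTorsion γ := by
  rw [IAutOne_eq_inertialOne, isInertial_iff_inertialEnd, actsTriviallyModTorsion_iff]
  rfl

theorem mem_IAutOne_iff_inertialEnd (γ : AutGroup A) : γ ∈ IAutOne A ↔
    InertialEnd γ.toAddEquiv.toAddMonoidHom ∧ ∀ a, IsOfFinAddOrder (γ a - a) := by
  rw [IAutOne_eq_inertialOne]; rfl

/-- The elements of `IAut₁(A)` preserving all cyclic torsion subgroups. -/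
def powerPart (A : Type*) [AddCommGroup A] : Subgroup (IAutOne A) :=
  (powerAutOn (⊤ : AddSubgroup A)).subgroupOf (IAutOne A)

theorem mem_powerPart {γ : IAutOne A} : γ ∈ powerPart A ↔
    ∀ x : A, IsOfFinAddOrder x → (γ : AutGroup A) x ∈ AddSubgroup.zmultiples x := by
  rw [powerPart, Subgroup.mem_subgroupOf, mem_powerAutOn]
  simp

instance powerPart_normal (A : Type*) [AddCommGroup A] : (powerPart A).Normal where
  conj_mem n hn g := by
    rw [mem_powerPart] at hn ⊢
    intro x hx
    obtain ⟨m, hm⟩ := hn ((g : AutGroup A)⁻¹ x) ((g : AutGroup A)⁻¹.isOfFinAddOrder_apply_iff.2 hx)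
    refine ⟨m, ?_⟩
    simp only at hm
    change m • x = (g : AutGroup A) ((n : AutGroup A) ((g : AutGroup A)⁻¹ x))
    rw [← hm, map_zsmul, AutGroup.apply_inv_self]

/-- The orbit of a torsion element under a group generated by finitely many inertial automorphisms
stays in a finite invariant subgroup. -/
theorem relIndex_stabilizer_ne_zero {ι : Type*} [Finite ι] (γ : ι → AutGroup A)
    (hγ : ∀ i, InertialEnd (γ i).toAddEquiv.toAddMonoidHom) {x : A} (hx : IsOfFinAddOrder x) :
    (MulAction.stabilizer (AutGroup A) x).relIndex (Subgroup.closure (Set.range γ)) ≠ 0 := by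
  obtain ⟨E, hE, hxE, hEγ⟩ := InertialEnd.exists_finite_invariant
    (fun i => (γ i).toAddEquiv.toAddMonoidHom) hγ hx
  have horb : (MulAction.orbit (Subgroup.closure (Set.range γ)) x) ⊆ E := by
    rintro _ ⟨κ, rfl⟩
    refine AutGroup.mem_of_mem_closure ?_ κ.2 x hxE
    rintro _ ⟨i, rfl⟩
    exact hEγ i
  have hfin : (MulAction.orbit (Subgroup.closure (Set.range γ)) x).Finite :=
    (Set.toFinite (E : Set A)).subset horb
  have h1 : (MulAction.stabilizer (AutGroup A) x).subgroupOf (Subgroup.closure (Set.range γ))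
      = MulAction.stabilizer (Subgroup.closure (Set.range γ)) x := rfl
  rw [Subgroup.relIndex, h1, MulAction.index_stabilizer]
  exact ((Set.ncard_pos hfin).2 ⟨x, MulAction.mem_orbit_self x⟩).ne'

/-- Lift finitely many generators to IAut₁(A). In the group they generate, the pointwise stabilizer
of a suitable finite set of torsion elements has finite index and lies in Γ. -/
theorem isLocallyFiniteGroup_quotient_powerPart (A : Type*) [AddCommGroup A] :
    IsLocallyFiniteGroup (IAutOne A ⧸ powerPart A) := by
  intro K hK
  obtain ⟨S, hS⟩ := hK
  let γ : S → IAutOne A := fun s => (s : IAutOne A ⧸ powerPart A).out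
  let γ' : S → AutGroup A := fun s => γ s
  have hγ' : ∀ s, InertialEnd (γ' s).toAddEquiv.toAddMonoidHom := fun s =>
    ((mem_IAutOne_iff_inertialEnd _).1 (γ s).2).1
  set L := Subgroup.closure (Set.range γ) with hL
  have hLK : L.map (QuotientGroup.mk' (powerPart A)) = K := by
    rw [hL, MonoidHom.map_closure, ← hS]
    congr 1
    ext q
    constructor
    · rintro ⟨_, ⟨s, rfl⟩, rfl⟩
      change ((s : IAutOne A ⧸ powerPart A).out : IAutOne A ⧸ powerPart A) ∈ S
      rw [QuotientGroup.out_eq']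
      exact s.2
    · exact fun hq => ⟨_, ⟨⟨q, hq⟩, rfl⟩, QuotientGroup.out_eq' q⟩
  have hLL : L.map (IAutOne A).subtype = Subgroup.closure (Set.range γ') := by
    rw [hL, MonoidHom.map_closure, ← Set.range_comp]
    rfl
  obtain ⟨Ω, hΩ, hΩt, hΩp⟩ := exists_finite_fixing_imp_power γ' hγ'
  have hne : (⨅ ω : Ω, MulAction.stabilizer (AutGroup A) (ω : A)).relIndex
      (Subgroup.closure (Set.range γ')) ≠ 0 := by
    have := hΩ.to_subtype
    exact Subgroup.relIndex_iInf_ne_zero fun ω => relIndex_stabilizer_ne_zero γ' hγ' (hΩt ω ω.2)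
  have hne2 : (powerPart A).relIndex L ≠ 0 := by
    have h1 : (powerAutOn (⊤ : AddSubgroup A)).relIndex (Subgroup.closure (Set.range γ')) ≠ 0 := by
      have hle : (⨅ ω : Ω, MulAction.stabilizer (AutGroup A) (ω : A)) ⊓
          Subgroup.closure (Set.range γ') ≤ powerAutOn (⊤ : AddSubgroup A) := by
        rintro κ ⟨hκ, hκ'⟩
        refine hΩp κ hκ' fun ω hω => ?_
        exact (Subgroup.mem_iInf.1 hκ ⟨ω, hω⟩)
      intro h0
      apply hne
      rw [← Subgroup.inf_relIndex_right]
      exact Subgroup.relIndex_eq_zero_of_le_left hle h0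
    rw [← hLL] at h1
    have h2 := Subgroup.relIndex_comap (powerAutOn (⊤ : AddSubgroup A)) (IAutOne A).subtype L
    rw [powerPart, Subgroup.subgroupOf, h2]
    exact h1
  rw [← hLK]
  have h3 : Nat.card (L.map (QuotientGroup.mk' (powerPart A))) ≠ 0 := by
    have h4 := Subgroup.relIndex_ker (K := L) (QuotientGroup.mk' (powerPart A))
    rw [QuotientGroup.ker_mk'] at h4
    rw [← h4]
    exact hne2
  exact Nat.finite_of_card_ne_zero h3

/-- The automorphisms fixing the torsion elements and moving all elements inside a finite set of
torsion elements. -/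
def finitaryStab (A : Type*) [AddCommGroup A] : Subgroup (AutGroup A) where
  carrier := {γ | (∀ x, IsOfFinAddOrder x → γ x = x) ∧
    ∃ E : AddSubgroup A, Finite E ∧ ∀ x, γ x - x ∈ E}
  one_mem' := ⟨fun _ _ => rfl, ⊥, inferInstance, fun x => by
    rw [LinearEquiv.coe_one, id_eq, sub_self]; exact AddSubgroup.zero_mem _⟩
  mul_mem' := by
    rintro γ δ ⟨h, E, hE, hγ⟩ ⟨h', D, hD, hδ⟩
    refine ⟨fun x hx => by rw [LinearEquiv.mul_apply, h' x hx, h x hx], E ⊔ D, finite_sup hE hD,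
      fun x => ?_⟩
    have : (γ * δ) x - x = (γ (δ x) - δ x) + (δ x - x) := by
      rw [LinearEquiv.mul_apply]; abel
    rw [this]
    exact AddSubgroup.add_mem_sup (hγ _) (hδ _)
  inv_mem' := by
    rintro γ ⟨h, E, hE, hγ⟩
    refine ⟨fun x hx => ?_, E, hE, fun x => ?_⟩
    · nth_rewrite 1 [← h x hx]
      rw [AutGroup.inv_apply_self]
    · have := E.neg_mem (hγ (γ⁻¹ x))
      rwa [AutGroup.apply_inv_self, neg_sub] at this

theorem finitaryStab.isOfFinAddOrder {γ : AutGroup A} (hγ : γ ∈ finitaryStab A) (x : A) :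
    IsOfFinAddOrder (γ x - x) := by
  obtain ⟨E, hE, h⟩ := hγ.2
  exact isOfFinAddOrder_of_mem_finite (h x)

theorem finitaryStab.pow_apply {γ : AutGroup A} (hγ : γ ∈ finitaryStab A) (n : ℕ) (x : A) :
    (γ ^ n) x = x + n • (γ x - x) := by
  induction n with
  | zero => simp
  | succ n ih =>
    rw [pow_succ', LinearEquiv.mul_apply, ih, map_add, map_nsmul,
      hγ.1 _ (finitaryStab.isOfFinAddOrder hγ x), add_smul, one_smul]
    abel

theorem finitaryStab.zpow_apply {γ : AutGroup A} (hγ : γ ∈ finitaryStab A) (n : ℤ) (x : A) :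
    (γ ^ n) x = x + n • (γ x - x) := by
  obtain ⟨n, rfl | rfl⟩ := n.eq_nat_or_neg
  · rw [zpow_natCast, finitaryStab.pow_apply hγ, natCast_zsmul]
  · rw [zpow_neg, zpow_natCast]
    apply LinearEquiv.injective (γ ^ n)
    rw [AutGroup.apply_inv_self, finitaryStab.pow_apply hγ, map_add, map_zsmul,
      hγ.1 _ (finitaryStab.isOfFinAddOrder hγ x), neg_smul, natCast_zsmul]
    have h1 : x + -(n • (γ x - x)) - x = -(n • (γ x - x)) := by abel
    have h2 : (γ x + -(n • (γ x - x))) - (x + -(n • (γ x - x))) = γ x - x := by abel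
    rw [h2]
    abel

theorem finitaryStab.isOfFinOrder {γ : AutGroup A} (hγ : γ ∈ finitaryStab A) :
    IsOfFinOrder γ := by
  obtain ⟨E, hE, h⟩ := hγ.2
  refine isOfFinOrder_iff_pow_eq_one.2 ⟨Nat.card E, Nat.card_pos, ?_⟩
  ext x
  rw [finitaryStab.pow_apply hγ]
  have : Nat.card E • (⟨_, h x⟩ : E) = 0 := card_nsmul_eq_zero'
  have h2 : Nat.card E • (γ x - x) = 0 := congrArg Subtype.val this
  rw [h2, add_zero]
  rfl

theorem finitaryStab.mul_comm {γ δ : AutGroup A} (hγ : γ ∈ finitaryStab A)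
    (hδ : δ ∈ finitaryStab A) : γ * δ = δ * γ := by
  have key : ∀ {γ δ : AutGroup A}, γ ∈ finitaryStab A → δ ∈ finitaryStab A → ∀ x,
      (γ * δ) x = γ x + (δ x - x) := by
    intro γ δ hγ hδ x
    rw [LinearEquiv.mul_apply]
    nth_rewrite 1 [show δ x = x + (δ x - x) by abel]
    rw [map_add, hγ.1 _ (finitaryStab.isOfFinAddOrder hδ x)]
  ext x
  rw [key hγ hδ, key hδ hγ]
  abel

/-- Commutators in the power part lie in `finitaryStab A`. -/
theorem commutator_powerPart_le : (commutator (powerPart A)) ≤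
    (finitaryStab A).comap ((IAutOne A).subtype.comp (powerPart A).subtype) := by
  rw [commutator_def, Subgroup.commutator_le]
  rintro γ - δ -
  set g : AutGroup A := ((γ : IAutOne A) : AutGroup A) with hg
  set d : AutGroup A := ((δ : IAutOne A) : AutGroup A) with hd
  change g * d * g⁻¹ * d⁻¹ ∈ finitaryStab A
  have hgm := (mem_IAutOne_iff_inertialEnd g).1 (γ : IAutOne A).2
  have hdm := (mem_IAutOne_iff_inertialEnd d).1 (δ : IAutOne A).2
  have hgp := mem_powerPart.1 γ.2
  have hdp := mem_powerPart.1 δ.2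
  have hcomm : g * d * g⁻¹ * d⁻¹ = g * d * (d * g)⁻¹ := by group
  rw [hcomm]
  have hdiff : ∀ x, (g * d * (d * g)⁻¹) x - x = g (d ((d * g)⁻¹ x)) - d (g ((d * g)⁻¹ x)) := by
    intro x
    have : x = d (g ((d * g)⁻¹ x)) := (AutGroup.apply_inv_self (d * g) x).symm
    nth_rewrite 2 [this]
    rfl
  have hfin := InertialEnd.exists_finite_commutator
    (ActsTriviallyModTorsion.inertialEnd_sub hgm.1)
    (ActsTriviallyModTorsion.inertialEnd_sub hdm.1) hgm.2 hdm.2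
  refine ⟨fun x hx => ?_, ?_⟩
  · rw [← sub_eq_zero, hdiff, sub_eq_zero]
    exact comm_of_mem_zmultiples (φ := g.toAddEquiv.toAddMonoidHom)
      (ψ := d.toAddEquiv.toAddMonoidHom) (hgp _ ((d * g)⁻¹.isOfFinAddOrder_apply_iff.2 hx))
      (hdp _ ((d * g)⁻¹.isOfFinAddOrder_apply_iff.2 hx))
  · let θ : A →+ A := g.toAddEquiv.toAddMonoidHom.comp d.toAddEquiv.toAddMonoidHom -
      d.toAddEquiv.toAddMonoidHom.comp g.toAddEquiv.toAddMonoidHom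
    have hθ : (θ.range : Set A).Finite := by
      refine hfin.subset ?_
      rintro _ ⟨x, rfl⟩
      refine ⟨x, ?_⟩
      change g (d x - x) - (d x - x) - (d (g x - x) - (g x - x)) = g (d x) - d (g x)
      rw [map_sub, map_sub]
      abel
    exact ⟨θ.range, hθ.to_subtype, fun x => ⟨(d * g)⁻¹ x, (hdiff x).symm⟩⟩

/-- For ν in N, the differences νx - x lie in a finite torsion group `E`, on which γ acts as an
integer `l`. Since ν fixes torsion elements and γ⁻¹x - x is torsion, γνγ⁻¹ sends x to x + l(νx - x),
so it is ν to the power `l`. -/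
theorem normal_of_le_commutator_powerPart {N : Subgroup (powerPart A)}
    (hN : N ≤ commutator (powerPart A)) : N.Normal where
  conj_mem n hn g := by
    have hn' := commutator_powerPart_le (hN hn)
    set ν : AutGroup A := ((n : IAutOne A) : AutGroup A) with hν
    set γ : AutGroup A := ((g : IAutOne A) : AutGroup A) with hγ
    change ν ∈ finitaryStab A at hn'
    obtain ⟨E, hE, hνE⟩ := hn'.2
    obtain ⟨l, hl⟩ := exists_zsmul_of_finite E γ.toAddEquiv.toAddMonoidHom fun x hx =>
      mem_powerPart.1 g.2 x (isOfFinAddOrder_of_mem_finite hx)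
    have hconj : g * n * g⁻¹ = n ^ l := by
      apply Subtype.ext
      apply Subtype.ext
      change γ * ν * γ⁻¹ = ν ^ l
      ext x
      rw [finitaryStab.zpow_apply hn', ← hl _ (hνE x)]
      change γ (ν (γ⁻¹ x)) = x + γ (ν x - x)
      have h1 : IsOfFinAddOrder (γ⁻¹ x - x) := by
        have := ((mem_IAutOne_iff_inertialEnd γ).1 (g : IAutOne A).2).2 (γ⁻¹ x)
        rw [AutGroup.apply_inv_self] at this
        rw [← neg_sub]
        exact this.neg
      have h2 := hn'.1 _ h1
      rw [map_sub] at h2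
      have h3 : ν (γ⁻¹ x) = γ⁻¹ x + (ν x - x) := by
        rw [← sub_eq_zero] at h2 ⊢
        rw [← h2]; abel
      rw [h3, map_add, AutGroup.apply_inv_self]
    rw [hconj]
    exact N.zpow_mem hn l

end InertialGroup

/-! ### Projections along a direct sum containing the values of a map. -/

section Projections

variable {A : Type*} [AddCommGroup A]

/-- The `P`-component is unique because `P` and `C` are disjoint, hence additive. Only the values of
θ need lie in P + C, which permits splitting off the p-part of a map with torsion image. -/
theorem exists_projection {B : Type*} [AddCommGroup B] (θ : B →+ A) (P C : AddSubgroup A)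
    (hd : Disjoint P C) (h : ∀ b, ∃ s ∈ P, θ b - s ∈ C) :
    ∃ π : B →+ A, ∀ b, π b ∈ P ∧ θ b - π b ∈ C := by
  choose f hf hf' using h
  have huniq : ∀ b, ∀ s ∈ P, θ b - s ∈ C → f b = s := by
    intro b s hs hs'
    have h1 := C.sub_mem hs' (hf' b)
    rw [sub_sub_sub_cancel_left] at h1
    exact sub_eq_zero.1 (AddSubgroup.disjoint_def.1 hd (P.sub_mem (hf b) hs) h1)
  refine ⟨AddMonoidHom.mk' f fun x y => huniq _ _ (P.add_mem (hf x) (hf y)) ?_,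
    fun b => ⟨hf b, hf' b⟩⟩
  have := C.add_mem (hf' x) (hf' y)
  rw [map_add]
  convert this using 1
  abel

end Projections

/-! ### Finiteness of B/p^k B for groups of finite rank without p-torsion. -/

section FiniteRank


/-- Lifts to `B` of a basis of `V` are independent over ℤ: a relation reduces to a trivial one
modulo p, so its coefficients are divisible by p, and p can be cancelled as `B` has no p-torsion.
Descent makes the coefficients zero, so the basis is no larger than the rank. -/
theorem finite_of_surjective_of_rank_lt_aleph0.{u} {B V : Type u} [AddCommGroup B] [AddCommGroup V]
    {p : ℕ} [Fact p.Prime] [Module (ZMod p) V] (hB : ∀ x : B, p • x = 0 → x = 0)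
    (hr : Module.rank ℤ B < Cardinal.aleph0) (f : B →+ V) (hf : Function.Surjective f) :
    Finite V := by
  have hp : p.Prime := Fact.out
  let bas := Module.Basis.ofVectorSpace (ZMod p) V
  choose v hv using fun i => hf (bas i)
  have hstep : ∀ l : Module.Basis.ofVectorSpaceIndex (ZMod p) V →₀ ℤ,
      Finsupp.linearCombination ℤ v l = 0 → ∃ l', l = (p : ℤ) • l' ∧
        Finsupp.linearCombination ℤ v l' = 0 := by
    intro l hl
    have h1 : Finsupp.linearCombination (ZMod p) bas (l.mapRange (Int.cast : ℤ → ZMod p) (by simp))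
        = 0 := by
      have h2 := congrArg f hl
      rw [map_zero, Finsupp.linearCombination_apply, Finsupp.sum, map_sum] at h2
      rw [Finsupp.linearCombination_apply, Finsupp.sum_mapRange_index (by simp), Finsupp.sum, ← h2]
      refine Finset.sum_congr rfl fun i _ => ?_
      rw [map_zsmul, hv, Int.cast_smul_eq_zsmul]
    have h3 := (linearIndependent_iff.1 bas.linearIndependent) _ h1
    have h4 : ∀ i, (p : ℤ) ∣ l i := fun i => by
      have := DFunLike.congr_fun h3 i
      rw [Finsupp.mapRange_apply] at this
      exact (ZMod.intCast_zmod_eq_zero_iff_dvd _ _).1 (by simpa using this)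
    refine ⟨l.mapRange (· / (p : ℤ)) (by simp), ?_, ?_⟩
    · ext i
      simp only [Finsupp.smul_apply, Finsupp.mapRange_apply, smul_eq_mul]
      exact (Int.mul_ediv_cancel' (h4 i)).symm
    · apply hB
      rw [← natCast_zsmul, ← map_smul]
      have : (p : ℤ) • l.mapRange (· / (p : ℤ)) (by simp) = l := by
        ext i
        simp only [Finsupp.smul_apply, Finsupp.mapRange_apply, smul_eq_mul]
        exact Int.mul_ediv_cancel' (h4 i)
      rw [this, hl]
  have hind : LinearIndependent ℤ v := by
    rw [linearIndependent_iff]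
    intro l hl
    have hall : ∀ n : ℕ, ∃ l', l = ((p : ℤ) ^ n) • l' ∧ Finsupp.linearCombination ℤ v l' = 0 := by
      intro n
      induction n with
      | zero => exact ⟨l, by simp, hl⟩
      | succ n ih =>
        obtain ⟨l', rfl, hl'⟩ := ih
        obtain ⟨l'', rfl, hl''⟩ := hstep l' hl'
        exact ⟨l'', by rw [pow_succ, mul_smul], hl''⟩
    ext i
    by_contra hne
    obtain ⟨l', hl', -⟩ := hall (l i).natAbs
    have h1 : (p : ℤ) ^ (l i).natAbs ∣ l i := ⟨l' i, by
      conv_lhs => rw [hl']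
      rfl⟩
    have h2 := Int.natAbs_dvd_natAbs.2 h1
    rw [Int.natAbs_pow, Int.natAbs_natCast] at h2
    have h3 := Nat.le_of_dvd (Int.natAbs_pos.2 hne) h2
    exact absurd h3 (not_le.2 (Nat.lt_pow_self hp.one_lt))
  have hfin : Finite (Module.Basis.ofVectorSpaceIndex (ZMod p) V) :=
    Cardinal.lt_aleph0_iff_finite.1 (lt_of_le_of_lt hind.cardinal_le_rank hr)
  have : Module.Finite (ZMod p) V := Module.Finite.of_basis bas
  exact Module.finite_of_finite (ZMod p)

theorem finite_of_rank_lt_aleph0 {B : Type*} [AddCommGroup B] {p : ℕ} (hp : p.Prime)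
    (hB : ∀ x : B, p • x = 0 → x = 0) (hr : Module.rank ℤ B < Cardinal.aleph0) :
    ∃ S : Set B, S.Finite ∧ ∀ b, ∃ s ∈ S, ∃ c, b = s + p • c := by
  have := Fact.mk hp
  set R : AddSubgroup B := (p • AddMonoidHom.id B).range with hR
  have hpV : ∀ x : B ⧸ R, p • x = 0 := by
    intro q
    obtain ⟨x, rfl⟩ := QuotientAddGroup.mk_surjective q
    rw [← QuotientAddGroup.mk_nsmul, QuotientAddGroup.eq_zero_iff]
    exact ⟨x, rfl⟩
  let m : Module (ZMod p) (B ⧸ R) := AddCommGroup.zmodModule hpV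
  have hV : Finite (B ⧸ R) := finite_of_surjective_of_rank_lt_aleph0 (p := p) hB hr
    (QuotientAddGroup.mk' R) (QuotientAddGroup.mk'_surjective R)
  refine ⟨Set.range fun q : B ⧸ R => q.out, Set.finite_range _, fun b => ?_⟩
  refine ⟨_, ⟨(b : B ⧸ R), rfl⟩, ?_⟩
  have h1 := QuotientAddGroup.eq.1 (QuotientAddGroup.out_eq' (b : B ⧸ R))
  obtain ⟨c, hc⟩ := h1
  refine ⟨c, ?_⟩
  have hc' : p • c = -Quotient.out (b : B ⧸ R) + b := hc
  simp only
  rw [hc']; abel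

theorem finite_pow_of_rank_lt_aleph0 {B : Type*} [AddCommGroup B] {p : ℕ} (hp : p.Prime)
    (hB : ∀ x : B, p • x = 0 → x = 0) (hr : Module.rank ℤ B < Cardinal.aleph0) (k : ℕ) :
    ∃ S : Set B, S.Finite ∧ ∀ b, ∃ s ∈ S, ∃ c, b = s + p ^ k • c := by
  induction k with
  | zero => exact ⟨{0}, Set.finite_singleton 0, fun b => ⟨0, rfl, b, by simp⟩⟩
  | succ k ih =>
    obtain ⟨S, hS, hS'⟩ := ih
    obtain ⟨R, hR, hR'⟩ := finite_of_rank_lt_aleph0 hp hB hr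
    refine ⟨Set.image2 (fun s r => s + p ^ k • r) S R, hS.image2 _ hR, fun b => ?_⟩
    obtain ⟨s, hs, c, rfl⟩ := hS' b
    obtain ⟨r, hr, d, rfl⟩ := hR' c
    refine ⟨_, ⟨s, hs, r, hr, rfl⟩, d, ?_⟩
    rw [smul_add, pow_succ, mul_smul, add_assoc]

end FiniteRank

/-! ### The automorphisms γ_(p) for p in π_*(A). -/

section PiStar

variable {A : Type*} [AddCommGroup A] {p : ℕ}

theorem InPiStar.exists_pow_smul_eq_zero (h : InPiStar A p) :
    ∃ k : ℕ, ∀ x ∈ AddCommGroup.primaryComponent A p, p ^ k • x = 0 := by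
  have hp := h.1
  have hb : ∃ n : ℕ, 0 < n ∧ ∀ x ∈ AddCommGroup.primaryComponent A p, n • x = 0 := by
    rcases h.2.2 with hfin | ⟨-, hb⟩
    · refine ⟨Nat.card (AddCommGroup.primaryComponent A p), Nat.card_pos, fun x hx => ?_⟩
      have : Nat.card (AddCommGroup.primaryComponent A p) •
        (⟨x, hx⟩ : AddCommGroup.primaryComponent A p) = 0 := card_nsmul_eq_zero'
      exact congrArg Subtype.val this
    · exact hb
  obtain ⟨n, hn, hnx⟩ := hb
  -- The bound `n` itself serves as exponent: if x has order p^i, then i < p^i ≤ n.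
  refine ⟨n, fun x hx => ?_⟩
  have := Fact.mk hp
  obtain ⟨i, hi⟩ := exists_addOrderOf_eq_prime_pow_iff.2 (show ∃ k : ℕ, p ^ k • x = 0 from hx)
  have h1 : p ^ i ≤ n := Nat.le_of_dvd hn (hi ▸ addOrderOf_dvd_of_nsmul_eq_zero (hnx x hx))
  have h2 : i < p ^ i := Nat.lt_pow_self hp.one_lt
  rw [← addOrderOf_dvd_iff_nsmul_eq_zero, hi]
  exact pow_dvd_pow p (by lia)

theorem InPiStar.exists_eq_add (h : InPiStar A p) (k : ℕ) (a : A) :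
    ∃ b, ∃ s ∈ AddCommGroup.primaryComponent A p, a = p ^ k • b + s := by
  induction k with
  | zero => exact ⟨a, 0, AddSubgroup.zero_mem _, by simp⟩
  | succ k ih =>
    obtain ⟨b, s, hs, rfl⟩ := ih
    obtain ⟨q, hq⟩ := h.2.1 (b : A ⧸ AddCommGroup.primaryComponent A p)
    obtain ⟨c, rfl⟩ := QuotientAddGroup.mk_surjective q
    rw [← QuotientAddGroup.mk_nsmul, QuotientAddGroup.eq] at hq
    refine ⟨c, p ^ k • (-(p • c) + b) + s,
      AddSubgroup.add_mem _ (AddSubgroup.nsmul_mem _ hq _) hs, ?_⟩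
    rw [smul_add, smul_neg, pow_succ, mul_smul]
    abel

/-- A is the sum of A_p and p^k A. When p^k kills A_p, any complement of A_p contains p^k A and so
equals it; this yields uniqueness and centrality of γ_(p). -/
theorem InPiStar.ext_hom (h : InPiStar A p) {k : ℕ} {f g : A →+ A}
    (h1 : ∀ x ∈ AddCommGroup.primaryComponent A p, f x = g x)
    (h2 : ∀ b, f (p ^ k • b) = g (p ^ k • b)) : f = g := by
  ext a
  obtain ⟨b, s, hs, rfl⟩ := h.exists_eq_add k a
  rw [map_add, map_add, h1 s hs, h2]

theorem IsOneSumMul.apply_pow_smul {γ : AutGroup A} (hγ : IsOneSumMul p γ) {k : ℕ}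
    (hk : ∀ x ∈ AddCommGroup.primaryComponent A p, p ^ k • x = 0) (b : A) :
    γ (p ^ k • b) = p • p ^ k • b := by
  obtain ⟨C, hC, h1, h2⟩ := hγ
  obtain ⟨s, hs, c, hc, rfl⟩ := AddSubgroup.mem_sup.1
    (show b ∈ AddCommGroup.primaryComponent A p ⊔ C by rw [hC.sup_eq_top]; trivial)
  rw [smul_add, hk s hs, zero_add, h2 _ (C.nsmul_mem hc _)]

theorem IsOneSumMul.apply_of_mem {γ : AutGroup A} (hγ : IsOneSumMul p γ) {x : A}
    (hx : x ∈ AddCommGroup.primaryComponent A p) : γ x = x := by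
  obtain ⟨C, hC, h1, h2⟩ := hγ
  exact h1 x hx

theorem IsOneSumMul.unique (h : InPiStar A p) {γ δ : AutGroup A} (hγ : IsOneSumMul p γ)
    (hδ : IsOneSumMul p δ) : γ = δ := by
  obtain ⟨k, hk⟩ := h.exists_pow_smul_eq_zero
  have := h.ext_hom (k := k) (f := γ.toAddEquiv.toAddMonoidHom) (g := δ.toAddEquiv.toAddMonoidHom)
    (fun x hx => (hγ.apply_of_mem hx).trans (hδ.apply_of_mem hx).symm)
    (fun b => (hγ.apply_pow_smul hk b).trans (hδ.apply_pow_smul hk b).symm)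
  ext x
  exact DFunLike.congr_fun this x

theorem IsOneSumMul.mem_center (h : InPiStar A p) {γ : AutGroup A} (hγ : IsOneSumMul p γ) :
    γ ∈ Subgroup.center (AutGroup A) := by
  obtain ⟨k, hk⟩ := h.exists_pow_smul_eq_zero
  rw [Subgroup.mem_center_iff]
  intro α
  have := h.ext_hom (k := k) (f := (α * γ : AutGroup A).toAddEquiv.toAddMonoidHom)
    (g := (γ * α : AutGroup A).toAddEquiv.toAddMonoidHom) (fun x hx => ?_) (fun b => ?_)
  · ext x
    exact DFunLike.congr_fun this x
  · change α (γ x) = γ (α x)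
    have hαx : α x ∈ AddCommGroup.primaryComponent A p := by
      obtain ⟨j, hj⟩ := hx
      exact ⟨j, by rw [← map_nsmul, hj, map_zero]⟩
    rw [hγ.apply_of_mem hx, hγ.apply_of_mem hαx]
  · change α (γ (p ^ k • b)) = γ (α (p ^ k • b))
    rw [hγ.apply_pow_smul hk, map_nsmul, map_nsmul, hγ.apply_pow_smul hk]

theorem InPiStar.exists_isOneSumMul (h : InPiStar A p) : ∃ γ : AutGroup A, IsOneSumMul p γ := by
  obtain ⟨k, hk⟩ := h.exists_pow_smul_eq_zero
  set P := AddCommGroup.primaryComponent A p with hP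
  set C : AddSubgroup A := (p ^ k • AddMonoidHom.id A).range with hC
  have hd : Disjoint P C := by
    refine AddSubgroup.disjoint_def.2 ?_
    rintro x ⟨j, hj⟩ ⟨b, rfl⟩
    refine hk b ⟨j + k, ?_⟩
    rw [pow_add, mul_smul]
    exact hj
  have hdec : ∀ b : A, ∃ s ∈ P, AddMonoidHom.id A b - s ∈ C := by
    intro a
    obtain ⟨b, s, hs, rfl⟩ := h.exists_eq_add k a
    refine ⟨s, hs, b, ?_⟩
    simp
  obtain ⟨π, hπ⟩ := exists_projection (AddMonoidHom.id A) P C hd hdec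
  have hπ1 : ∀ x, π x ∈ P := fun x => (hπ x).1
  have hπ2 : ∀ x, x - π x ∈ C := fun x => (hπ x).2
  have hπP : ∀ x ∈ P, π x = x := by
    intro x hx
    have := AddSubgroup.disjoint_def.1 hd (P.sub_mem hx (hπ1 x)) (hπ2 x)
    exact (sub_eq_zero.1 this).symm
  have hπC : ∀ x ∈ C, π x = 0 := by
    intro x hx
    have := C.sub_mem hx (hπ2 x)
    rw [sub_sub_cancel] at this
    exact AddSubgroup.disjoint_def.1 hd (hπ1 x) this
  let f : A →+ A := p • (AddMonoidHom.id A - π) + π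
  have hf : ∀ x, f x = p • (x - π x) + π x := fun x => rfl
  have hbij : Function.Bijective f := by
    constructor
    · rw [injective_iff_map_eq_zero]
      intro x hx
      rw [hf] at hx
      have h1 : p • (x - π x) = - π x := eq_neg_of_add_eq_zero_left hx
      have h2 : π x = 0 := by
        have h3 := C.nsmul_mem (hπ2 x) p
        rw [h1] at h3
        exact neg_eq_zero.1 (AddSubgroup.disjoint_def.1 hd (P.neg_mem (hπ1 x)) h3)
      have h4 := hπ2 x
      rw [h2, neg_zero, sub_zero] at h1
      rw [h2, sub_zero] at h4
      exact AddSubgroup.disjoint_def.1 hd ⟨1, by rw [pow_one, h1]⟩ h4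
    · intro a
      obtain ⟨b, hb⟩ := hπ2 a
      have hb' : p ^ k • b = a - π a := hb
      obtain ⟨c, s, hs, rfl⟩ := h.exists_eq_add 1 b
      have hc : p ^ k • c ∈ C := ⟨c, rfl⟩
      refine ⟨p ^ k • c + π a, ?_⟩
      rw [hf, map_add, hπC _ hc, hπP _ (hπ1 a), zero_add, add_sub_cancel_right]
      rw [smul_add, hk s hs, add_zero, pow_one, smul_comm] at hb'
      rw [hb', sub_add_cancel]
  refine ⟨LinearEquiv.ofBijective f.toIntLinearMap hbij, C, ⟨hd, codisjoint_iff.2 ?_⟩, ?_, ?_⟩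
  · refine eq_top_iff.2 fun x _ => ?_
    have : x = π x + (x - π x) := by abel
    rw [this]
    exact AddSubgroup.add_mem_sup (hπ1 x) (hπ2 x)
  · intro a ha
    change f a = a
    rw [hf, hπP a ha, sub_self, smul_zero, zero_add]
  · intro c hc
    change f c = p • c
    rw [hf, hπC c hc, sub_zero, add_zero]

theorem IsOneSumMul.inertialEnd (h : InPiStar A p) {γ : AutGroup A} (hγ : IsOneSumMul p γ) :
    InertialEnd γ.toAddEquiv.toAddMonoidHom := by
  obtain ⟨k, hk⟩ := h.exists_pow_smul_eq_zero
  obtain ⟨C, hC, h1, h2⟩ := hγ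
  set P := AddCommGroup.primaryComponent A p with hP
  obtain ⟨π, hπ⟩ := exists_projection (AddMonoidHom.id A) P C hC.disjoint (fun b => by
    obtain ⟨s, hs, c, hc, rfl⟩ := AddSubgroup.mem_sup.1
      (show b ∈ P ⊔ C by rw [hC.sup_eq_top]; trivial)
    exact ⟨s, hs, by simpa using hc⟩)
  have hπ1 : ∀ x, π x ∈ P := fun x => (hπ x).1
  have hπ2 : ∀ x, x - π x ∈ C := fun x => (hπ x).2
  have hπP : ∀ x ∈ P, π x = x := by
    intro x hx
    have := AddSubgroup.disjoint_def.1 hC.disjoint (P.sub_mem hx (hπ1 x)) (hπ2 x)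
    exact (sub_eq_zero.1 this).symm
  -- For finite A_p this is clear. Otherwise H/(H ∩ A_p) has finite rank and no p-torsion, so H is a
  -- finite set plus p^k H plus H ∩ A_p; π kills p^k H and is the identity on H ∩ A_p.
  have hπin : InertialEnd π := by
    intro H
    rcases h.2.2 with hfin | ⟨hr, -⟩
    · exact ⟨P, Set.toFinite _, fun x _ => ⟨π x, hπ1 x, by simp⟩⟩
    · set B := H.map (QuotientAddGroup.mk' P) with hB
      have htf : ∀ x : B, p • x = 0 → x = 0 := by
        rintro ⟨_, x, hx, rfl⟩ h0
        have h3 : p • (QuotientAddGroup.mk' P x) = 0 := congrArg Subtype.val h0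
        apply Subtype.ext
        change (QuotientAddGroup.mk' P x) = 0
        rw [← map_nsmul, QuotientAddGroup.mk'_apply, QuotientAddGroup.eq_zero_iff] at h3
        rw [QuotientAddGroup.mk'_apply, QuotientAddGroup.eq_zero_iff]
        obtain ⟨j, hj⟩ := h3
        exact ⟨j + 1, by rw [pow_succ, mul_smul, hj]⟩
      have hrB : Module.rank ℤ B < Cardinal.aleph0 := by
        refine lt_of_le_of_lt ?_ hr
        refine (LinearMap.rank_le_of_injective (B.subtype.toIntLinearMap)
          B.subtype_injective).trans ?_
        exact LinearMap.rank_le_of_surjective ((QuotientAddGroup.mk' P).toIntLinearMap)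
          (QuotientAddGroup.mk'_surjective P)
      obtain ⟨S, hS, hS'⟩ := finite_pow_of_rank_lt_aleph0 h.1 htf hrB k
      choose f hf hf' using fun b : B => b.2
      refine ⟨(fun b => π (f b)) '' S, hS.image _, fun x hx => ?_⟩
      obtain ⟨s, hs, c, hc⟩ := hS' ⟨_, x, hx, rfl⟩
      refine ⟨_, ⟨s, hs, rfl⟩, ?_⟩
      have h3 : QuotientAddGroup.mk' P x = s + p ^ k • (c : A ⧸ P) := congrArg Subtype.val hc
      rw [← hf' s, ← hf' c, ← map_nsmul, ← map_add] at h3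
      have h4 : x - (f s + p ^ k • f c) ∈ P := by
        rw [← QuotientAddGroup.eq_zero_iff, QuotientAddGroup.mk_sub]
        exact sub_eq_zero.2 h3
      have h5 := hπP _ h4
      rw [map_sub, map_add, map_nsmul, hk _ (hπ1 _), add_zero] at h5
      simp only
      rw [h5]
      exact H.sub_mem hx (H.add_mem (hf s) (H.nsmul_mem (hf c) _))
  have heq : γ.toAddEquiv.toAddMonoidHom
      = (p : ℤ) • AddMonoidHom.id A + (1 - (p : ℤ)) • π := by
    ext x
    change γ x = (p : ℤ) • x + (1 - (p : ℤ)) • π x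
    have : x = π x + (x - π x) := by abel
    nth_rewrite 1 [this]
    rw [map_add, h1 _ (hπ1 x), h2 _ (hπ2 x), sub_smul, one_smul, natCast_zsmul, natCast_zsmul,
      smul_sub]
    abel
  rw [heq]
  exact (InertialEnd.zsmul_id _).add (hπin.zsmul _)

/-- The map is the identity on A_p, and multiplication by p on every other primary component, since
there each element is a multiple of p^k. -/
theorem IsOneSumMul.mem_powerAutOn (h : InPiStar A p) {γ : AutGroup A} (hγ : IsOneSumMul p γ) :
    γ ∈ powerAutOn (⊤ : AddSubgroup A) := by
  intro x _ hx
  refine mem_of_forall_prime_power hx ((AddSubgroup.zmultiples x).comap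
    γ.toAddEquiv.toAddMonoidHom) fun s hs q j hq hsq => ?_
  refine AddSubgroup.zmultiples_le_of_mem hs (?_ : γ s ∈ AddSubgroup.zmultiples s)
  by_cases hqp : q = p
  · subst hqp
    rw [hγ.apply_of_mem ⟨j, hsq⟩]
    exact AddSubgroup.mem_zmultiples s
  · obtain ⟨k, hk⟩ := h.exists_pow_smul_eq_zero
    have hcop : IsCoprime ((p ^ k : ℕ) : ℤ) ((q ^ j : ℕ) : ℤ) := by
      rw [Nat.isCoprime_iff_coprime]
      exact Nat.Coprime.pow _ _ ((Nat.coprime_primes h.1 hq).2 (Ne.symm hqp))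
    obtain ⟨u, v, huv⟩ := hcop
    have hs' : s = p ^ k • (u • s) := by
      have h1 : s = (u * ((p ^ k : ℕ) : ℤ) + v * ((q ^ j : ℕ) : ℤ)) • s := by rw [huv, one_smul]
      rw [add_smul, mul_smul, mul_smul, natCast_zsmul, natCast_zsmul, hsq, smul_zero, add_zero,
        smul_comm] at h1
      exact h1
    rw [hs', hγ.apply_pow_smul hk, ← hs']
    exact ⟨p, by simp⟩

theorem IsOneSumMul.isOfFinAddOrder_sub (h : InPiStar A p) {γ : AutGroup A}
    (hγ : IsOneSumMul p γ) (x : A) : IsOfFinAddOrder (γ x - p • x) := by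
  obtain ⟨k, hk⟩ := h.exists_pow_smul_eq_zero
  refine isOfFinAddOrder_of_nsmul (pow_pos h.1.pos k) ?_
  rw [smul_sub, ← map_nsmul, hγ.apply_pow_smul hk, smul_comm, sub_self]

end PiStar

/-! ### Automorphisms acting on A/T as rational numbers. -/

section RationalAction

variable {A : Type*} [AddCommGroup A]

/-- `q` acts on `A / T(A)` as multiplication by the rational number `u`. -/
def ActsAs (q : AutGroup A) (u : ℚˣ) : Prop :=
  ∃ m n : ℤ, n ≠ 0 ∧ (u : ℚ) * n = m ∧ ∀ a, IsOfFinAddOrder (n • q a - m • a)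

theorem isOfFinAddOrder_sub {x y : A} (hx : IsOfFinAddOrder x) (hy : IsOfFinAddOrder y) :
    IsOfFinAddOrder (x - y) := (AddCommGroup.torsion A).sub_mem hx hy

theorem isOfFinAddOrder_zsmul {x : A} (hx : IsOfFinAddOrder x) (n : ℤ) :
    IsOfFinAddOrder (n • x) := (AddCommGroup.torsion A).zsmul_mem hx n

theorem ActsAs.apply {q : AutGroup A} {u : ℚˣ} (h : ActsAs q u) {m n : ℤ}
    (hu : (u : ℚ) * n = m) (a : A) : IsOfFinAddOrder (n • q a - m • a) := by
  obtain ⟨m', n', hn', hu', h⟩ := h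
  refine isOfFinAddOrder_of_zsmul_isOfFinAddOrder hn' ?_
  have h1 : n' * m = n * m' := by
    have : (n' : ℚ) * m = n * m' := by rw [← hu, ← hu']; ring
    exact_mod_cast this
  rw [smul_sub, ← mul_smul, ← mul_smul, h1, mul_comm, mul_smul, mul_smul, ← smul_sub]
  exact isOfFinAddOrder_zsmul (h a) n

theorem ActsAs.one : ActsAs (1 : AutGroup A) 1 :=
  ⟨1, 1, one_ne_zero, by simp, fun a => by
    rw [LinearEquiv.coe_one, id_eq, sub_self]; exact IsOfFinAddOrder.zero⟩

theorem ActsAs.mul {q q' : AutGroup A} {u u' : ℚˣ} (h : ActsAs q u) (h' : ActsAs q' u') :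
    ActsAs (q * q') (u * u') := by
  obtain ⟨m, n, hn, hu, h⟩ := h
  obtain ⟨m', n', hn', hu', h'⟩ := h'
  refine ⟨m * m', n * n', mul_ne_zero hn hn', by push_cast; rw [← hu, ← hu']; ring, fun a => ?_⟩
  have h1 : (n * n') • (q * q') a - (m * m') • a
      = n • q (n' • q' a - m' • a) + m' • (n • q a - m • a) := by
    rw [LinearEquiv.mul_apply, map_sub, map_zsmul, map_zsmul, smul_sub, smul_sub, ← mul_smul,
      ← mul_smul, ← mul_smul, ← mul_smul, mul_comm m m', mul_comm n m']
    abel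
  rw [h1]
  exact (isOfFinAddOrder_zsmul (q.isOfFinAddOrder_apply_iff.2 (h' a)) n).add
    (isOfFinAddOrder_zsmul (h a) m')

theorem ActsAs.inv {q : AutGroup A} {u : ℚˣ} (h : ActsAs q u) : ActsAs q⁻¹ u⁻¹ := by
  obtain ⟨m, n, hn, hu, h⟩ := h
  have hm : m ≠ 0 := by
    rintro rfl
    have : (u : ℚ) * n = 0 := by rw [hu]; simp
    rcases mul_eq_zero.1 this with h | h
    · exact u.ne_zero h
    · exact hn (by exact_mod_cast h)
  refine ⟨n, m, hm, ?_, fun a => ?_⟩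
  · rw [← hu, ← mul_assoc, Units.inv_mul, one_mul]
  · have := (h (q⁻¹ a)).neg
    rwa [AutGroup.apply_inv_self, neg_sub] at this

theorem ActsAs.unique (hA : ¬ IsAddTorsion A) {q : AutGroup A} {u v : ℚˣ} (h : ActsAs q u)
    (h' : ActsAs q v) : u = v := by
  obtain ⟨m, n, hn, hu, h⟩ := h
  obtain ⟨m', n', hn', hv, h'⟩ := h'
  obtain ⟨a, ha⟩ : ∃ a : A, ¬ IsOfFinAddOrder a := by
    by_contra! hcon
    exact hA hcon
  have h1 : IsOfFinAddOrder ((n' * m - n * m') • a) := by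
    have := isOfFinAddOrder_sub (isOfFinAddOrder_zsmul (h' a) n) (isOfFinAddOrder_zsmul (h a) n')
    convert this using 1
    rw [smul_sub, smul_sub, sub_smul, mul_smul, mul_smul, smul_comm n n']
    abel
  have h2 : n' * m - n * m' = 0 := by
    by_contra hne
    exact ha (isOfFinAddOrder_of_zsmul_isOfFinAddOrder hne h1)
  have h3 : (n' : ℚ) * m = n * m' := by exact_mod_cast sub_eq_zero.1 h2
  rw [← hu, ← hv] at h3
  have hn0 : (n : ℚ) ≠ 0 := by exact_mod_cast hn
  have hn0' : (n' : ℚ) ≠ 0 := by exact_mod_cast hn'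
  apply Units.ext
  apply mul_left_cancel₀ (mul_ne_zero hn0 hn0')
  linear_combination h3

theorem ActsAs.neg : ActsAs (LinearEquiv.neg ℤ : AutGroup A) (-1) :=
  ⟨-1, 1, one_ne_zero, by simp, fun a => by
    rw [LinearEquiv.neg_apply, one_smul, neg_smul, one_smul, sub_self]; exact IsOfFinAddOrder.zero⟩

theorem IsOneSumMul.actsAs {p : ℕ} (h : InPiStar A p) {γ : AutGroup A} (hγ : IsOneSumMul p γ)
    {u : ℚˣ} (hu : (u : ℚ) = p) : ActsAs γ u :=
  ⟨p, 1, one_ne_zero, by rw [hu]; simp, fun a => by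
    rw [one_smul, natCast_zsmul]; exact hγ.isOfFinAddOrder_sub h a⟩

end RationalAction

/-! ### The group Q(A) and its isomorphism with a group of rationals. -/

section QGroup

variable (A : Type*) [AddCommGroup A]

theorem neg_mem_center : (LinearEquiv.neg ℤ : AutGroup A) ∈ Subgroup.center (AutGroup A) := by
  rw [Subgroup.mem_center_iff]
  intro α
  ext x
  simp [LinearEquiv.mul_apply]

theorem QAut_le_center : QAut A ≤ Subgroup.center (AutGroup A) := by
  rw [QAut, Subgroup.closure_le]
  rintro γ (rfl | ⟨p, hp, hγ⟩)
  · exact neg_mem_center A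
  · exact hγ.mem_center hp

theorem QAut_le_powerAutOn : QAut A ≤ powerAutOn (⊤ : AddSubgroup A) := by
  rw [QAut, Subgroup.closure_le]
  rintro γ (rfl | ⟨p, hp, hγ⟩)
  · exact fun x _ _ => ⟨-1, by simp⟩
  · exact hγ.mem_powerAutOn hp

theorem QAut_le_IAut : QAut A ≤ IAut A := by
  rw [QAut, Subgroup.closure_le]
  rintro γ (rfl | ⟨p, hp, hγ⟩)
  · refine Subgroup.subset_closure ((isInertial_iff_inertialEnd _).2 ?_)
    exact InertialEnd.of_forall_mem_zmultiples fun x => ⟨-1, by simp⟩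
  · exact Subgroup.subset_closure ((isInertial_iff_inertialEnd _).2 (hγ.inertialEnd hp))

/-- Allows finite products of the γ_(p) indexed by prime factorizations, and free rearrangement of
fractions. -/
instance centerCommGroup : CommGroup (Subgroup.center (AutGroup A)) where
  mul_comm x y := Subtype.ext (Subgroup.mem_center_iff.1 y.2 x)

open Classical in
/-- The automorphism `1 ⊕ p` if `p ∈ π_*(A)`, and the identity otherwise, as a central element. -/
noncomputable def gammaAut (p : ℕ) : Subgroup.center (AutGroup A) :=
  if h : InPiStar A p then ⟨h.exists_isOneSumMul.choose,
    h.exists_isOneSumMul.choose_spec.mem_center h⟩ else 1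

variable {A}

theorem gammaAut_spec {p : ℕ} (h : InPiStar A p) : IsOneSumMul p (gammaAut A p : AutGroup A) := by
  rw [gammaAut, dif_pos h]
  exact h.exists_isOneSumMul.choose_spec

variable (A) in
/-- The product of the automorphisms `gammaAut A p` over the prime factors `p` of `m`. -/
noncomputable def mulAut (m : ℕ) : Subgroup.center (AutGroup A) :=
  m.factorization.prod fun p k => gammaAut A p ^ k

theorem mulAut_mul {m n : ℕ} (hm : m ≠ 0) (hn : n ≠ 0) :
    mulAut A (m * n) = mulAut A m * mulAut A n := by
  rw [mulAut, Nat.factorization_mul hm hn, Finsupp.prod_add_index' (by simp)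
    (fun p k l => pow_add _ _ _)]
  rfl

theorem mulAut_one : mulAut A 1 = 1 := by simp [mulAut]

theorem mulAut_prime {p : ℕ} (hp : p.Prime) : mulAut A p = gammaAut A p := by
  simp [mulAut, hp.factorization]

theorem mulAut_spec {m : ℕ} (hm : m ≠ 0) (h : ∀ p, p.Prime → p ∣ m → InPiStar A p) :
    (mulAut A m : AutGroup A) ∈ QAut A ∧
      InertialEnd (mulAut A m : AutGroup A).toAddEquiv.toAddMonoidHom ∧
      ∀ a, IsOfFinAddOrder ((mulAut A m : AutGroup A) a - m • a) := by
  induction m using Nat.recOnMul with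
  | zero => exact absurd rfl hm
  | one =>
    rw [mulAut_one]
    refine ⟨Subgroup.one_mem _, InertialEnd.of_forall_mem_zmultiples fun x =>
      AddSubgroup.mem_zmultiples x, fun a => ?_⟩
    rw [one_smul, Subgroup.coe_one, LinearEquiv.coe_one, id_eq, sub_self]
    exact IsOfFinAddOrder.zero
  | prime p hp =>
    have hps := h p hp dvd_rfl
    rw [mulAut_prime hp]
    exact ⟨Subgroup.subset_closure (Or.inr ⟨p, hps, gammaAut_spec hps⟩),
      (gammaAut_spec hps).inertialEnd hps, (gammaAut_spec hps).isOfFinAddOrder_sub hps⟩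
  | mul m n ihm ihn =>
    have hm0 := left_ne_zero_of_mul hm
    have hn0 := right_ne_zero_of_mul hm
    obtain ⟨h1, h2, h3⟩ := ihm hm0 fun p hp hpm => h p hp (hpm.mul_right _)
    obtain ⟨h1', h2', h3'⟩ := ihn hn0 fun p hp hpn => h p hp (hpn.mul_left _)
    rw [mulAut_mul hm0 hn0]
    refine ⟨Subgroup.mul_mem _ h1 h1', h2.comp h2', fun a => ?_⟩
    have : (mulAut A m * mulAut A n : AutGroup A) a - (m * n) • a
        = ((mulAut A m : AutGroup A) ((mulAut A n : AutGroup A) a)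
          - m • (mulAut A n : AutGroup A) a) + m • ((mulAut A n : AutGroup A) a - n • a) := by
      rw [LinearEquiv.mul_apply, smul_sub, mul_smul]; abel
    rw [Subgroup.coe_mul, this]
    refine (h3 _).add ?_
    rw [← natCast_zsmul]
    exact isOfFinAddOrder_zsmul (h3' a) m

variable (A) in
/-- `-1` as a central automorphism. -/
def negAut : Subgroup.center (AutGroup A) := ⟨LinearEquiv.neg ℤ, neg_mem_center A⟩

theorem negAut_mul_self : negAut A * negAut A = 1 := by
  apply Subtype.ext
  ext x
  simp [negAut, LinearEquiv.mul_apply]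

/-- Fractional normal form of the elements of `Q(A)`. -/
theorem exists_mul_mulAut_eq {q : AutGroup A} (hq : q ∈ QAut A) :
    ∃ (z : Subgroup.center (AutGroup A)) (m n j : ℕ), (z : AutGroup A) = q ∧ m ≠ 0 ∧ n ≠ 0 ∧
      (∀ p, p.Prime → p ∣ m → InPiStar A p) ∧ (∀ p, p.Prime → p ∣ n → InPiStar A p) ∧
      z * mulAut A n = negAut A ^ j * mulAut A m := by
  have hone : ∀ p : ℕ, p.Prime → p ∣ 1 → InPiStar A p := fun p hp h =>
    absurd (Nat.dvd_one.1 h) hp.ne_one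
  have hmul : ∀ m n : ℕ, (∀ p, p.Prime → p ∣ m → InPiStar A p) →
      (∀ p, p.Prime → p ∣ n → InPiStar A p) → ∀ p, p.Prime → p ∣ m * n → InPiStar A p :=
    fun m n h h' p hp hdvd => (hp.dvd_mul.1 hdvd).elim (h p hp) (h' p hp)
  induction hq using Subgroup.closure_induction with
  | mem γ hγ =>
    rcases hγ with rfl | ⟨p, hp, hγ⟩
    · exact ⟨negAut A, 1, 1, 1, rfl, one_ne_zero, one_ne_zero, hone, hone, by rw [pow_one]⟩
    · refine ⟨gammaAut A p, p, 1, 0, (gammaAut_spec hp).unique hp hγ, hp.1.ne_zero, one_ne_zero,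
        fun q hq hqp => ?_, hone, ?_⟩
      · rwa [(Nat.prime_dvd_prime_iff_eq hq hp.1).1 hqp]
      · rw [mulAut_one, mul_one, pow_zero, one_mul, mulAut_prime hp.1]
  | one => exact ⟨1, 1, 1, 0, rfl, one_ne_zero, one_ne_zero, hone, hone, by simp⟩
  | mul q q' _ _ ih ih' =>
    obtain ⟨z, m, n, j, rfl, hm, hn, hm', hn', h⟩ := ih
    obtain ⟨w, k, l, i, rfl, hk, hl, hk', hl', h'⟩ := ih'
    refine ⟨z * w, m * k, n * l, j + i, rfl, mul_ne_zero hm hk, mul_ne_zero hn hl,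
      hmul m k hm' hk', hmul n l hn' hl', ?_⟩
    rw [mulAut_mul hm hk, mulAut_mul hn hl, mul_mul_mul_comm, h, h', pow_add, mul_mul_mul_comm]
  | inv q _ ih =>
    obtain ⟨z, m, n, j, rfl, hm, hn, hm', hn', h⟩ := ih
    refine ⟨z⁻¹, n, m, j, rfl, hn, hm, hn', hm', ?_⟩
    rw [inv_mul_eq_iff_eq_mul, mul_left_comm, h, ← mul_assoc, ← mul_pow, negAut_mul_self, one_pow,
      one_mul]

/-- Only the identity in `Q(A)` acts trivially modulo torsion. -/
theorem eq_one_of_mem_QAut (hA : ¬ IsAddTorsion A) {q : AutGroup A} (hq : q ∈ QAut A)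
    (h : ∀ a, IsOfFinAddOrder (q a - a)) : q = 1 := by
  -- Trivial action on A/T gives n = ±m for positive m, n. The sign is therefore +, and m = n makes
  -- the numerator and denominator of the normal form cancel.
  obtain ⟨z, m, n, j, rfl, hm, hn, hm', hn', hz⟩ := exists_mul_mulAut_eq hq
  obtain ⟨a, ha⟩ : ∃ a : A, ¬ IsOfFinAddOrder a := by
    by_contra! hcon
    exact hA hcon
  have hnpow : ∀ (j : ℕ) (b : A), ((negAut A ^ j : Subgroup.center (AutGroup A)) : AutGroup A) b
      = (-1 : ℤ) ^ j • b := by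
    intro j b
    induction j generalizing b with
    | zero => simp
    | succ j ih =>
      rw [pow_succ, Subgroup.coe_mul, LinearEquiv.mul_apply, ih, pow_succ, mul_smul]
      simp [negAut]
  have h1 : IsOfFinAddOrder ((n : ℤ) • a - ((-1 : ℤ) ^ j * m) • a) := by
    have e1 := h ((mulAut A n : AutGroup A) a)
    have e2 := (mulAut_spec hn hn').2.2 a
    have e3 := (mulAut_spec hm hm').2.2 a
    have e4 : (z : AutGroup A) ((mulAut A n : AutGroup A) a)
        = (-1 : ℤ) ^ j • (mulAut A m : AutGroup A) a := by
      rw [← hnpow]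
      exact congrArg (fun w : Subgroup.center (AutGroup A) => (w : AutGroup A) a) hz
    rw [e4] at e1
    have e5 := isOfFinAddOrder_zsmul e3 ((-1 : ℤ) ^ j)
    have e6 := isOfFinAddOrder_sub (isOfFinAddOrder_sub e5 e1) e2
    convert e6 using 1
    rw [smul_sub, mul_smul, natCast_zsmul, natCast_zsmul]
    abel
  rw [← sub_smul] at h1
  have h2 : (n : ℤ) - (-1 : ℤ) ^ j * m = 0 := by
    by_contra hne
    exact ha (isOfFinAddOrder_of_zsmul_isOfFinAddOrder hne h1)
  rcases neg_one_pow_eq_or ℤ j with hj | hj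
  · rw [hj, one_mul] at h2
    have hmn : n = m := by lia
    have hz1 : (negAut A ^ j : Subgroup.center (AutGroup A)) = 1 := by
      apply Subtype.ext
      ext b
      rw [hnpow, hj, one_smul]
      rfl
    rw [hz1, one_mul, hmn] at hz
    rw [mul_eq_right.1 hz]
    rfl
  · rw [hj] at h2
    exfalso
    lia

theorem exists_actsAs_of_mem_QAut {q : AutGroup A} (hq : q ∈ QAut A) :
    ∃ u ∈ ratGroupPiStar A, ActsAs q u := by
  induction hq using Subgroup.closure_induction with
  | mem γ hγ =>
    rcases hγ with rfl | ⟨p, hp, hγ⟩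
    · exact ⟨-1, Subgroup.subset_closure (Or.inl rfl), ActsAs.neg⟩
    · have hp0 : (p : ℚ) ≠ 0 := by exact_mod_cast hp.1.ne_zero
      exact ⟨Units.mk0 p hp0, Subgroup.subset_closure (Or.inr ⟨p, hp, rfl⟩), hγ.actsAs hp rfl⟩
  | one => exact ⟨1, Subgroup.one_mem _, ActsAs.one⟩
  | mul q q' _ _ ih ih' =>
    obtain ⟨u, hu, h⟩ := ih
    obtain ⟨u', hu', h'⟩ := ih'
    exact ⟨u * u', Subgroup.mul_mem _ hu hu', h.mul h'⟩
  | inv q _ ih =>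
    obtain ⟨u, hu, h⟩ := ih
    exact ⟨u⁻¹, Subgroup.inv_mem _ hu, h.inv⟩

theorem exists_mem_QAut_actsAs {u : ℚˣ} (hu : u ∈ ratGroupPiStar A) :
    ∃ q ∈ QAut A, ActsAs q u := by
  induction hu using Subgroup.closure_induction with
  | mem u hu =>
    rcases hu with rfl | ⟨p, hp, hu⟩
    · exact ⟨LinearEquiv.neg ℤ, Subgroup.subset_closure (Or.inl rfl), ActsAs.neg⟩
    · obtain ⟨γ, hγ⟩ := hp.exists_isOneSumMul
      exact ⟨γ, Subgroup.subset_closure (Or.inr ⟨p, hp, hγ⟩), hγ.actsAs hp hu⟩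
  | one => exact ⟨1, Subgroup.one_mem _, ActsAs.one⟩
  | mul u u' _ _ ih ih' =>
    obtain ⟨q, hq, h⟩ := ih
    obtain ⟨q', hq', h'⟩ := ih'
    exact ⟨q * q', Subgroup.mul_mem _ hq hq', h.mul h'⟩
  | inv u _ ih =>
    obtain ⟨q, hq, h⟩ := ih
    exact ⟨q⁻¹, Subgroup.inv_mem _ hq, h.inv⟩

theorem ActsAs.eq_one (hA : ¬ IsAddTorsion A) {q : AutGroup A} (hq : q ∈ QAut A)
    (h : ActsAs q 1) : q = 1 := by
  refine eq_one_of_mem_QAut hA hq fun a => ?_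
  have := h.apply (m := 1) (n := 1) (by simp) a
  rwa [one_smul, one_smul] at this

theorem exists_mulEquiv_ratGroupPiStar (hA : ¬ IsAddTorsion A) :
    ∃ e : QAut A ≃* ratGroupPiStar A, ∀ (q : QAut A) (a : A),
      (((e q : ℚˣ) : ℚ).den • (q : AutGroup A) a) - (((e q : ℚˣ) : ℚ).num • a)
        ∈ AddCommGroup.torsion A := by
  choose r hr hr' using fun q : QAut A => exists_actsAs_of_mem_QAut q.2
  let f : QAut A →* ratGroupPiStar A :=
    { toFun := fun q => ⟨r q, hr q⟩
      map_one' := Subtype.ext (ActsAs.unique hA (hr' 1) ActsAs.one)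
      map_mul' := fun q q' => Subtype.ext
        (ActsAs.unique hA (hr' (q * q')) ((hr' q).mul (hr' q'))) }
  have hf : Function.Bijective f := by
    constructor
    · rw [injective_iff_map_eq_one]
      intro q hq
      have h1 : r q = 1 := congrArg Subtype.val hq
      have h2 := hr' q
      rw [h1] at h2
      exact Subtype.ext (h2.eq_one hA q.2)
    · rintro ⟨u, hu⟩
      obtain ⟨q, hq, h⟩ := exists_mem_QAut_actsAs hu
      exact ⟨⟨q, hq⟩, Subtype.ext (ActsAs.unique hA (hr' ⟨q, hq⟩) h)⟩
  refine ⟨MulEquiv.ofBijective f hf, fun q a => ?_⟩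
  change IsOfFinAddOrder (((r q : ℚˣ) : ℚ).den • (q : AutGroup A) a - ((r q : ℚˣ) : ℚ).num • a)
  rw [← natCast_zsmul]
  refine (hr' q).apply ?_ a
  exact_mod_cast Rat.mul_den_eq_num _

end QGroup

/-! ### The rational number attached to an inertial endomorphism, and p-parts of torsion elements.
-/

section PrimePart

variable {A : Type*} [AddCommGroup A]

/-- An inertial endomorphism of a non-periodic group acts modulo torsion as multiplication by a
rational number. -/
theorem InertialEnd.exists_isOfFinAddOrder_zsmul_sub (hA : ¬ IsAddTorsion A) {φ : A →+ A}
    (hφ : InertialEnd φ) : ∃ m n : ℤ, 0 < n ∧ IsCoprime m n ∧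
      ∀ x, IsOfFinAddOrder (n • φ x - m • x) := by
  obtain ⟨a, ha⟩ : ∃ a : A, ¬ IsOfFinAddOrder a := by
    by_contra! hcon
    exact hA hcon
  obtain ⟨k, l, hk, hkl⟩ := hφ.exists_zsmul_eq a
  set ψ : A →+ A := k • φ - l • AddMonoidHom.id A with hψ
  have hψx : ∀ x, ψ x = k • φ x - l • x := fun x => rfl
  have hψin : InertialEnd ψ := (hφ.zsmul k).sub (InertialEnd.zsmul_id l)
  have hψa : ψ a = 0 := by rw [hψx, hkl, sub_self]
  have key : ∀ x, IsOfFinAddOrder (ψ x) := by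
    intro x
    obtain ⟨k₁, l₁, hk₁, h₁⟩ := hψin.exists_zsmul_eq x
    obtain ⟨k₂, l₂, hk₂, h₂⟩ := hψin.exists_zsmul_eq (x + a)
    rw [map_add, hψa, add_zero, smul_add] at h₂
    -- Elimination of ψ(x) between the relations for x and x + a. Either a nonzero multiple of x
    -- lies in ⟨a⟩, which ψ kills, or all coefficients vanish and ψ(x) is torsion by the second
    -- relation.
    have h3 : (k₂ * l₁ - k₁ * l₂) • x = (k₁ * l₂) • a := by
      have e1 : (k₂ * k₁) • ψ x = (k₂ * l₁) • x := by rw [mul_smul, h₁, ← mul_smul]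
      have e2 : (k₂ * k₁) • ψ x = (k₁ * l₂) • x + (k₁ * l₂) • a := by
        rw [mul_comm, mul_smul, h₂, smul_add, ← mul_smul, ← mul_smul]
      rw [sub_smul, ← e1, e2, add_sub_cancel_left]
    by_cases hc : k₂ * l₁ - k₁ * l₂ = 0
    · rw [hc, zero_smul] at h3
      have h4 : k₁ * l₂ = 0 := by
        by_contra hne
        exact ha (isOfFinAddOrder_of_zsmul hne h3.symm)
      have h5 : l₂ = 0 := (mul_eq_zero.1 h4).resolve_left hk₁.ne'
      rw [h5, zero_smul, zero_smul, add_zero] at h₂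
      exact isOfFinAddOrder_of_zsmul hk₂.ne' h₂
    · refine isOfFinAddOrder_of_zsmul hc ?_
      rw [← map_zsmul, h3, map_zsmul, hψa, smul_zero]
  obtain ⟨g, m, n, hg, hcop, hm, hn⟩ := Int.exists_gcd_one' (m := l) (n := k)
    (Int.gcd_pos_of_ne_zero_right _ hk.ne')
  have hg' : (0 : ℤ) < g := by exact_mod_cast hg
  refine ⟨m, n, ?_, Int.isCoprime_iff_gcd_eq_one.2 hcop, fun x => ?_⟩
  · rw [hn] at hk
    exact pos_of_mul_pos_left hk hg'.le
  · refine isOfFinAddOrder_of_zsmul_isOfFinAddOrder hg'.ne' ?_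
    have := key x
    rw [hψx, hm, hn, mul_comm, mul_comm m, mul_smul, mul_smul, ← smul_sub] at this
    exact this

theorem exists_mem_primaryComponent_coprime_nsmul {p : ℕ} (hp : p.Prime) {t : A}
    (ht : IsOfFinAddOrder t) :
    ∃ s ∈ AddCommGroup.primaryComponent A p, ∃ b : ℕ, b.Coprime p ∧ b • (t - s) = 0 := by
  obtain ⟨n, hn, hnt⟩ := ht.exists_nsmul_eq_zero
  obtain ⟨j, b, hb, rfl⟩ := Nat.exists_eq_pow_mul_and_not_dvd hn.ne' p hp.ne_one
  have hcop : b.Coprime p := ((Nat.Prime.coprime_iff_not_dvd hp).2 hb).symm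
  have hcop' : IsCoprime (b : ℤ) ((p ^ j : ℕ) : ℤ) :=
    Nat.isCoprime_iff_coprime.2 (hcop.pow_right j)
  obtain ⟨u, v, huv⟩ := hcop'
  refine ⟨(u * b) • t, ⟨j, ?_⟩, b, hcop, ?_⟩
  · rw [mul_smul, natCast_zsmul, smul_comm, ← mul_smul, hnt, smul_zero]
  · have : t - (u * (b : ℤ)) • t = (v * ((p ^ j : ℕ) : ℤ)) • t := by
      nth_rewrite 1 [← one_smul ℤ t]
      rw [← huv, add_smul, add_sub_cancel_left]
    rw [this, mul_smul, natCast_zsmul, smul_comm, ← mul_smul, mul_comm b, hnt, smul_zero]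

end PrimePart

/-! ### The criterion for membership in π_*(A). -/

section Bounded

variable {A : Type*} [AddCommGroup A] {p : ℕ}

/-- The `p`-part of an inertial endomorphism with torsion image. -/
theorem InertialEnd.exists_primaryPart (hp : p.Prime) {ε : A →+ A} (hε : InertialEnd ε)
    (ht : ∀ x, IsOfFinAddOrder (ε x)) : ∃ ψ : A →+ A, InertialEnd ψ ∧
      (∀ x, ψ x ∈ AddCommGroup.primaryComponent A p) ∧
      ∀ x, ε x ∈ AddCommGroup.primaryComponent A p → ψ x = ε x := by
  set P := AddCommGroup.primaryComponent A p with hP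
  let C : AddSubgroup A :=
    { carrier := {t | ∃ b : ℕ, b.Coprime p ∧ b • t = 0}
      zero_mem' := ⟨1, Nat.coprime_one_left p, smul_zero _⟩
      add_mem' := by
        rintro x y ⟨b, hb, hbx⟩ ⟨c, hc, hcy⟩
        refine ⟨b * c, hb.mul_left hc, ?_⟩
        rw [smul_add, mul_comm, mul_smul, hbx, mul_comm, mul_smul, hcy, smul_zero, smul_zero,
          add_zero]
      neg_mem' := by
        rintro x ⟨b, hb, hbx⟩
        exact ⟨b, hb, by rw [smul_neg, hbx, neg_zero]⟩ }
  have hbez : ∀ (b j : ℕ), b.Coprime p → ∃ u v : ℤ, u * b + v * (p ^ j : ℕ) = 1 :=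
    fun b j hb => Nat.isCoprime_iff_coprime.2 (hb.pow_right j)
  have hd : Disjoint P C := by
    refine AddSubgroup.disjoint_def.2 ?_
    rintro x ⟨j, hj⟩ ⟨b, hb, hbx⟩
    obtain ⟨u, v, huv⟩ := hbez b j hb
    rw [← one_smul ℤ x, ← huv, add_smul, mul_smul, mul_smul, natCast_zsmul, natCast_zsmul, hbx, hj,
      smul_zero, smul_zero, add_zero]
  obtain ⟨ψ, hψ⟩ := exists_projection ε P C hd
    fun x => exists_mem_primaryComponent_coprime_nsmul hp (ht x)
  refine ⟨ψ, hε.of_map_le ?_, fun x => (hψ x).1, fun x hx => ?_⟩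
  · rintro H _ ⟨x, hx, rfl⟩
    obtain ⟨⟨j, hj⟩, b, hb, hbx⟩ := hψ x
    obtain ⟨u, v, huv⟩ := hbez b j hb
    -- The coefficient ub is 1 modulo p^j and kills the prime-to-p part, so ψ(x) = ε(ub x). Hence
    -- ψ(H) ≤ ε(H) and inertiality is inherited.
    refine ⟨(u * b) • x, H.zsmul_mem hx _, ?_⟩
    rw [smul_sub, sub_eq_zero] at hbx
    rw [map_zsmul, mul_smul, natCast_zsmul, hbx]
    nth_rewrite 2 [← one_smul ℤ (ψ x)]
    rw [← huv, add_smul, mul_smul, mul_smul, natCast_zsmul, natCast_zsmul, hj, smul_zero, add_zero]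
  · exact (sub_eq_zero.1 (AddSubgroup.disjoint_def.1 hd (P.sub_mem hx (hψ x).1) (hψ x).2)).symm

variable {ψ : A →+ A}

/-- Suppose A_p is unbounded, and let c have infinite order and D = A_p + ⟨c⟩. Since c is
p-divisible modulo A_p, the p-component of A/D is unbounded too. With g₁, g₂ unbounded characters on
the two, put g = g₁ψ + g₂: values of g₂ can be used to correct elements into ker g, so ψ(ker g)
contains A_p. Inertiality makes g(A_p) finite, yet g(A_p) = g₁(A_p) is unbounded. -/
theorem InertialEnd.bounded_of_surjOn (hA : ¬ IsAddTorsion A) (hp : p.Prime)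
    (hdiv : ∀ x : A, ∃ y, x - p • y ∈ AddCommGroup.primaryComponent A p)
    (hψ : InertialEnd ψ) (hψP : ∀ x, ψ x ∈ AddCommGroup.primaryComponent A p)
    (hsurj : ∀ y ∈ AddCommGroup.primaryComponent A p,
      ∃ x ∈ AddCommGroup.primaryComponent A p, ψ x = y) :
    ∃ k : ℕ, ∀ x ∈ AddCommGroup.primaryComponent A p, p ^ k • x = 0 := by
  set P := AddCommGroup.primaryComponent A p with hP
  have hPp : ∀ x ∈ P, ∃ k : ℕ, p ^ k • x = 0 := fun x hx => hx
  by_contra! hunb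
  have hdec : ∀ a, ∃ s ∈ P, ψ (a - s) = 0 := by
    intro a
    obtain ⟨s, hs, hsa⟩ := hsurj _ (hψP a)
    exact ⟨s, hs, by rw [map_sub, hsa, sub_self]⟩
  obtain ⟨c, hc⟩ : ∃ a : A, ¬ IsOfFinAddOrder a := by
    by_contra! hcon
    exact hA hcon
  obtain ⟨g₁, hg₁⟩ := exists_character_unbounded P hPp hunb
  have hdivpow : ∀ j, ∃ d, c - p ^ j • d ∈ P := by
    intro j
    induction j with
    | zero => exact ⟨c, by rw [pow_zero, one_smul, sub_self]; exact P.zero_mem⟩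
    | succ j ih =>
      obtain ⟨d, hd⟩ := ih
      obtain ⟨e, he⟩ := hdiv d
      refine ⟨e, ?_⟩
      have := P.add_mem hd (P.nsmul_mem he (p ^ j))
      rw [smul_sub, ← mul_smul, ← pow_succ, sub_add_sub_cancel] at this
      exact this
  set D := P ⊔ AddSubgroup.zmultiples c with hD
  set N := AddCommGroup.primaryComponent (A ⧸ D) p with hN
  have hNp : ∀ x ∈ N, ∃ k : ℕ, p ^ k • x = 0 := fun x hx => hx
  have hNunb : ∀ k : ℕ, ∃ x ∈ N, p ^ k • x ≠ 0 := by
    intro k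
    obtain ⟨d, hd⟩ := hdivpow (k + 1)
    refine ⟨(d : A ⧸ D), ⟨k + 1, ?_⟩, fun h0 => ?_⟩
    · rw [← QuotientAddGroup.mk_nsmul, QuotientAddGroup.eq_zero_iff]
      have := D.sub_mem (AddSubgroup.mem_sup_right (AddSubgroup.mem_zmultiples c))
        (AddSubgroup.mem_sup_left hd)
      rwa [sub_sub_cancel] at this
    · rw [← QuotientAddGroup.mk_nsmul, QuotientAddGroup.eq_zero_iff] at h0
      obtain ⟨s, hs, _, ⟨l, rfl⟩, hsl⟩ := AddSubgroup.mem_sup.1 h0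
      simp only at hsl
      have h1 : (1 - p * l) • c ∈ P := by
        have := P.add_mem hd (P.nsmul_mem hs p)
        convert this using 1
        rw [pow_succ', mul_smul, ← hsl, sub_smul, mul_smul, one_smul, natCast_zsmul, smul_add]
        abel
      have h2 : 1 - (p : ℤ) * l = 0 := by
        by_contra hne
        exact hc (isOfFinAddOrder_of_zsmul_isOfFinAddOrder hne
          (isOfFinAddOrder_of_mem_primaryComponent hp h1))
      have h3 : (p : ℤ) ∣ 1 := ⟨l, by lia⟩
      exact hp.one_lt.ne' (Nat.dvd_one.1 (by exact_mod_cast h3))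
  obtain ⟨g₂, hg₂⟩ := exists_character_unbounded N hNp hNunb
  set g : A →+ AddCircle (1 : ℚ) := g₁.comp ψ + g₂.comp (QuotientAddGroup.mk' D) with hg
  have hgx : ∀ x, g x = g₁ (ψ x) + g₂ (x : A ⧸ D) := fun x => rfl
  have hgP : ∀ x ∈ P, g x = g₁ (ψ x) := by
    intro x hx
    rw [hgx, (QuotientAddGroup.eq_zero_iff x).2 (AddSubgroup.mem_sup_left hx), map_zero, add_zero]
  have hker : ∀ y ∈ P, ∃ h ∈ g.ker, ψ h = y := by
    intro y hy
    obtain ⟨x, hx, hxy⟩ := hsurj y hy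
    obtain ⟨j, hj⟩ := hPp y hy
    obtain ⟨q, -, hq⟩ := exists_apply_eq_of_unbounded hp N hNp hg₂
      (y := - g₁ y) (j := j) (by rw [smul_neg, ← map_nsmul, hj, map_zero, neg_zero])
    obtain ⟨d, rfl⟩ := QuotientAddGroup.mk_surjective q
    obtain ⟨s, hs, hsd⟩ := hdec d
    have hs0 : ((s : A) : A ⧸ D) = 0 :=
      (QuotientAddGroup.eq_zero_iff s).2 (AddSubgroup.mem_sup_left hs)
    -- Here x alone has the right ψ-image `y` but g-value g₁(y). Adding d - s in ker ψ, with g₂(d) =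
    -- -g₁(y), cancels that value.
    refine ⟨x + (d - s), ?_, by rw [map_add, hsd, add_zero, hxy]⟩
    rw [AddMonoidHom.mem_ker, map_add, hgP x hx, hxy, hgx, hsd, map_zero, zero_add,
      QuotientAddGroup.mk_sub, hs0, sub_zero, hq, add_neg_cancel]
  obtain ⟨S, hS, hS'⟩ := hψ g.ker
  have hfin : (g '' (P : Set A)).Finite := by
    refine (hS.image g).subset ?_
    rintro _ ⟨y, hy, rfl⟩
    obtain ⟨h, hh, rfl⟩ := hker y hy
    obtain ⟨s, hs, hsy⟩ := hS' h hh
    rw [AddMonoidHom.mem_ker, map_sub, sub_eq_zero] at hsy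
    exact ⟨s, hs, hsy.symm⟩
  have hpow : ∀ v ∈ g '' (P : Set A), ∃ k : ℕ, p ^ k • v = 0 := by
    rintro _ ⟨y, ⟨k, hk⟩, rfl⟩
    exact ⟨k, by rw [← map_nsmul, hk, map_zero]⟩
  choose! f hf using hpow
  obtain ⟨k, hk⟩ := (hfin.image f).bddAbove
  obtain ⟨y, hy, hne⟩ := hg₁ k
  obtain ⟨x, hx, rfl⟩ := hsurj y hy
  rw [← hgP x hx] at hne
  have hxP : g x ∈ g '' (P : Set A) := ⟨x, hx, rfl⟩
  obtain ⟨i, hi⟩ := Nat.exists_eq_add_of_le (hk ⟨_, hxP, rfl⟩)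
  rw [hi, add_comm, pow_add, mul_smul, hf _ hxP, smul_zero] at hne
  exact hne rfl

theorem InertialEnd.rank_lt_aleph0_of_surjOn (hψ : InertialEnd ψ)
    (hψP : ∀ x, ψ x ∈ AddCommGroup.primaryComponent A p) (hp : p.Prime) {k : ℕ}
    (hsurj : ∀ y ∈ AddCommGroup.primaryComponent A p,
      ∃ x ∈ AddCommGroup.primaryComponent A p, ψ x = y)
    (hk : ∀ x ∈ AddCommGroup.primaryComponent A p, p ^ k • x = 0)
    (hinf : Infinite (AddCommGroup.primaryComponent A p)) :
    Module.rank ℤ A < Cardinal.aleph0 := by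
  by_contra! hrank
  obtain ⟨s, hs, hind⟩ := exists_set_linearIndependent ℤ A
  rw [← hs, Cardinal.aleph0_le_mk_iff] at hrank
  let e := Infinite.natEmbedding s
  have hc : LinearIndependent ℤ (fun i : ℕ => (e i : A)) := hind.comp e e.injective
  set c : ℕ → A := fun i => e i with hc'
  let y := Infinite.natEmbedding (AddCommGroup.primaryComponent A p)
  choose b hb hby using fun i => hsurj (y i) (y i).2
  -- The term p^k c_i makes the v_i independent and does not affect ψ, as p^k kills A_p. So ψ(v_i) =
  -- y_i takes infinitely many values, while the span `H` is torsion-free and meets the torsion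
  -- group ψ(H) trivially: this contradicts inertiality.
  set v : ℕ → A := fun i => p ^ k • c i + b i with hv
  have hpk : p ^ k ≠ 0 := pow_ne_zero k hp.ne_zero
  have hlc : ∀ l : ℕ →₀ ℤ, p ^ k • Finsupp.linearCombination ℤ v l
      = Finsupp.linearCombination ℤ c ((((p ^ k : ℕ) : ℤ) * ((p ^ k : ℕ) : ℤ)) • l) := by
    intro l
    rw [map_smul, Finsupp.linearCombination_apply, Finsupp.linearCombination_apply, Finsupp.sum,
      Finsupp.sum, Finset.smul_sum, Finset.smul_sum]
    refine Finset.sum_congr rfl fun i _ => ?_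
    rw [smul_comm, hv]
    simp only
    rw [smul_add, hk _ (hb i), add_zero, mul_smul, natCast_zsmul, natCast_zsmul,
      smul_comm (l i), smul_comm (l i)]
  set H := (Finsupp.linearCombination ℤ v).toAddMonoidHom.range with hH
  have htf : ∀ x ∈ H, IsOfFinAddOrder x → x = 0 := by
    rintro _ ⟨l, rfl⟩ hx
    obtain ⟨n, hn, hnx⟩ := hx.exists_nsmul_eq_zero
    change n • Finsupp.linearCombination ℤ v l = 0 at hnx
    change Finsupp.linearCombination ℤ v l = 0
    have h1 := congrArg (p ^ k • ·) hnx
    simp only [smul_zero] at h1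
    rw [smul_comm, hlc, ← natCast_zsmul, ← map_smul, ← mul_smul] at h1
    have h2 := linearIndependent_iff.1 hc _ h1
    have h3 : l = 0 := (smul_eq_zero.1 h2).resolve_left (by
      have : (n : ℤ) ≠ 0 := by exact_mod_cast hn.ne'
      have : ((p ^ k : ℕ) : ℤ) ≠ 0 := by exact_mod_cast hpk
      positivity)
    rw [h3, map_zero]
  have hfin := hψ.finite_image_of_disjoint H fun x _ hx => htf _ hx
    (isOfFinAddOrder_of_mem_primaryComponent hp (hψP x))
  refine (Set.infinite_of_injective_forall_mem (f := fun i => (y i : A)) ?_ fun i => ?_) hfin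
  · exact Subtype.val_injective.comp y.injective
  · refine ⟨v i, ⟨Finsupp.single i 1, ?_⟩, ?_⟩
    · change Finsupp.linearCombination ℤ v (Finsupp.single i 1) = v i
      rw [Finsupp.linearCombination_single, one_smul]
    · simp only [hv]
      rw [map_add, map_nsmul, hk _ (hψP _), zero_add, hby]

/-- A criterion for `p ∈ π_*(A)`. -/
theorem InertialEnd.inPiStar (hA : ¬ IsAddTorsion A) (hp : p.Prime) {ε : A →+ A}
    (hε : InertialEnd ε) (ht : ∀ x, IsOfFinAddOrder (ε x))
    (h : ∀ y, ∃ x z, y = ε x + p • z ∧ ∀ j : ℕ, p ^ j • y = 0 → p ^ j • x = 0 ∧ p ^ j • z = 0) :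
    InPiStar A p := by
  obtain ⟨ψ, hψ, hψP, hψε⟩ := hε.exists_primaryPart hp ht
  -- ε maps A[p^j] onto itself: in y = ε(x) + pz the summand pz is killed by one power of p less, so
  -- induction applies.
  have hsurj' : ∀ (j : ℕ) (y : A), p ^ j • y = 0 → ∃ x, p ^ j • x = 0 ∧ ε x = y := by
    intro j
    induction j with
    | zero =>
      intro y hy
      exact ⟨0, smul_zero _, by rw [map_zero, ← hy, pow_zero, one_smul]⟩
    | succ j ih =>
      intro y hy
      obtain ⟨x, z, rfl, hxz⟩ := h y
      obtain ⟨hx, hz⟩ := hxz _ hy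
      obtain ⟨x', hx', hxz'⟩ := ih (p • z) (by rw [← mul_smul, ← pow_succ, hz])
      refine ⟨x + x', ?_, by rw [map_add, hxz']⟩
      rw [smul_add, hx, pow_succ', mul_smul, hx', smul_zero, add_zero]
  have hsurj : ∀ y ∈ AddCommGroup.primaryComponent A p,
      ∃ x ∈ AddCommGroup.primaryComponent A p, ψ x = y := by
    rintro y ⟨j, hj⟩
    obtain ⟨x, hx, rfl⟩ := hsurj' j y hj
    exact ⟨x, ⟨j, hx⟩, hψε x ⟨j, hj⟩⟩
  have hdiv : ∀ y : A, ∃ z, y - p • z ∈ AddCommGroup.primaryComponent A p := by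
    intro y
    obtain ⟨x, z, rfl, -⟩ := h y
    obtain ⟨s, hs, b, hb, hbs⟩ := exists_mem_primaryComponent_coprime_nsmul hp (ht x)
    obtain ⟨u, v, huv⟩ := Nat.isCoprime_iff_coprime.2 hb
    refine ⟨z + v • (ε x - s), ?_⟩
    have h1 : ε x - s = p • v • (ε x - s) := by
      nth_rewrite 1 [← one_smul ℤ (ε x - s)]
      rw [← huv, add_smul, mul_smul, mul_smul, natCast_zsmul, natCast_zsmul, hbs, smul_zero,
        zero_add, smul_comm]
    rw [smul_add, ← h1]
    convert hs using 1
    abel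
  obtain ⟨k, hk⟩ := hψ.bounded_of_surjOn hA hp hdiv hψP hsurj
  refine ⟨hp, fun q => ?_, ?_⟩
  · obtain ⟨y, rfl⟩ := QuotientAddGroup.mk_surjective q
    obtain ⟨z, hz⟩ := hdiv y
    refine ⟨z, ?_⟩
    rw [← QuotientAddGroup.mk_nsmul, QuotientAddGroup.eq, neg_add_eq_sub]
    exact hz
  · rcases finite_or_infinite (AddCommGroup.primaryComponent A p) with hfin | hinf
    · exact Or.inl hfin
    · exact Or.inr ⟨hψ.rank_lt_aleph0_of_surjOn hψP hp hsurj hk hinf, p ^ k, pow_pos hp.pos k, hk⟩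

end Bounded

/-! ### The decomposition of IAut(A). -/

section Decomposition

variable {A : Type*} [AddCommGroup A]

/-- Prime divisors of the rational number by which an inertial automorphism acts modulo torsion
belong to `π_*(A)`. -/
theorem InertialEnd.inPiStar_of_dvd (hA : ¬ IsAddTorsion A) {γ : AutGroup A}
    (hγ : InertialEnd γ.toAddEquiv.toAddMonoidHom) {m n : ℤ} (hmn : IsCoprime m n)
    (ht : ∀ x, IsOfFinAddOrder (n • γ x - m • x)) {p : ℕ} (hp : p.Prime)
    (hdvd : (p : ℤ) ∣ m ∨ (p : ℤ) ∣ n) : InPiStar A p := by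
  obtain ⟨u, v, huv⟩ := hmn
  refine ((hγ.zsmul n).sub (InertialEnd.zsmul_id m)).inPiStar hA hp ht fun y => ?_
  change ∃ x z, y = (n • γ x - m • x) + p • z ∧ _
  rcases hdvd with ⟨k, rfl⟩ | ⟨k, rfl⟩
  -- From y = umy + vny: the term vny is ε(vγ⁻¹y) + mvγ⁻¹y, and what remains is divisible by m,
  -- hence by p.
  · refine ⟨v • γ⁻¹ y, (k * v) • γ⁻¹ y + (u * k) • y, ?_, fun j hj => ?_⟩
    · rw [map_zsmul, AutGroup.apply_inv_self]
      nth_rewrite 1 [← one_smul ℤ y]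
      rw [← huv]
      module
    · have h1 : p ^ j • γ⁻¹ y = 0 := by rw [← map_nsmul, hj, map_zero]
      exact ⟨by rw [smul_comm, h1, smul_zero],
        by rw [smul_add, smul_comm, h1, smul_comm _ (u * k), hj, smul_zero, smul_zero, add_zero]⟩
  -- Symmetrically, umy = ε(-uy) + nuγ(y), and what remains is divisible by n.
  · refine ⟨(-u) • y, (k * u) • γ y + (v * k) • y, ?_, fun j hj => ?_⟩
    · rw [map_zsmul]
      nth_rewrite 1 [← one_smul ℤ y]
      rw [← huv]
      module
    · have h1 : p ^ j • γ y = 0 := by rw [← map_nsmul, hj, map_zero]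
      exact ⟨by rw [smul_comm, hj, smul_zero],
        by rw [smul_add, smul_comm, h1, smul_comm _ (v * k), hj, smul_zero, smul_zero, add_zero]⟩

theorem exists_int_mulAut {m : ℤ} (hm : m ≠ 0)
    (h : ∀ p : ℕ, p.Prime → (p : ℤ) ∣ m → InPiStar A p) :
    ∃ q ∈ QAut A, InertialEnd q.toAddEquiv.toAddMonoidHom ∧
      ∀ a, IsOfFinAddOrder (q a - m • a) := by
  have hm' : m.natAbs ≠ 0 := Int.natAbs_ne_zero.2 hm
  obtain ⟨h1, h2, h3⟩ := mulAut_spec hm' fun p hp hpm => h p hp (Int.natCast_dvd.2 hpm)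
  rcases Int.natAbs_eq m with hmm | hmm
  · refine ⟨_, h1, h2, fun a => ?_⟩
    have h4 : m • a = m.natAbs • a := by rw [← natCast_zsmul, ← hmm]
    rw [h4]
    exact h3 a
  · refine ⟨_, Subgroup.mul_mem _ (Subgroup.subset_closure (Or.inl rfl)) h1, h2.neg, fun a => ?_⟩
    have h4 : m • a = -(m.natAbs • a) := by rw [← natCast_zsmul, ← neg_smul, ← hmm]
    rw [h4, sub_neg_eq_add, LinearEquiv.mul_apply, LinearEquiv.neg_apply, neg_add_eq_sub, ← neg_sub]
    exact (h3 a).neg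

/-- If γ acts on A/T as m/n, all prime divisors of m and n are in π_*(A), so some q, r in Q(A) act
there as n and m. Then γqr⁻¹ acts trivially on A/T, and only its inertiality remains. -/
theorem InertialEnd.exists_mul_mem_IAutOne (hA : ¬ IsAddTorsion A) {γ : AutGroup A}
    (hγ : InertialEnd γ.toAddEquiv.toAddMonoidHom) : ∃ q ∈ QAut A, γ * q ∈ IAutOne A := by
  obtain ⟨m, n, hn, hmn, ht⟩ := hγ.exists_isOfFinAddOrder_zsmul_sub hA
  have hm : m ≠ 0 := by
    rintro rfl
    refine hA fun x => ?_
    have := ht (γ⁻¹ x)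
    rw [zero_smul, sub_zero] at this
    have h1 : IsOfFinAddOrder (γ (γ⁻¹ x)) := isOfFinAddOrder_of_zsmul_isOfFinAddOrder hn.ne' this
    rwa [AutGroup.apply_inv_self] at h1
  have hpi : ∀ p : ℕ, p.Prime → (p : ℤ) ∣ m ∨ (p : ℤ) ∣ n → InPiStar A p :=
    fun p hp => hγ.inPiStar_of_dvd hA hmn ht hp
  obtain ⟨q, hq, hqin, hqt⟩ := exists_int_mulAut hn.ne' fun p hp h => hpi p hp (Or.inr h)
  obtain ⟨r, hr, hrin, hrt⟩ := exists_int_mulAut hm fun p hp h => hpi p hp (Or.inl h)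
  have hr' := (QAut A).inv_mem hr
  set ε : A →+ A := γ.toAddEquiv.toAddMonoidHom.comp q.toAddEquiv.toAddMonoidHom
    - r.toAddEquiv.toAddMonoidHom with hε
  have hεin : InertialEnd ε := (hγ.comp hqin).sub hrin
  have hεx : ∀ x, ε x = γ (q x) - r x := fun x => rfl
  have hεt : ∀ x, IsOfFinAddOrder (ε x) := by
    intro x
    have h1 := γ.isOfFinAddOrder_apply_iff.2 (hqt x)
    have h2 := isOfFinAddOrder_sub (h1.add (ht x)) (hrt x)
    rw [hεx]
    convert h2 using 1
    rw [map_sub, map_zsmul]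
    change _ = _ + (n • γ x - m • x) - _
    abel
  have hdiff : ∀ x, (γ * (q * r⁻¹)) x - x = r⁻¹ (ε x) := by
    intro x
    have hcent := Subgroup.mem_center_iff.1 (QAut_le_center A hr') (γ * q)
    rw [hεx, map_sub, AutGroup.inv_apply_self, ← mul_assoc, hcent]
    rfl
  refine ⟨q * r⁻¹, Subgroup.mul_mem _ hq hr', (mem_IAutOne_iff_inertialEnd _).2 ⟨?_, fun a => ?_⟩⟩
  · set δ : A →+ A := (r⁻¹).toAddEquiv.toAddMonoidHom.comp ε with hδ
    have hδin : InertialEnd δ := by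
      -- The inverse of r need not be inertial, but it preserves cyclic torsion subgroups and ε has
      -- torsion image, so r⁻¹ε(H) ≤ ε(H).
      refine hεin.of_map_le ?_
      rintro H _ ⟨x, hx, rfl⟩
      exact AddSubgroup.zmultiples_le_of_mem (AddSubgroup.mem_map_of_mem ε hx)
        (QAut_le_powerAutOn A hr' (ε x) trivial (hεt x))
    have heq : (γ * (q * r⁻¹) : AutGroup A).toAddEquiv.toAddMonoidHom
        = δ + (1 : ℤ) • AddMonoidHom.id A := by
      ext x
      change (γ * (q * r⁻¹)) x = r⁻¹ (ε x) + (1 : ℤ) • x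
      rw [← hdiff, one_smul, sub_add_cancel]
    rw [heq]
    exact hδin.add (InertialEnd.zsmul_id 1)
  · rw [hdiff]
    exact (AutGroup.isOfFinAddOrder_apply_iff _).2 (hεt a)

theorem IAutOne_sup_QAut (hA : ¬ IsAddTorsion A) : IAutOne A ⊔ QAut A = IAut A := by
  refine le_antisymm (sup_le ?_ (QAut_le_IAut A)) ?_
  · exact Subgroup.closure_mono fun γ hγ => hγ.1
  · rw [IAut, Subgroup.closure_le]
    intro γ hγ
    obtain ⟨q, hq, h⟩ := ((isInertial_iff_inertialEnd γ).1 hγ).exists_mul_mem_IAutOne hA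
    have := Subgroup.mul_mem_sup h ((QAut A).inv_mem hq)
    rwa [mul_inv_cancel_right] at this

theorem IAutOne_inf_QAut (hA : ¬ IsAddTorsion A) : IAutOne A ⊓ QAut A = ⊥ := by
  rw [eq_bot_iff]
  rintro q ⟨hq, hq'⟩
  exact eq_one_of_mem_QAut hA hq' ((mem_IAutOne_iff_inertialEnd q).1 hq).2

end Decomposition

theorem theoremB {A : Type*} [AddCommGroup A] (hA : ¬ IsAddTorsion A) :
    -- the inertial automorphisms acting trivially on `A / T(A)` form a group
    (∀ γ : AutGroup A, γ ∈ IAutOne A ↔ IsInertial γ ∧ ActsTriviallyModTorsion γ) ∧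
    -- `Q(A)` is central
    QAut A ≤ Subgroup.center (AutGroup A) ∧
    -- `Q(A)` is isomorphic to a multiplicative group of rationals, and its elements act on
    -- `A / T(A)` as multiplication by the corresponding rational numbers
    (∃ e : QAut A ≃* ratGroupPiStar A, ∀ (q : QAut A) (a : A),
      (((e q : ℚˣ) : ℚ).den • (q : AutGroup A) a) - (((e q : ℚˣ) : ℚ).num • a)
        ∈ AddCommGroup.torsion A) ∧
    -- `IAut(A)` is the internal direct product of `IAut₁(A)` and the central subgroup `Q(A)`
    IAutOne A ⊓ QAut A = ⊥ ∧
    IAutOne A ⊔ QAut A = IAut A ∧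
    -- the normal subgroup `Γ` of `IAut₁(A)`
    ∃ (Γ : Subgroup (IAutOne A)) (_ : Γ.Normal),
      IsLocallyFiniteGroup (IAutOne A ⧸ Γ) ∧
      (∀ x ∈ commutator Γ, ∀ y ∈ commutator Γ, x * y = y * x) ∧
      (∀ x ∈ commutator Γ, IsOfFinOrder x) ∧
      (∀ N : Subgroup Γ, N ≤ commutator Γ → N.Normal) := by
  refine ⟨mem_IAutOne_iff, QAut_le_center A, exists_mulEquiv_ratGroupPiStar hA,
    IAutOne_inf_QAut hA, IAutOne_sup_QAut hA, powerPart A, powerPart_normal A,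
    isLocallyFiniteGroup_quotient_powerPart A, fun x hx y hy => ?_, fun x hx => ?_,
    fun N hN => normal_of_le_commutator_powerPart hN⟩
  · exact Subtype.ext (Subtype.ext (finitaryStab.mul_comm (commutator_powerPart_le hx)
      (commutator_powerPart_le hy)))
  · have hinj : Function.Injective ((IAutOne A).subtype.comp (powerPart A).subtype) :=
      (IAutOne A).subtype_injective.comp (powerPart A).subtype_injective
    exact (hinj.isOfFinOrder_iff).1 (finitaryStab.isOfFinOrder (commutator_powerPart_le hx))
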